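/- **Setting.** Let $\Omega\subset\mathbb R^2$ be an open rectangle, and let $\Gamma$ be a simple regular $C^2$ curve ($C^3$ if $m\ge 3$) parametrized by $\mathbf g$ on $[\xi_s,\xi_e]$, either closed and contained in $\Omega$ (then $\mathbf g$ is extended periodically) or an arc of which only the end points may lie on $\partial\Omega$. Assume $\Omega\setminus\Gamma=\Omega^-\cup\Omega^+$ with $\Omega^\pm$ open and disjoint, $\Gamma=\overline{\Omega^-}\cap\overline{\Omega^+}$, and that the unit normal $\mathbf n$ (the unit tangent rotated by $-90^\circ$) points from $\Omega^-$ to $\Omega^+$. Let $\kappa$ be the signed curvature of $\Gamma$, and let $\delta>0$ be such that the Frenet map $P_\Gamma(\eta,\xi)=\mathbf g(\xi)+\eta\,\mathbf n(\xi)$ is injective (modulo the period, for a closed curve) with $1+\eta\kappa(\xi)>0$ for $|\eta|\le\delta$. Let $\beta=\beta^\pm$ on $\Omega^\pm$ with $0<\beta^-\le\beta^+$, and let $m\ge1$ and $\alpha\ge0$. Let $\mathcal T_h$ be a Cartesian rectangular mesh of $\Omega$ with mesh size $h=\max_K\operatorname{diam}K\le\delta$, such that $\Gamma$ meets each edge in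 at most one point unless the edge is part of $\Gamma$. Interface elements are those whose interior meets $\Gamma$. For an interface element $K$ let $a_K$ and $b_K$ be the least and the largest parameter of the points of $\Gamma$ closest to the vertices of $K$ (taken in one parameter interval on which $P_\Gamma$ is injective), and assume that $K\subset K_F:=P_\Gamma([-h,h]\times[a_K,b_K])$. Let $\mathring{\mathcal E}_h^s$ be the set of interior edges of interface elements. For an interior edge $B$ shared by $K_1$ and $K_2$ let $\mathbf n_B$ be its unit normal pointing from $K_1$ to $K_2$, $|B|$ its length, $[v]=v|_{K_1}-v|_{K_2}$ and $\{w\}=\frac12(w|_{K_1}+w|_{K_2})$. Let $Q_m$ be the polynomials of degree at most $m$ in each of the two variables. For an interface element $K$ let $\mathcal V^m_\beta(K)$ be the set of functions $\hat\phi\circ P_\Gamma^{-1}|_K$ such that $\hat\phi$ is in $Q_m$ separately on $\{\eta<0\}$ and $\{\eta>0\}$ and satisfies, for every polynomial $q$ of degree at most $m$, $$\int_{a_K}^{b_K}[\hat\phi]\,q\,d\xi=0,\qquad \int_{a_K}^{b_K}[\hat\beta\,\hat\phi_\eta]\,q\,d\xi=0,\qquad \int_{a_K}^{b_K}\big[\hat\beta\,\partial_\eta^j\mathcal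 L\hat\phi\big]\,q\,d\xi=0\quad(0\le j\le m-2),$$ where $[\cdot]$ is the jump across $\eta=0$, $\hat\beta=\beta\circ P_\Gamma$, and $\mathcal L$ is the Laplacian written in the coordinates $(\eta,\xi)$. The hybrid immersed finite element space $S_h^m(\Omega)$ consists of the piecewise functions $v$ with $v|_K\in Q_m$ on non-interface elements, $v|_K\in\mathcal V^m_\beta(K)$ and $v|_{K\cap\Omega^\pm}\in H^m$ on interface elements, $v$ continuous across each interior edge outside $\mathring{\mathcal E}_h^s$, and $v=0$ on $\partial\Omega$. For $\sigma_B^0\in\mathbb R$ ($B\in\mathring{\mathcal E}_h^s$) and $\epsilon\in\{-1,0,1\}$ put $$a_h(u,v)=\sum_{K}\int_K\beta\nabla u\cdot\nabla v\,dX-\sum_{B\in\mathring{\mathcal E}_h^s}\int_B\{\beta\nabla u\cdot\mathbf n_B\}[v]\,ds+\epsilon\sum_{B\in\mathring{\mathcal E}_h^s}\int_B\{\beta\nabla v\cdot\mathbf n_B\}[u]\,ds+\sum_{B\in\mathring{\mathcal E}_h^s}\int_B\frac{\sigma_B^0}{|B|^\alpha}[u][v]\,ds .$$ The selective discontinuous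 Galerkin (SDG) scheme for $f\in L^2(\Omega)$ is: find $u_h\in S_h^m(\Omega)$ with $a_h(u_h,v_h)=(f,v_h)$ for all $v_h\in S_h^m(\Omega)$. **Theorem.** 1. If $\epsilon=1$, then for all $\sigma_B^0>0$ and every $f\in L^2(\Omega)$ the SDG scheme has a unique solution $u_h\in S_h^m(\Omega)$. 2. If $\epsilon=0$ or $\epsilon=-1$, the same holds whenever the $\sigma_B^0$ are large enough. More precisely, for every $c>0$ there is a constant $C>0$, depending only on $\Omega$, $\Gamma$ (with $\Omega^\pm$ and $\delta$), $m$, $\alpha$ and $c$, such that for every such mesh whose edges all have length at least $c\,h$, all $0<\beta^-\le\beta^+$ and every $f\in L^2(\Omega)$, the SDG scheme has a unique solution as soon as $$\sigma_B^0\ \ge\ C\,\max\{1,h^{\alpha-1}\}\,\frac{(\beta^+)^2}{\beta^-}\qquad\text{for all }B\in\mathring{\mathcal E}_h^s .$$ In particular, for $\alpha\ge1$ and $h\le1$ the threshold is $C(\beta^+)^2/\beta^-$, independent of the mesh size and of the position of the interface relative to the mesh. -/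

import Mathlib

open MeasureTheory Set
open scoped ContDiff

noncomputable section

namespace SDG

/-- The Euclidean plane. -/
abbrev Pt : Type := EuclideanSpace ℝ (Fin 2)

/-! Geometry of the interface -/

/-- Unit tangent vector of the parametrized curve `g`. -/
def tangent (g : ℝ → Pt) (ξ : ℝ) : Pt := ‖deriv g ξ‖⁻¹ • deriv g ξ

/-- Unit normal vector: the tangent rotated by the matrix `[[0, 1], [-1, 0]]`. -/
def normal (g : ℝ → Pt) (ξ : ℝ) : Pt := !₂[tangent g ξ 1, -(tangent g ξ 0)]

/-- Signed curvature. -/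
def curvature (g : ℝ → Pt) (ξ : ℝ) : ℝ :=
  (deriv g ξ 0 * deriv (deriv g) ξ 1 - deriv g ξ 1 * deriv (deriv g) ξ 0) / ‖deriv g ξ‖ ^ 3

/-- The Frenet map `P(η, ξ) = g(ξ) + η n(ξ)`. -/
def frenet (g : ℝ → Pt) (z : ℝ × ℝ) : Pt := g z.2 + z.1 • normal g z.2

/-- A nondegenerate axis-parallel rectangle. -/
structure Rect where
  x₀ : ℝ
  x₁ : ℝ
  y₀ : ℝ
  y₁ : ℝ
  hx : x₀ < x₁
  hy : y₀ < y₁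

/-- The open rectangular domain. -/
def Rect.dom (Q : Rect) : Set Pt := {p | p 0 ∈ Ioo Q.x₀ Q.x₁ ∧ p 1 ∈ Ioo Q.y₀ Q.y₁}

/-- A simple regular `C²` interface curve, with a tubular neighbourhood of half-width `δ`, that
splits the rectangular domain into two subdomains.  The curve is parametrized by `[ξs, ξe]`; it is
either a closed curve in the domain, whose parametrization is then extended periodically to the
line (`params = univ`), or an arc of which only the end points may lie on the boundary of the
domain (`params = [ξs, ξe]`; `C²` up to the end points, so `g` is a restriction of a `C²` map). -/
structure Interface (Q : Rect) where
  g : ℝ → Pt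
  ξs : ℝ
  ξe : ℝ
  lt : ξs < ξe
  params : Set ℝ
  δ : ℝ
  δ_pos : 0 < δ
  smooth : ContDiff ℝ 2 g
  regular : ∀ ξ ∈ params, deriv g ξ ≠ 0
  /-- The curve is simple, and the Frenet map is a bijection onto the tubular neighbourhood. -/
  tube :
    (params = univ ∧ Function.Periodic g (ξe - ξs) ∧ (∀ ξ, g ξ ∈ Q.dom) ∧
      InjOn (frenet g) (Icc (-δ) δ ×ˢ Ico ξs ξe)) ∨
    (params = Icc ξs ξe ∧ (∀ ξ ∈ Ioo ξs ξe, g ξ ∈ Q.dom) ∧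
      InjOn (frenet g) (Icc (-δ) δ ×ˢ Icc ξs ξe))
  /-- The Jacobian factor `1 + η κ` of the Frenet map does not degenerate on the tube. -/
  jacobian_pos : ∀ η ∈ Icc (-δ) δ, ∀ ξ ∈ params, 0 < 1 + η * curvature g ξ
  Ωm : Set Pt
  Ωp : Set Pt
  isOpen_Ωm : IsOpen Ωm
  isOpen_Ωp : IsOpen Ωp
  disjoint : Disjoint Ωm Ωp
  split : Q.dom \ g '' params = Ωm ∪ Ωp
  common : g '' params = closure Ωm ∩ closure Ωp
  /-- The normal points from `Ωm` to `Ωp`. -/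
  orient : ∀ ξ ∈ params, g ξ ∈ Q.dom →
    ∃ r > 0, ∀ η ∈ Ioo 0 r, frenet g (-η, ξ) ∈ Ωm ∧ frenet g (η, ξ) ∈ Ωp

variable {Q : Rect}

/-- The interface as a set. -/
def Interface.Γ (S : Interface Q) : Set Pt := S.g '' S.params

/-! Cartesian meshes -/

/-- A Cartesian mesh of the rectangle, with `nx + 1` columns and `ny + 1` rows. -/
structure Mesh (Q : Rect) where
  nx : ℕ
  ny : ℕ
  x : Fin (nx + 2) → ℝ
  y : Fin (ny + 2) → ℝ
  x_mono : StrictMono x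
  y_mono : StrictMono y
  x_first : x 0 = Q.x₀
  x_last : x (Fin.last _) = Q.x₁
  y_first : y 0 = Q.y₀
  y_last : y (Fin.last _) = Q.y₁

namespace Mesh

variable (T : Mesh Q)

/-- Indices of the elements. -/
abbrev Elt : Type := Fin (T.nx + 1) × Fin (T.ny + 1)

/-- The closed rectangle with index `K`. -/
def cell (K : T.Elt) : Set Pt :=
  {p | p 0 ∈ Icc (T.x K.1.castSucc) (T.x K.1.succ) ∧
    p 1 ∈ Icc (T.y K.2.castSucc) (T.y K.2.succ)}

/-- The four vertices of an element. -/
def vertex (K : T.Elt) : Fin 4 → Pt :=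
  ![!₂[T.x K.1.castSucc, T.y K.2.castSucc], !₂[T.x K.1.succ, T.y K.2.castSucc],
    !₂[T.x K.1.succ, T.y K.2.succ], !₂[T.x K.1.castSucc, T.y K.2.succ]]

/-- The mesh size: the largest diameter of an element. -/
def h : ℝ := ⨆ K : T.Elt, Metric.diam (T.cell K)

/-- Every edge of the mesh has length at least `c` times the mesh size. -/
def QuasiUniform (c : ℝ) : Prop :=
  (∀ i : Fin (T.nx + 1), c * T.h ≤ T.x i.succ - T.x i.castSucc) ∧
  (∀ j : Fin (T.ny + 1), c * T.h ≤ T.y j.succ - T.y j.castSucc)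

/-- All vertical edges, as sets. -/
def vEdge (i : Fin (T.nx + 2)) (j : Fin (T.ny + 1)) : Set Pt :=
  {p | p 0 = T.x i ∧ p 1 ∈ Icc (T.y j.castSucc) (T.y j.succ)}

/-- All horizontal edges, as sets. -/
def hEdge (i : Fin (T.nx + 1)) (j : Fin (T.ny + 2)) : Set Pt :=
  {p | p 0 ∈ Icc (T.x i.castSucc) (T.x i.succ) ∧ p 1 = T.y j}

/-- Interior edges: vertical ones (between horizontal neighbours) and horizontal ones (between
vertical neighbours). -/
abbrev Edge : Type := (Fin T.nx × Fin (T.ny + 1)) ⊕ (Fin (T.nx + 1) × Fin T.ny)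

variable {T}

/-- The first element adjacent to an interior edge (left, respectively below). -/
def Edge.fst : T.Edge → T.Elt
  | .inl e => (e.1.castSucc, e.2)
  | .inr e => (e.1, e.2.castSucc)

/-- The second element adjacent to an interior edge (right, respectively above). -/
def Edge.snd : T.Edge → T.Elt
  | .inl e => (e.1.succ, e.2)
  | .inr e => (e.1, e.2.succ)

/-- The unit normal of an interior edge, pointing from the first to the second element. -/
def Edge.normal : T.Edge → Pt
  | .inl _ => !₂[1, 0]
  | .inr _ => !₂[0, 1]

/-- Start of the parameter interval of an edge. -/
def Edge.lo : T.Edge → ℝ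
  | .inl e => T.y e.2.castSucc
  | .inr e => T.x e.1.castSucc

/-- End of the parameter interval of an edge. -/
def Edge.hi : T.Edge → ℝ
  | .inl e => T.y e.2.succ
  | .inr e => T.x e.1.succ

/-- Arc length parametrization of an interior edge over `[lo, hi]`. -/
def Edge.pt : T.Edge → ℝ → Pt
  | .inl e, t => !₂[T.x e.1.castSucc.succ, t]
  | .inr e, t => !₂[t, T.y e.2.castSucc.succ]

/-- The length of an edge. -/
def Edge.length (B : T.Edge) : ℝ := B.hi - B.lo

/-- An interior edge as a set. -/
def Edge.carrier (B : T.Edge) : Set Pt := B.pt '' Icc B.lo B.hi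

/-- Integral over an edge with respect to arc length. -/
def Edge.integral (B : T.Edge) (F : Pt → ℝ) : ℝ := ∫ t in B.lo..B.hi, F (B.pt t)

variable (T) (S : Interface Q)

/-- Interface elements: those whose interior meets the interface. -/
def IsInterfaceElt (K : T.Elt) : Prop := (interior (T.cell K) ∩ S.Γ).Nonempty

/-- The interior edges of the interface elements. -/
def IsSEdge (B : T.Edge) : Prop := T.IsInterfaceElt S B.fst ∨ T.IsInterfaceElt S B.snd

open Classical in
/-- The finite set of interior edges of interface elements. -/
def sEdges : Finset T.Edge := Finset.univ.filter (T.IsSEdge S)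

/-- `[a, b]` is the parameter interval of the fictitious element of `K`: `a` and `b` are the least
and the largest parameters of the points of the interface closest to the vertices of `K`, and `K`
lies in the injective image `P([-h, h] × [a, b])`.  (For an arc `[a, b]` is unique; for a closed
curve it is unique up to a shift by periods.) -/
def IsFictitiousInterval (K : T.Elt) (a b : ℝ) : Prop :=
  Icc a b ⊆ S.params ∧
  (∃ ξ : Fin 4 → ℝ,
    (∀ i, ξ i ∈ S.params ∧ ‖T.vertex K i - S.g (ξ i)‖ = Metric.infDist (T.vertex K i) S.Γ) ∧
    IsLeast (range ξ) a ∧ IsGreatest (range ξ) b) ∧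
  InjOn (frenet S.g) (Icc (-T.h) T.h ×ˢ Icc a b) ∧
  T.cell K ⊆ frenet S.g '' (Icc (-T.h) T.h ×ˢ Icc a b)

/-- The mesh is fine enough for the interface: the interface meets each edge in at most one point
unless the edge is part of the interface, the mesh size is at most the half-width of the tube, and
every interface element lies in its fictitious element. -/
structure Admissible : Prop where
  vEdge : ∀ i j, (S.Γ ∩ T.vEdge i j).Subsingleton ∨ T.vEdge i j ⊆ S.Γ
  hEdge : ∀ i j, (S.Γ ∩ T.hEdge i j).Subsingleton ∨ T.hEdge i j ⊆ S.Γ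
  h_le : T.h ≤ S.δ
  fictitious : ∀ K, T.IsInterfaceElt S K → ∃ a b, T.IsFictitiousInterval S K a b

end Mesh

/-! Local spaces -/

/-- The polynomial of degree at most `m` in each of two variables with coefficients `c`. -/
def qEval (m : ℕ) (c : Fin (m + 1) → Fin (m + 1) → ℝ) (s t : ℝ) : ℝ :=
  ∑ i, ∑ j, c i j * s ^ (i : ℕ) * t ^ (j : ℕ)

/-- `ψ(η, ξ) = (1 + η κ(ξ))⁻¹`. -/
def psi (g : ℝ → Pt) (η ξ : ℝ) : ℝ := (1 + η * curvature g ξ)⁻¹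

/-- The Laplacian in the Frenet coordinates `(η, ξ)`. -/
def frenetLaplacian (g : ℝ → Pt) (U : ℝ → ℝ → ℝ) (η ξ : ℝ) : ℝ :=
  iteratedDeriv 2 (fun s => U s ξ) η
  + (psi g η ξ / ‖deriv g ξ‖) ^ 2 * iteratedDeriv 2 (fun t => U η t) ξ
  + curvature g ξ * psi g η ξ * deriv (fun s => U s ξ) η
  - (psi g η ξ / ‖deriv g ξ‖) ^ 2 *
      (η * deriv (curvature g) ξ * psi g η ξ
        + inner ℝ (deriv g ξ) (deriv (deriv g) ξ) / ‖deriv g ξ‖ ^ 2) *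
      deriv (fun t => U η t) ξ

/-- The interface conditions on `{0} × [a, b]` for the pair of polynomials with coefficients `cm`
(on the side `η < 0`) and `cp` (on the side `η > 0`), tested with the polynomials of degree at most
`m`.  As the first two jumps are themselves polynomials of degree at most `m`, they vanish. -/
structure JumpConditions (g : ℝ → Pt) (m : ℕ) (βm βp a b : ℝ)
    (cm cp : Fin (m + 1) → Fin (m + 1) → ℝ) : Prop where
  value : ∀ q : Polynomial ℝ, q.natDegree ≤ m →
    ∫ ξ in a..b, (qEval m cp 0 ξ - qEval m cm 0 ξ) * q.eval ξ = 0
  flux : ∀ q : Polynomial ℝ, q.natDegree ≤ m →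
    ∫ ξ in a..b, (βp * deriv (fun η => qEval m cp η ξ) 0
      - βm * deriv (fun η => qEval m cm η ξ) 0) * q.eval ξ = 0
  laplacian : ∀ j : ℕ, j + 2 ≤ m → ∀ q : Polynomial ℝ, q.natDegree ≤ m →
    ∫ ξ in a..b, (βp * iteratedDeriv j (fun η => frenetLaplacian g (qEval m cp) η ξ) 0
      - βm * iteratedDeriv j (fun η => frenetLaplacian g (qEval m cm) η ξ) 0) * q.eval ξ = 0

/-- Partial derivative in the coordinate direction `k`. -/
def partialDeriv (k : Fin 2) (φ : Pt → ℝ) (x : Pt) : ℝ :=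
  fderiv ℝ φ x (EuclideanSpace.single k 1)

/-- `v` belongs to the Sobolev space `H^m(U)` of the open set `U`: it and its weak derivatives of
order at most `m` are square integrable on `U`. -/
def MemSobolev (m : ℕ) (U : Set Pt) (v : Pt → ℝ) : Prop :=
  MemLp v 2 (volume.restrict U) ∧
  ∀ i j : ℕ, i + j ≤ m → ∃ w : Pt → ℝ, MemLp w 2 (volume.restrict U) ∧
    ∀ φ : Pt → ℝ, ContDiff ℝ ∞ φ → HasCompactSupport φ → tsupport φ ⊆ U →
      ∫ x in U, v x * ((partialDeriv 0)^[i] ((partialDeriv 1)^[j] φ)) x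
        = (-1) ^ (i + j) * ∫ x in U, w x * φ x

section Scheme

variable (T : Mesh Q) (S : Interface Q) (m : ℕ) (βm βp : ℝ)

/-- `v` is in `Q_m(K)` on the element `K`. -/
def IsLocalPoly (K : T.Elt) (v : Pt → ℝ) : Prop :=
  ∃ c, ∀ p ∈ T.cell K, v p = qEval m c (p 0) (p 1)

/-- `v` is in the local Frenet immersed finite element space on the interface element `K`: in Frenet
coordinates it is a polynomial on each side of the interface, subject to the interface conditions
on the fictitious element.  (The choice among the shifted intervals `[a, b]` does not matter.) -/
def IsLocalIFE (K : T.Elt) (v : Pt → ℝ) : Prop :=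
  ∀ a b, T.IsFictitiousInterval S K a b →
    ∃ cm cp, JumpConditions S.g m βm βp a b cm cp ∧
      ∀ η ∈ Icc (-T.h) T.h, ∀ ξ ∈ Icc a b, frenet S.g (η, ξ) ∈ T.cell K →
        v (frenet S.g (η, ξ)) = if η < 0 then qEval m cm η ξ else qEval m cp η ξ

/-- The global hybrid immersed finite element space.  A piecewise function is the family of its
restrictions to the closed elements (two-valued on interior edges); each restriction is extended by
zero, so that equality of families is equality on the elements. -/
structure IsHIFE (v : T.Elt → Pt → ℝ) : Prop where
  support : ∀ K, ∀ p ∉ T.cell K, v K p = 0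
  nonInterface : ∀ K, ¬ T.IsInterfaceElt S K → IsLocalPoly T m K (v K)
  immersed : ∀ K, T.IsInterfaceElt S K → IsLocalIFE T S m βm βp K (v K)
  sobolev : ∀ K, T.IsInterfaceElt S K →
    MemSobolev m (interior (T.cell K) ∩ S.Ωm) (v K) ∧
    MemSobolev m (interior (T.cell K) ∩ S.Ωp) (v K)
  continuous : ∀ B : T.Edge, ¬ T.IsSEdge S B → ∀ p ∈ B.carrier, v B.fst p = v B.snd p
  boundary : ∀ K, ∀ p ∈ T.cell K, p ∈ frontier Q.dom → v K p = 0

open Classical in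
/-- The coefficient `β` on the element `K`, with its one-sided values on the boundary of `K`. -/
def coeff (K : T.Elt) (p : Pt) : ℝ :=
  if p ∈ closure (interior (T.cell K) ∩ S.Ωm) then βm else βp

/-- The gradient of `v` on the element `K`, one-sided on the boundary of `K`. -/
def grad (K : T.Elt) (v : T.Elt → Pt → ℝ) (p : Pt) : Pt := gradientWithin (v K) (T.cell K) p

variable {T}

/-- The jump of `v` across an interior edge. -/
def jump (v : T.Elt → Pt → ℝ) (B : T.Edge) (p : Pt) : ℝ := v B.fst p - v B.snd p

/-- The average of the fluxes `β ∇v · n` on an interior edge. -/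
def avgFlux (v : T.Elt → Pt → ℝ) (B : T.Edge) (p : Pt) : ℝ :=
  (coeff T S βm βp B.fst p * inner ℝ (grad T B.fst v p) B.normal
    + coeff T S βm βp B.snd p * inner ℝ (grad T B.snd v p) B.normal) / 2

/-- The bilinear form of the selective discontinuous Galerkin scheme. -/
def bilin (ε α : ℝ) (σ : T.Edge → ℝ) (u v : T.Elt → Pt → ℝ) : ℝ :=
  (∑ K : T.Elt, ∫ p in T.cell K,
      coeff T S βm βp K p * inner ℝ (grad T K u p) (grad T K v p))
  - (∑ B ∈ T.sEdges S, B.integral fun p => avgFlux S βm βp u B p * jump v B p)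
  + ε * (∑ B ∈ T.sEdges S, B.integral fun p => avgFlux S βm βp v B p * jump u B p)
  + ∑ B ∈ T.sEdges S, B.integral fun p => σ B / B.length ^ α * jump u B p * jump v B p

/-- The load functional `(f, v)`. -/
def load (f : Pt → ℝ) (v : T.Elt → Pt → ℝ) : ℝ :=
  ∑ K : T.Elt, ∫ p in T.cell K, f p * v K p

/-- `u` solves the selective discontinuous Galerkin scheme. -/
def IsSolution (ε α : ℝ) (σ : T.Edge → ℝ) (f : Pt → ℝ) (u : T.Elt → Pt → ℝ) : Prop :=
  IsHIFE T S m βm βp u ∧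
    ∀ v, IsHIFE T S m βm βp v → bilin S βm βp ε α σ u v = load f v

end Scheme

end SDG

end

noncomputable section

namespace SDG

section

/-! ### Polynomials of bounded degree in each variable -/

/-! The discrete space is finite-dimensional and the form is bilinear on it, so unique solvability
for every load reduces to definiteness: `bilin v v = 0` must force `v = 0`
(`existsUnique_of_definite`). On the diagonal the form is the broken energy, minus `1 - ε` times the
sum of the flux-jump integrals, plus the penalty. For `ε = 1` the flux terms cancel. For the other
two values they are absorbed by Young's inequality, half of the energy and half of the penalty being
spent. In all cases energies and penalty terms then vanish, so `v` is constant on each element, has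
no jumps, and is zero on the boundary, hence zero (`eq_zero_of_energy_eq_zero`).

The absorption rests on a flux bound (`Interface.exists_flux_bound`): at every point of an element
the squared flux `|β ∇v| ^ 2` is at most `C βp ^ 2 / h ^ 2` times the integral of `|∇v| ^ 2` over
the element, where `C` depends neither on the position of the curve in the element nor on `βm`,
`βp`. Integration over an edge gives one factor `h` back. Since the energy carries at least the
weight `βm`, a penalty of order `βp ^ 2 / (βm h)` per unit length suffices, which is the stated
threshold.

On an interface element the curve may cut off an arbitrarily thin piece, over which the energy says
nothing useful. The larger side, however, has at least half of the area of the element. A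
compactness argument of Remez type (`exists_seminorm_sq_le_integral`) shows that the energy over any
subset of that relative size controls all non-constant coefficients of the polynomial on that side.

The interface conditions carry the bound to the other side (`Interface.exists_transfer`). With `e =
βp cp - βm cm`, continuity makes row zero of `e` (the part of order zero in the normal variable)
equal to `βp - βm` times row zero of either side; flux continuity kills row one; and the condition
on the normal derivative of order `j` of the Laplacian determines row `j + 2` from the lower rows,
because its leading term is `(j + 2)!` times that row (`Interface.frenetLaplacian_expansion`). Hence
`e` is bounded by `βp` times either side, and the ratio `βp / βm` never enters.

These estimates live in Frenet coordinates scaled by `h` and by the length `b - a` of the parameter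
interval. The two scales are comparable: `Interface.exists_length_le` uses the geometry of the
curve, `Interface.exists_le_length` compares areas. A topological argument (`mem_side`) identifies
the sign of the normal coordinate with the side of the interface, so that the one-sided gradients of
the scheme are those of the two polynomial pieces. -/

/-- Coefficient arrays of the polynomials of degree at most `m` in each of two variables. -/
abbrev Coef (m : ℕ) : Type := Fin (m + 1) → Fin (m + 1) → ℝ

/-- The coefficient of the `i`-th power of the first variable. -/
def row {m : ℕ} (c : Coef m) (i : Fin (m + 1)) : Polynomial ℝ :=
  ∑ j, Polynomial.C (c i j) * Polynomial.X ^ (j : ℕ)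

theorem row_eval {m : ℕ} (c : Coef m) (i : Fin (m + 1)) (t : ℝ) :
    (row c i).eval t = ∑ j, c i j * t ^ (j : ℕ) := by
  simp [row, Polynomial.eval_finsetSum]

theorem row_coeff {m : ℕ} (c : Coef m) (i j : Fin (m + 1)) : (row c i).coeff j = c i j := by
  simp only [row, Polynomial.finsetSum_coeff, Polynomial.coeff_C_mul, Polynomial.coeff_X_pow]
  rw [Finset.sum_eq_single j]
  · simp
  · intro b _ hb
    have : (j : ℕ) ≠ b := fun h => hb (Fin.ext h.symm)
    simp [this]
  · simp

theorem row_natDegree_le {m : ℕ} (c : Coef m) (i : Fin (m + 1)) : (row c i).natDegree ≤ m := by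
  refine Polynomial.natDegree_sum_le_of_forall_le _ _ fun j _ => ?_
  exact (Polynomial.natDegree_C_mul_X_pow_le _ _).trans (Nat.lt_succ_iff.1 j.2)

theorem qEval_eq_sum_row {m : ℕ} (c : Coef m) (s t : ℝ) :
    qEval m c s t = ∑ i : Fin (m + 1), s ^ (i : ℕ) * (row c i).eval t := by
  simp only [qEval, row_eval, Finset.mul_sum]
  exact Finset.sum_congr rfl fun i _ => Finset.sum_congr rfl fun j _ => by ring

theorem row_add {m : ℕ} (c d : Coef m) (i : Fin (m + 1)) :
    row (c + d) i = row c i + row d i := by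
  simp [row, add_mul, Finset.sum_add_distrib]

theorem row_smul {m : ℕ} (r : ℝ) (c : Coef m) (i : Fin (m + 1)) :
    row (r • c) i = Polynomial.C r * row c i := by
  simp [row, Finset.mul_sum, mul_assoc]

theorem eval_eq_sum_fin {m : ℕ} {p : Polynomial ℝ} (hp : p.natDegree ≤ m) (t : ℝ) :
    p.eval t = ∑ j : Fin (m + 1), p.coeff j * t ^ (j : ℕ) := by
  rw [Polynomial.eval_eq_sum_range' (Nat.lt_succ_of_le hp), Finset.sum_range]

theorem eq_of_coeff_le {m : ℕ} {p q : Polynomial ℝ} (hp : p.natDegree ≤ m) (hq : q.natDegree ≤ m)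
    (h : ∀ j : Fin (m + 1), p.coeff j = q.coeff j) : p = q := by
  ext j
  by_cases hj : j ≤ m
  · exact h ⟨j, Nat.lt_succ_of_le hj⟩
  · rw [Polynomial.coeff_eq_zero_of_natDegree_lt (by omega),
      Polynomial.coeff_eq_zero_of_natDegree_lt (by omega)]

/-- First partial derivative of `qEval m c`. -/
def dS (m : ℕ) (c : Coef m) (s t : ℝ) : ℝ :=
  ∑ i : Fin (m + 1), ∑ j : Fin (m + 1), c i j * ((i : ℕ) * s ^ ((i : ℕ) - 1)) * t ^ (j : ℕ)

/-- Second partial derivative of `qEval m c`. -/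
def dT (m : ℕ) (c : Coef m) (s t : ℝ) : ℝ :=
  ∑ i : Fin (m + 1), ∑ j : Fin (m + 1), c i j * s ^ (i : ℕ) * ((j : ℕ) * t ^ ((j : ℕ) - 1))

theorem qEval_hasFDerivAt (m : ℕ) (c : Coef m) (z : ℝ × ℝ) :
    HasFDerivAt (fun z : ℝ × ℝ => qEval m c z.1 z.2)
      (dS m c z.1 z.2 • ContinuousLinearMap.fst ℝ ℝ ℝ
        + dT m c z.1 z.2 • ContinuousLinearMap.snd ℝ ℝ ℝ) z := by
  unfold qEval dS dT
  rw [Finset.sum_smul, Finset.sum_smul, ← Finset.sum_add_distrib]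
  refine HasFDerivAt.fun_sum fun i _ => ?_
  rw [Finset.sum_smul, Finset.sum_smul, ← Finset.sum_add_distrib]
  refine HasFDerivAt.fun_sum fun j _ => ?_
  have h1 : HasFDerivAt (fun z : ℝ × ℝ => z.1) (ContinuousLinearMap.fst ℝ ℝ ℝ) z := hasFDerivAt_fst
  have h2 : HasFDerivAt (fun z : ℝ × ℝ => z.2) (ContinuousLinearMap.snd ℝ ℝ ℝ) z := hasFDerivAt_snd
  have h := ((h1.pow i).const_mul (c i j)).mul (h2.pow j)
  refine h.congr_fderiv ?_
  ext <;> simp <;> ring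

theorem qEval_continuous (m : ℕ) (c : Coef m) : Continuous fun z : ℝ × ℝ => qEval m c z.1 z.2 := by
  unfold qEval; fun_prop

theorem dS_continuous (m : ℕ) :
    Continuous fun x : Coef m × ℝ × ℝ => dS m x.1 x.2.1 x.2.2 := by
  unfold dS; fun_prop

theorem dT_continuous (m : ℕ) :
    Continuous fun x : Coef m × ℝ × ℝ => dT m x.1 x.2.1 x.2.2 := by
  unfold dT; fun_prop

theorem qEval_add (m : ℕ) (c d : Coef m) (s t : ℝ) :
    qEval m (c + d) s t = qEval m c s t + qEval m d s t := by
  simp [qEval, add_mul, Finset.sum_add_distrib]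

theorem qEval_smul (m : ℕ) (r : ℝ) (c : Coef m) (s t : ℝ) :
    qEval m (r • c) s t = r * qEval m c s t := by
  simp [qEval, Finset.mul_sum, mul_assoc]

/-- Sum of the absolute values of the coefficients other than the constant one. -/
def seminorm {m : ℕ} (c : Coef m) : ℝ :=
  ∑ i : Fin (m + 1), ∑ j : Fin (m + 1), if (i : ℕ) = 0 ∧ (j : ℕ) = 0 then 0 else |c i j|

theorem seminorm_nonneg {m : ℕ} (c : Coef m) : 0 ≤ seminorm c :=
  Finset.sum_nonneg fun i _ => Finset.sum_nonneg fun j _ => by split_ifs <;> positivity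

theorem abs_le_seminorm {m : ℕ} (c : Coef m) (i j : Fin (m + 1)) (h : ¬ ((i : ℕ) = 0 ∧ (j : ℕ) = 0)) :
    |c i j| ≤ seminorm c := by
  have h0 : ∀ i j : Fin (m + 1), 0 ≤ if (i : ℕ) = 0 ∧ (j : ℕ) = 0 then (0 : ℝ) else |c i j| :=
    fun i j => by split_ifs <;> positivity
  calc |c i j| = if (i : ℕ) = 0 ∧ (j : ℕ) = 0 then 0 else |c i j| := by rw [if_neg h]
    _ ≤ ∑ j : Fin (m + 1), if (i : ℕ) = 0 ∧ (j : ℕ) = 0 then 0 else |c i j| :=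
      Finset.single_le_sum (f := fun j : Fin (m + 1) =>
        if (i : ℕ) = 0 ∧ (j : ℕ) = 0 then (0 : ℝ) else |c i j|) (fun j _ => h0 i j)
        (Finset.mem_univ j)
    _ ≤ seminorm c :=
      Finset.single_le_sum (f := fun i : Fin (m + 1) => ∑ j : Fin (m + 1),
        if (i : ℕ) = 0 ∧ (j : ℕ) = 0 then (0 : ℝ) else |c i j|)
        (fun i _ => Finset.sum_nonneg fun j _ => h0 i j) (Finset.mem_univ i)

theorem abs_pow_le_one {s : ℝ} (hs : |s| ≤ 1) (n : ℕ) : |s ^ n| ≤ 1 := by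
  rw [abs_pow]; exact pow_le_one₀ (abs_nonneg _) hs

theorem abs_dS_le {m : ℕ} (c : Coef m) {s t : ℝ} (hs : |s| ≤ 1) (ht : |t| ≤ 1) :
    |dS m c s t| ≤ m * seminorm c := by
  unfold dS seminorm
  rw [Finset.mul_sum]
  refine (Finset.abs_sum_le_sum_abs _ _).trans (Finset.sum_le_sum fun i _ => ?_)
  rw [Finset.mul_sum]
  refine (Finset.abs_sum_le_sum_abs _ _).trans (Finset.sum_le_sum fun j _ => ?_)
  split_ifs with h
  · simp [h.1]
  · have hi : ((i : ℕ) : ℝ) ≤ m := by exact_mod_cast Nat.lt_succ_iff.1 i.2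
    rw [abs_mul, abs_mul, abs_mul, Nat.abs_cast]
    calc |c i j| * ((i : ℕ) * |s ^ ((i : ℕ) - 1)|) * |t ^ (j : ℕ)|
        ≤ |c i j| * ((m : ℝ) * 1) * 1 := by
          gcongr
          · exact abs_pow_le_one hs _
          · exact abs_pow_le_one ht _
      _ = m * |c i j| := by ring

theorem abs_dT_le {m : ℕ} (c : Coef m) {s t : ℝ} (hs : |s| ≤ 1) (ht : |t| ≤ 1) :
    |dT m c s t| ≤ m * seminorm c := by
  unfold dT seminorm
  rw [Finset.mul_sum]
  refine (Finset.abs_sum_le_sum_abs _ _).trans (Finset.sum_le_sum fun i _ => ?_)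
  rw [Finset.mul_sum]
  refine (Finset.abs_sum_le_sum_abs _ _).trans (Finset.sum_le_sum fun j _ => ?_)
  split_ifs with h
  · simp [h.2]
  · have hi : ((j : ℕ) : ℝ) ≤ m := by exact_mod_cast Nat.lt_succ_iff.1 j.2
    rw [abs_mul, abs_mul, abs_mul, Nat.abs_cast]
    calc |c i j| * |s ^ (i : ℕ)| * ((j : ℕ) * |t ^ ((j : ℕ) - 1)|)
        ≤ |c i j| * 1 * ((m : ℝ) * 1) := by
          gcongr
          · exact abs_pow_le_one hs _
          · exact abs_pow_le_one ht _
      _ = m * |c i j| := by ring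

/-! ### Affine changes of variables -/

/-- Coefficients of `qEval m c (h * s) (a + l * t)` as a polynomial in `s` and `t`. -/
def rescale {m : ℕ} (h a l : ℝ) (c : Coef m) : Coef m := fun i j =>
  h ^ (i : ℕ) * ((row c i).comp (Polynomial.C a + Polynomial.C l * Polynomial.X)).coeff j

theorem comp_affine_natDegree_le {m : ℕ} {p : Polynomial ℝ} (hp : p.natDegree ≤ m) (a l : ℝ) :
    (p.comp (Polynomial.C a + Polynomial.C l * Polynomial.X)).natDegree ≤ m := by
  refine Polynomial.natDegree_comp_le.trans ?_
  have : (Polynomial.C a + Polynomial.C l * Polynomial.X : Polynomial ℝ).natDegree ≤ 1 := by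
    compute_degree
  calc _ ≤ m * 1 := Nat.mul_le_mul hp this
    _ = m := mul_one _

theorem row_rescale {m : ℕ} (h a l : ℝ) (c : Coef m) (i : Fin (m + 1)) :
    row (rescale h a l c) i = Polynomial.C (h ^ (i : ℕ)) *
      (row c i).comp (Polynomial.C a + Polynomial.C l * Polynomial.X) := by
  refine eq_of_coeff_le (m := m) (row_natDegree_le _ _) ?_ fun j => ?_
  · exact (Polynomial.natDegree_C_mul_le _ _).trans
      (comp_affine_natDegree_le (row_natDegree_le _ _) _ _)
  · rw [row_coeff, Polynomial.coeff_C_mul, rescale]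

theorem qEval_rescale {m : ℕ} (h a l : ℝ) (c : Coef m) (s t : ℝ) :
    qEval m (rescale h a l c) s t = qEval m c (h * s) (a + l * t) := by
  simp only [qEval_eq_sum_row, row_rescale]
  refine Finset.sum_congr rfl fun i _ => ?_
  simp only [Polynomial.eval_mul, Polynomial.eval_C, Polynomial.eval_comp, Polynomial.eval_add,
    Polynomial.eval_X]
  ring

theorem qEval_swap {m : ℕ} (c : Coef m) (s t : ℝ) :
    qEval m (fun i j => c j i) s t = qEval m c t s := by
  unfold qEval
  rw [Finset.sum_comm]
  exact Finset.sum_congr rfl fun i _ => Finset.sum_congr rfl fun j _ => by ring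

/-- `rescale` moves and stretches the second variable but only stretches the first; transposing the
coefficients and rescaling once more supplies the missing translation. -/
theorem exists_qEval_affine {m : ℕ} (c : Coef m) (x k a l : ℝ) :
    ∃ d : Coef m, ∀ s t, qEval m d s t = qEval m c (x + k * s) (a + l * t) := by
  refine ⟨fun i j => rescale 1 x k (fun i j => rescale 1 a l c j i) j i, fun s t => ?_⟩
  rw [qEval_swap, qEval_rescale, qEval_swap, qEval_rescale]
  simp

/-! ### Lower bounds for polynomials -/

/-- By homogeneity it is enough to look at the unit sphere, where the continuous positive function
attains a positive minimum by compactness. -/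
theorem exists_lower_of_homogeneous {V : Type*} [NormedAddCommGroup V] [NormedSpace ℝ V]
    [FiniteDimensional ℝ V] (F : V → ℝ) (hF : Continuous F)
    (hom : ∀ (r : ℝ) x, F (r • x) = r ^ 2 * F x) (pos : ∀ x, x ≠ 0 → 0 < F x) :
    ∃ k : ℝ, 0 < k ∧ ∀ x, k * ‖x‖ ^ 2 ≤ F x := by
  have := FiniteDimensional.proper_real V
  have hF0 : F 0 = 0 := by simpa using hom 0 0
  -- The sphere is empty only if `V` is trivial; then any constant works.
  rcases (Metric.sphere (0 : V) 1).eq_empty_or_nonempty with he | hne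
  · refine ⟨1, one_pos, fun x => ?_⟩
    by_cases hx : x = 0
    · simp [hx, hF0]
    · have : (‖x‖⁻¹ • x) ∈ Metric.sphere (0 : V) 1 := by
        simp [norm_smul, norm_ne_zero_iff.2 hx]
      simp [he] at this
  · obtain ⟨x₀, hx₀, hmin⟩ := (isCompact_sphere (0 : V) 1).exists_isMinOn hne hF.continuousOn
    refine ⟨F x₀, pos _ (by rintro rfl; simp at hx₀), fun x => ?_⟩
    by_cases hx : x = 0
    · simp [hx, hF0]
    · have hn : ‖x‖ ≠ 0 := norm_ne_zero_iff.2 hx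
      have h1 : F x₀ ≤ F (‖x‖⁻¹ • x) := hmin (by simp [norm_smul, hn])
      rw [hom] at h1
      have h2 := mul_le_mul_of_nonneg_right h1 (sq_nonneg ‖x‖)
      calc _ ≤ _ := h2
        _ = F x := by field_simp

/-- The squared `L²` norm on `[0, 1]` is positive definite on polynomials of degree at most `m`, a
nonzero polynomial having finitely many roots; in finite dimension it therefore dominates the
largest coefficient. -/
theorem coeff_sq_le_integral (m : ℕ) : ∃ C : ℝ, 0 < C ∧ ∀ p : Polynomial ℝ, p.natDegree ≤ m →
    ∀ j, p.coeff j ^ 2 ≤ C * ∫ t in (0:ℝ)..1, p.eval t ^ 2 := by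
  have hcont : Continuous fun d : Fin (m + 1) → ℝ =>
      ∫ t in (0:ℝ)..1, (∑ j, d j * t ^ (j : ℕ)) ^ 2 := by
    apply intervalIntegral.continuous_parametric_intervalIntegral_of_continuous'
    fun_prop
  have hom : ∀ (r : ℝ) (x : Fin (m + 1) → ℝ),
      (∫ t in (0:ℝ)..1, (∑ j, (r • x) j * t ^ (j : ℕ)) ^ 2)
        = r ^ 2 * ∫ t in (0:ℝ)..1, (∑ j, x j * t ^ (j : ℕ)) ^ 2 := by
    intro r x
    rw [← intervalIntegral.integral_const_mul]
    congr 1; ext t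
    simp only [Pi.smul_apply, smul_eq_mul, mul_assoc, ← Finset.mul_sum]
    ring
  have pos : ∀ x : Fin (m + 1) → ℝ, x ≠ 0 →
      0 < ∫ t in (0:ℝ)..1, (∑ j, x j * t ^ (j : ℕ)) ^ 2 := by
    intro x hx
    have hc : Continuous fun t : ℝ => (∑ j, x j * t ^ (j : ℕ)) ^ 2 := by fun_prop
    have h0 : 0 ≤ ∫ t in (0:ℝ)..1, (∑ j, x j * t ^ (j : ℕ)) ^ 2 :=
      intervalIntegral.integral_nonneg zero_le_one fun t _ => sq_nonneg _
    refine lt_of_le_of_ne h0 fun h => hx ?_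
    have hz : ∀ t ∈ Ioo (0:ℝ) 1, (∑ j, x j * t ^ (j : ℕ)) ^ 2 = 0 := by
      by_contra! hne
      obtain ⟨t, ht, hne⟩ := hne
      refine (intervalIntegral.integral_pos zero_lt_one hc.continuousOn
        (fun t _ => sq_nonneg _) ⟨t, Ioo_subset_Icc_self ht, ?_⟩).ne h
      positivity
    let c : Coef m := fun _ => x
    have hp : row c 0 = 0 := by
      refine Polynomial.eq_zero_of_infinite_isRoot _ ((Ioo_infinite zero_lt_one).mono fun t ht => ?_)
      show (row c 0).eval t = 0
      rw [row_eval]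
      exact pow_eq_zero_iff (two_ne_zero) |>.1 (hz t ht)
    ext j
    have := row_coeff c 0 j
    rw [hp] at this
    simpa [c] using this.symm
  obtain ⟨k, hk, h⟩ := exists_lower_of_homogeneous (V := Fin (m + 1) → ℝ)
    (fun d => ∫ t in (0:ℝ)..1, (∑ j, d j * t ^ (j : ℕ)) ^ 2) hcont hom pos
  refine ⟨k⁻¹, inv_pos.2 hk, fun p hp j => ?_⟩
  rw [← div_eq_inv_mul, le_div_iff₀ hk]
  have h0 : 0 ≤ ∫ t in (0:ℝ)..1, p.eval t ^ 2 :=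
    intervalIntegral.integral_nonneg zero_le_one fun t _ => sq_nonneg _
  by_cases hj : j ≤ m
  · have h1 := h fun j => p.coeff j
    simp only [← eval_eq_sum_fin hp] at h1
    refine le_trans ?_ h1
    rw [mul_comm]
    refine mul_le_mul_of_nonneg_left ?_ hk.le
    have := norm_le_pi_norm (fun j : Fin (m + 1) => p.coeff j) ⟨j, Nat.lt_succ_of_le hj⟩
    have h2 : |p.coeff j| ≤ ‖fun j : Fin (m + 1) => p.coeff j‖ := this
    exact sq_le_sq' (by linarith [neg_abs_le (p.coeff j)]) ((le_abs_self _).trans h2)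
  · rw [Polynomial.coeff_eq_zero_of_natDegree_lt (by omega)]
    simpa using h0

/-- Fubini. If `r i₀` has a nonzero coefficient of order `j`, the coefficient `A` of order `j` in
the second variable is a nonzero polynomial in the first. Away from the finitely many roots of `A`
the slice polynomial `B` is nonzero, so the slice is finite. -/
theorem volume_zeros_eq_zero {n : ℕ} (r : Fin n → Polynomial ℝ) {i₀ : Fin n} (h : r i₀ ≠ 0) :
    volume {z : ℝ × ℝ | ∑ i : Fin n, z.1 ^ (i : ℕ) * (r i).eval z.2 = 0} = 0 := by
  have hm : MeasurableSet {z : ℝ × ℝ | ∑ i : Fin n, z.1 ^ (i : ℕ) * (r i).eval z.2 = 0} := by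
    refine (isClosed_eq ?_ continuous_const).measurableSet
    refine continuous_finsetSum _ fun i _ => ?_
    exact (continuous_fst.pow _).mul ((r i).continuous.comp continuous_snd)
  obtain ⟨j, hj⟩ : ∃ j, (r i₀).coeff j ≠ 0 := by
    by_contra! h'
    exact h (Polynomial.ext h')
  let A : Polynomial ℝ := ∑ i : Fin n, Polynomial.C ((r i).coeff j) * Polynomial.X ^ (i : ℕ)
  have hA : A ≠ 0 := by
    intro h0
    have : A.coeff i₀ = (r i₀).coeff j := by
      simp only [A, Polynomial.finsetSum_coeff, Polynomial.coeff_C_mul, Polynomial.coeff_X_pow]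
      rw [Finset.sum_eq_single i₀]
      · simp
      · intro b _ hb
        have : (i₀ : ℕ) ≠ b := fun h => hb (Fin.ext h.symm)
        simp [this]
      · simp
    rw [h0] at this
    exact hj (by simpa using this.symm)
  rw [Measure.volume_eq_prod, Measure.measure_prod_null hm]
  have hfin : {s : ℝ | A.IsRoot s}.Finite := Polynomial.finite_setOfPred_isRoot hA
  have hae : ∀ᵐ s : ℝ, ¬ A.IsRoot s := by
    rw [ae_iff]; simpa using hfin.measure_zero _
  filter_upwards [hae] with s hs
  let B : Polynomial ℝ := ∑ i : Fin n, Polynomial.C (s ^ (i : ℕ)) * r i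
  have hB : B ≠ 0 := by
    intro h0
    apply hs
    have : B.coeff j = A.eval s := by
      simp only [A, B, Polynomial.eval_finsetSum, Polynomial.finsetSum_coeff,
        Polynomial.coeff_C_mul, Polynomial.eval_mul, Polynomial.eval_C, Polynomial.eval_pow,
        Polynomial.eval_X]
      exact Finset.sum_congr rfl fun i _ => mul_comm _ _
    rw [Polynomial.IsRoot, ← this, h0, Polynomial.coeff_zero]
  have : Prod.mk s ⁻¹' {z : ℝ × ℝ | ∑ i : Fin n, z.1 ^ (i : ℕ) * (r i).eval z.2 = 0}
      = {t | B.IsRoot t} := by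
    ext t; simp [B, Polynomial.eval_finsetSum]
  rw [this]
  exact (Polynomial.finite_setOfPred_isRoot hB).measure_zero _

/-- A nonzero coefficient other than the constant one survives in a partial derivative: in the first
if it carries a positive power of the first variable, otherwise in the second. The critical set lies
in the null set of zeros of that derivative. -/
theorem volume_critical_eq_zero {m : ℕ} (c : Coef m) (i₀ j₀ : Fin (m + 1))
    (h : ¬ ((i₀ : ℕ) = 0 ∧ (j₀ : ℕ) = 0)) (hc : c i₀ j₀ ≠ 0) :
    volume {z : ℝ × ℝ | dS m c z.1 z.2 = 0 ∧ dT m c z.1 z.2 = 0} = 0 := by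
  by_cases hi : (i₀ : ℕ) = 0
  · have hj : (j₀ : ℕ) ≠ 0 := fun hj => h ⟨hi, hj⟩
    refine measure_mono_null ?_ (volume_zeros_eq_zero (fun i => (row c i).derivative) (i₀ := i₀) ?_)
    · rintro z ⟨-, hz⟩
      rw [mem_ofPred_eq, ← hz]
      unfold dT
      refine Finset.sum_congr rfl fun i _ => ?_
      simp only [row, Polynomial.derivative_sum, Polynomial.eval_finsetSum, Finset.mul_sum]
      refine Finset.sum_congr rfl fun j _ => ?_
      simp [Polynomial.derivative_X_pow]
      ring
    · intro h0
      have := Polynomial.coeff_derivative (row c i₀) ((j₀ : ℕ) - 1)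
      rw [h0, Nat.sub_add_cancel (Nat.one_le_iff_ne_zero.2 hj), row_coeff] at this
      simp only [Polynomial.coeff_zero, zero_eq_mul, hc, false_or] at this
      exact absurd this (by positivity)
  · obtain ⟨i, rfl⟩ := Fin.exists_succ_eq.2 (fun h0 : i₀ = 0 => hi (by simp [h0]))
    refine measure_mono_null ?_ (volume_zeros_eq_zero
      (fun i : Fin m => Polynomial.C ((i : ℝ) + 1) * row c i.succ) (i₀ := i) ?_)
    · rintro z ⟨hz, -⟩
      rw [mem_ofPred_eq, ← hz]
      unfold dS
      rw [Fin.sum_univ_succ]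
      simp only [Fin.val_zero, Nat.cast_zero, zero_mul, mul_zero, Finset.sum_const_zero, zero_add]
      refine Finset.sum_congr rfl fun i _ => ?_
      simp only [Polynomial.eval_mul, Polynomial.eval_C, row_eval, Finset.mul_sum]
      refine Finset.sum_congr rfl fun j _ => ?_
      simp
      ring
    · intro h0
      have := congrArg (fun p : Polynomial ℝ => p.coeff j₀) h0
      simp only [Polynomial.coeff_C_mul, row_coeff, Polynomial.coeff_zero, mul_eq_zero, hc,
        or_false] at this
      exact absurd this (by positivity)

end

/-! ### Gradients of polynomials are small on small sets only -/

section

/-- The reference rectangle. -/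
def refRect : Set (ℝ × ℝ) := Icc (-1) 1 ×ˢ Icc 0 1

theorem refRect_isCompact : IsCompact refRect := isCompact_Icc.prod isCompact_Icc

/-- Squared length of the gradient of `qEval m c`. -/
def gradSq (m : ℕ) (c : Coef m) (z : ℝ × ℝ) : ℝ := dS m c z.1 z.2 ^ 2 + dT m c z.1 z.2 ^ 2

theorem gradSq_continuous (m : ℕ) : Continuous fun x : Coef m × ℝ × ℝ => gradSq m x.1 x.2 :=
  ((dS_continuous m).pow 2).add ((dT_continuous m).pow 2)

theorem gradSq_continuous_right {m : ℕ} (c : Coef m) : Continuous (gradSq m c) := by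
  unfold gradSq dS dT; fun_prop

theorem sublevel_mono {m : ℕ} (c d : Coef m) {σ τ : ℝ}
    (h : ∀ z ∈ refRect, gradSq m c z ≤ σ → gradSq m d z ≤ τ) :
    volume (refRect ∩ {z | gradSq m c z ≤ σ}) ≤ volume (refRect ∩ {z | gradSq m d z ≤ τ}) :=
  measure_mono fun z hz => ⟨hz.1, h z hz.1 hz.2⟩

theorem gradSq_smul {m : ℕ} (r : ℝ) (c : Coef m) (z : ℝ × ℝ) :
    gradSq m (r • c) z = r ^ 2 * gradSq m c z := by
  simp only [gradSq, dS, dT, Pi.smul_apply, smul_eq_mul, mul_assoc, ← Finset.mul_sum]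
  ring

/-- The sublevel sets of the squared gradient at the levels `1 / (n + 1)` decrease to the critical
set, which is null, so one of them has measure below `θ`. On the compact rectangle the squared
gradient depends uniformly on the coefficients, and half that level works for all nearby
coefficients. -/
theorem exists_small_sublevel_nhds {m : ℕ} (c : Coef m) (hc : 0 < seminorm c) {θ : ENNReal}
    (hθ : 0 < θ) : ∃ τ : ℝ, 0 < τ ∧ ∀ᶠ d in nhds c,
      volume (refRect ∩ {z | gradSq m d z ≤ τ}) ≤ θ := by
  obtain ⟨i, j, hij, hcij⟩ : ∃ i j : Fin (m + 1), ¬ ((i : ℕ) = 0 ∧ (j : ℕ) = 0) ∧ c i j ≠ 0 := by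
    by_contra! h
    refine hc.ne' (Finset.sum_eq_zero fun i _ => Finset.sum_eq_zero fun j _ => ?_)
    split_ifs with h'
    · rfl
    · rw [h i j (fun a b => h' ⟨a, b⟩), abs_zero]
  let A : ℕ → Set (ℝ × ℝ) := fun n => refRect ∩ {z | gradSq m c z ≤ 1 / ((n : ℝ) + 1)}
  have hclosed : ∀ n, IsClosed (A n) := fun n =>
    refRect_isCompact.isClosed.inter (isClosed_le (gradSq_continuous_right c) continuous_const)
  have hanti : Antitone A := by
    intro n k hnk z hz
    refine ⟨hz.1, le_trans (show gradSq m c z ≤ _ from hz.2) ?_⟩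
    have : (n : ℝ) ≤ k := by exact_mod_cast hnk
    gcongr
  have hlim := tendsto_measure_iInter_atTop (μ := (volume : Measure (ℝ × ℝ)))
    (fun n => (hclosed n).measurableSet.nullMeasurableSet) hanti
    ⟨0, ((measure_mono inter_subset_left).trans_lt refRect_isCompact.measure_lt_top).ne⟩
  have hnull : volume (⋂ n, A n) = 0 := by
    refine measure_mono_null (fun z hz => ?_) (volume_critical_eq_zero c i j hij hcij)
    have hle : gradSq m c z ≤ 0 := by
      refine ge_of_tendsto' tendsto_one_div_add_atTop_nhds_zero_nat fun n => ?_
      exact (mem_iInter.1 hz n).2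
    have h1 := sq_nonneg (dS m c z.1 z.2)
    have h2 := sq_nonneg (dT m c z.1 z.2)
    unfold gradSq at hle
    exact ⟨pow_eq_zero_iff two_ne_zero |>.1 (by linarith),
      pow_eq_zero_iff two_ne_zero |>.1 (by linarith)⟩
  rw [hnull] at hlim
  obtain ⟨n, hn⟩ := (hlim.eventually (eventually_lt_nhds hθ)).exists
  have hpos : (0 : ℝ) < 1 / ((n : ℝ) + 1) := by positivity
  refine ⟨1 / ((n : ℝ) + 1) / 2, by positivity, ?_⟩
  have huni : ∀ᶠ d in nhds c, ∀ z ∈ refRect,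
      gradSq m c z < gradSq m d z + 1 / ((n : ℝ) + 1) / 2 := by
    refine refRect_isCompact.eventually_forall_of_forall_eventually fun z _ => ?_
    have h1 : Continuous fun x : Coef m × ℝ × ℝ => gradSq m c x.2 :=
      (gradSq_continuous_right c).comp continuous_snd
    have h2 : Continuous fun x : Coef m × ℝ × ℝ => gradSq m x.1 x.2 + 1 / ((n : ℝ) + 1) / 2 :=
      (gradSq_continuous m).add continuous_const
    exact (isOpen_lt h1 h2).mem_nhds (show gradSq m c z < gradSq m c z + _ by linarith)
  filter_upwards [huni] with d hd
  refine (measure_mono fun z hz => ?_).trans (le_of_lt hn)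
  refine ⟨hz.1, ?_⟩
  have h1 := hd z hz.1
  have h2 : gradSq m d z ≤ 1 / ((n : ℝ) + 1) / 2 := hz.2
  show gradSq m c z ≤ 1 / ((n : ℝ) + 1)
  linarith

theorem seminorm_continuous (m : ℕ) : Continuous fun c : Coef m => seminorm c := by
  unfold seminorm
  refine continuous_finsetSum _ fun i _ => continuous_finsetSum _ fun j _ => ?_
  split_ifs <;> fun_prop

theorem seminorm_smul {m : ℕ} (r : ℝ) (c : Coef m) : seminorm (r • c) = |r| * seminorm c := by
  simp only [seminorm, Finset.mul_sum]
  refine Finset.sum_congr rfl fun i _ => Finset.sum_congr rfl fun j _ => ?_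
  split_ifs <;> simp [abs_mul]

/-- Changing the constant coefficient does not affect the gradient. -/
theorem exists_zero_const {m : ℕ} (c : Coef m) : ∃ d : Coef m, d 0 0 = 0 ∧
    seminorm d = seminorm c ∧ ∀ z, gradSq m d z = gradSq m c z := by
  refine ⟨fun i j => if (i : ℕ) = 0 ∧ (j : ℕ) = 0 then 0 else c i j, by simp, ?_, fun z => ?_⟩
  · unfold seminorm
    refine Finset.sum_congr rfl fun i _ => Finset.sum_congr rfl fun j _ => ?_
    split_ifs with h
    · rfl
    · simp only [if_neg h]
  · have h1 : dS m (fun i j => if (i : ℕ) = 0 ∧ (j : ℕ) = 0 then 0 else c i j) z.1 z.2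
        = dS m c z.1 z.2 := by
      unfold dS
      refine Finset.sum_congr rfl fun i _ => Finset.sum_congr rfl fun j _ => ?_
      by_cases h : (i : ℕ) = 0 ∧ (j : ℕ) = 0
      · simp [h.1]
      · simp only [if_neg h]
    have h2 : dT m (fun i j => if (i : ℕ) = 0 ∧ (j : ℕ) = 0 then 0 else c i j) z.1 z.2
        = dT m c z.1 z.2 := by
      unfold dT
      refine Finset.sum_congr rfl fun i _ => Finset.sum_congr rfl fun j _ => ?_
      by_cases h : (i : ℕ) = 0 ∧ (j : ℕ) = 0
      · simp [h.2]
      · simp only [if_neg h]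
    rw [gradSq, gradSq, h1, h2]

/-- A Remez type estimate: the gradient of a polynomial is small on a small set only. -/
theorem exists_small_sublevel (m : ℕ) {θ : ENNReal} (hθ : 0 < θ) : ∃ τ : ℝ, 0 < τ ∧
    ∀ c : Coef m, 0 < seminorm c →
      volume (refRect ∩ {z | gradSq m c z ≤ τ * seminorm c ^ 2}) ≤ θ := by
  -- With the constant coefficient fixed at zero, `seminorm` is a norm, and this is its compact unit
  -- sphere.
  let W : Set (Coef m) := {c | c 0 0 = 0 ∧ seminorm c = 1}
  have hW : IsCompact W := by
    refine Metric.isCompact_of_isClosed_isBounded ?_ ?_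
    · exact (isClosed_eq (by fun_prop) continuous_const).inter
        (isClosed_eq (seminorm_continuous m) continuous_const)
    · refine (Metric.isBounded_closedBall (x := (0 : Coef m)) (r := 1)).subset fun c hc => ?_
      rw [mem_closedBall_zero_iff, pi_norm_le_iff_of_nonneg zero_le_one]
      intro i
      rw [pi_norm_le_iff_of_nonneg zero_le_one]
      intro j
      by_cases h : (i : ℕ) = 0 ∧ (j : ℕ) = 0
      · rw [show i = 0 from Fin.ext h.1, show j = 0 from Fin.ext h.2, hc.1]; simp
      · exact (abs_le_seminorm c i j h).trans hc.2.le
  have key : ∃ τ : ℝ, 0 < τ ∧ ∀ c ∈ W, volume (refRect ∩ {z | gradSq m c z ≤ τ}) ≤ θ := by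
    -- A finite cover turns the local levels into one level; on a union the smaller of two levels
    -- serves.
    refine hW.induction_on (p := fun s => ∃ τ : ℝ, 0 < τ ∧ ∀ c ∈ s,
      volume (refRect ∩ {z | gradSq m c z ≤ τ}) ≤ θ) ⟨1, one_pos, by simp⟩ ?_ ?_ ?_
    · rintro s t hst ⟨τ, h, h'⟩
      exact ⟨τ, h, fun c hc => h' c (hst hc)⟩
    · rintro s t ⟨τ, h, h'⟩ ⟨σ, k, k'⟩
      refine ⟨min τ σ, lt_min h k, ?_⟩
      rintro c (hc | hc)
      · exact (sublevel_mono c c fun z _ hz => hz.trans (min_le_left _ _)).trans (h' c hc)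
      · exact (sublevel_mono c c fun z _ hz => hz.trans (min_le_right _ _)).trans (k' c hc)
    · intro c hc
      obtain ⟨τ, h, h'⟩ := exists_small_sublevel_nhds c (by rw [hc.2]; exact one_pos) hθ
      exact ⟨_, mem_nhdsWithin_of_mem_nhds h', τ, h, fun d hd => hd⟩
  obtain ⟨τ, hτ, h⟩ := key
  refine ⟨τ, hτ, fun c hc => ?_⟩
  obtain ⟨d, hd0, hdn, hdg⟩ := exists_zero_const c
  have hmem : (seminorm c)⁻¹ • d ∈ W := by
    refine ⟨by simp [hd0], ?_⟩
    rw [seminorm_smul, hdn, abs_of_pos (inv_pos.2 hc), inv_mul_cancel₀ hc.ne']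
  refine (sublevel_mono c _ fun z _ hz => ?_).trans (h _ hmem)
  rw [gradSq_smul, hdg, inv_pow, inv_mul_le_iff₀ (by positivity), mul_comm]
  exact hz

/-- On `ℝ × ℝ` and on `Fin 2 → ℝ` with the sup norm, Lebesgue measure is two-dimensional Hausdorff
measure, which a Lipschitz map enlarges at most by `L ^ 2`. Passing from the Euclidean to the
smaller sup norm costs nothing. Neither differentiability nor injectivity of the map is involved. -/
theorem volume_image_le {Φ : ℝ × ℝ → Pt} {A : Set (ℝ × ℝ)} {L : NNReal}
    (hΦ : LipschitzOnWith L Φ A) : volume (Φ '' A) ≤ (L : ENNReal) ^ 2 * volume A := by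
  have h1 : LipschitzOnWith L (fun z => WithLp.ofLp (Φ z)) A := by
    have := (PiLp.lipschitzWith_ofLp 2 (fun _ : Fin 2 => ℝ)).comp_lipschitzOnWith hΦ
    rwa [one_mul] at this
  have h2 := h1.hausdorffMeasure_image_le (d := 2) zero_le_two
  have h3 : (μH[2] : Measure (Fin 2 → ℝ)) = volume := by
    have := hausdorffMeasure_pi_real (ι := Fin 2)
    simpa using this
  rw [h3, hausdorffMeasure_prod_real] at h2
  have h4 : (fun z => WithLp.ofLp (Φ z)) '' A = WithLp.ofLp '' (Φ '' A) := by
    rw [image_image]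
  have h5 : volume (WithLp.ofLp '' (Φ '' A)) = volume (Φ '' A) := by
    have hmp := (EuclideanSpace.volume_preserving_symm_measurableEquiv_toLp (Fin 2)).symm
    rw [show (WithLp.ofLp '' (Φ '' A) : Set (Fin 2 → ℝ))
      = ((MeasurableEquiv.toLp 2 (Fin 2 → ℝ)).symm : Pt → (Fin 2 → ℝ)) '' (Φ '' A) from rfl,
      MeasurableEquiv.image_eq_preimage_symm]
    exact hmp.measure_preimage_equiv _
  rw [h4, h5] at h2
  convert h2 using 2
  norm_cast

/-- The Dirichlet integral over a large part of an element controls the coefficients. -/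
theorem exists_seminorm_sq_le_integral (m : ℕ) (L : NNReal) {θ : ℝ} (hθ : 0 < θ) :
    ∃ k : ℝ, 0 < k ∧ ∀ (Φ : ℝ × ℝ → Pt) (h : NNReal) (c : Coef m) (E : Set Pt) (w : Pt → ℝ),
      0 < h → LipschitzOnWith (L * h) Φ refRect → E ⊆ Φ '' refRect → MeasurableSet E →
      ENNReal.ofReal (θ * h ^ 2) ≤ volume E →
      (∀ z ∈ refRect, Φ z ∈ E → gradSq m c z ≤ L * h ^ 2 * w (Φ z)) →
      IntegrableOn w E → (∀ p ∈ E, 0 ≤ w p) → k * seminorm c ^ 2 ≤ ∫ p in E, w p := by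
  -- The measure granted to the set of small gradients is chosen so that its image, larger by a
  -- factor of at most `(L * h) ^ 2`, fills at most half of the area `θ * h ^ 2` guaranteed for `E`.
  obtain ⟨τ, hτ, H⟩ := exists_small_sublevel m
    (θ := ENNReal.ofReal (θ / 2 / (L ^ 2 + 1))) (by simp; positivity)
  refine ⟨τ / (L + 1) * (θ / 2), by positivity, fun Φ h c E w hh hΦ hE hEm hvol hw hwi hw0 => ?_⟩
  have hh' : (0 : ℝ) < h := hh
  rcases (seminorm_nonneg c).eq_or_lt with h0 | h0
  · rw [← h0]
    simpa using setIntegral_nonneg hEm hw0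
  let A := refRect ∩ {z | gradSq m c z ≤ τ * seminorm c ^ 2}
  have hAc : IsCompact A := refRect_isCompact.inter_right
    (isClosed_le (gradSq_continuous_right c) continuous_const)
  have hAim : IsCompact (Φ '' A) :=
    hAc.image_of_continuousOn (hΦ.continuousOn.mono inter_subset_left)
  have hvA : volume (Φ '' A) ≤ ENNReal.ofReal (θ / 2 * h ^ 2) := by
    refine (volume_image_le (hΦ.mono inter_subset_left)).trans ?_
    calc _ ≤ ((L * h : NNReal) : ENNReal) ^ 2 * ENNReal.ofReal (θ / 2 / (L ^ 2 + 1)) := by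
          gcongr; exact H c h0
      _ = ENNReal.ofReal ((L * h) ^ 2 * (θ / 2 / (L ^ 2 + 1))) := by
          rw [ENNReal.ofReal_mul (by positivity), ENNReal.ofReal_pow (by positivity)]
          congr 2
          rw [← NNReal.coe_mul, ENNReal.ofReal_coe_nnreal]
      _ ≤ _ := by
          apply ENNReal.ofReal_le_ofReal
          rw [mul_pow, div_eq_mul_inv (θ / 2)]
          have : (L : ℝ) ^ 2 * ((L : ℝ) ^ 2 + 1)⁻¹ ≤ 1 := by
            rw [← div_eq_mul_inv, div_le_one (by positivity)]; linarith
          calc (L : ℝ) ^ 2 * h ^ 2 * (θ / 2 * ((L : ℝ) ^ 2 + 1)⁻¹)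
              = ((L : ℝ) ^ 2 * ((L : ℝ) ^ 2 + 1)⁻¹) * (θ / 2 * h ^ 2) := by ring
            _ ≤ 1 * (θ / 2 * h ^ 2) := by gcongr
            _ = _ := one_mul _
  have hEA : MeasurableSet (E \ Φ '' A) := hEm.diff hAim.isClosed.measurableSet
  have hEfin : volume E ≠ ⊤ := by
    refine ((measure_mono hE).trans_lt ?_).ne
    exact (refRect_isCompact.image_of_continuousOn hΦ.continuousOn).measure_lt_top
  have hvEA : θ / 2 * h ^ 2 ≤ volume.real (E \ Φ '' A) := by
    have h1 : volume E ≤ volume (E \ Φ '' A) + volume (Φ '' A) := by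
      refine (measure_mono ?_).trans (measure_union_le _ _)
      intro p hp
      by_cases h : p ∈ Φ '' A
      · exact Or.inr h
      · exact Or.inl ⟨hp, h⟩
    have h2 : ENNReal.ofReal (θ * h ^ 2)
        ≤ volume (E \ Φ '' A) + ENNReal.ofReal (θ / 2 * h ^ 2) :=
      hvol.trans (h1.trans (by gcongr))
    have hfin : volume (E \ Φ '' A) ≠ ⊤ := ((measure_mono sdiff_subset).trans_lt hEfin.lt_top).ne
    have h3 := ENNReal.toReal_mono (ENNReal.add_ne_top.2 ⟨hfin, ENNReal.ofReal_ne_top⟩) h2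
    rw [ENNReal.toReal_add hfin ENNReal.ofReal_ne_top, ENNReal.toReal_ofReal (by positivity),
      ENNReal.toReal_ofReal (by positivity)] at h3
    rw [Measure.real]
    linarith
  -- On the remaining half `w` is at least of order `h ^ (-2)`, which cancels against an area of
  -- order `h ^ 2`; the resulting constant is free of scale. Writing `L + 1` keeps the denominator
  -- positive for `L = 0`.
  have hlow : ∀ p ∈ E \ Φ '' A, τ * seminorm c ^ 2 / ((L + 1) * h ^ 2) ≤ w p := by
    rintro p ⟨hp, hpA⟩
    obtain ⟨z, hz, rfl⟩ := hE hp
    have h1 : τ * seminorm c ^ 2 < gradSq m c z := by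
      by_contra hle
      exact hpA ⟨z, ⟨hz, not_lt.1 hle⟩, rfl⟩
    have h2 := hw z hz hp
    have h3 := hw0 _ hp
    rw [div_le_iff₀ (by positivity)]
    have h4 : (L : ℝ) * h ^ 2 * w (Φ z) ≤ (L + 1) * h ^ 2 * w (Φ z) := by gcongr; linarith
    linarith
  calc τ / (L + 1) * (θ / 2) * seminorm c ^ 2
      = τ * seminorm c ^ 2 / ((L + 1) * h ^ 2) * (θ / 2 * h ^ 2) := by field_simp
    _ ≤ τ * seminorm c ^ 2 / ((L + 1) * h ^ 2) * volume.real (E \ Φ '' A) := by gcongr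
    _ = ∫ p in E \ Φ '' A, τ * seminorm c ^ 2 / ((L + 1) * h ^ 2) := by
        rw [setIntegral_const, smul_eq_mul, mul_comm]
    _ ≤ ∫ p in E \ Φ '' A, w p := by
        refine setIntegral_mono_on ?_ (hwi.mono_set sdiff_subset) hEA hlow
        refine integrableOn_const ?_
        exact ((measure_mono sdiff_subset).trans_lt hEfin.lt_top).ne
    _ ≤ ∫ p in E, w p := by
        refine setIntegral_mono_set hwi ?_ (Filter.Eventually.of_forall sdiff_subset)
        exact (ae_restrict_iff' hEm).2 (Filter.Eventually.of_forall hw0)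

end

section

/-! ### Geometry of a regular plane curve -/

theorem norm_sq_eq (p : Pt) : ‖p‖ ^ 2 = p 0 ^ 2 + p 1 ^ 2 := by
  simp [EuclideanSpace.norm_sq_eq, Fin.sum_univ_two]

theorem inner_eq (p q : Pt) : inner ℝ p q = p 0 * q 0 + p 1 * q 1 := by
  simp [PiLp.inner_apply, Fin.sum_univ_two, mul_comm]

theorem hasDerivAt_pt_iff {f : ℝ → Pt} {f' : Pt} {x : ℝ} :
    HasDerivAt f f' x ↔ ∀ i, HasDerivAt (fun y => f y i) (f' i) x := by
  rw [hasDerivAt_iff_hasFDerivAt, ← hasFDerivWithinAt_univ, hasFDerivWithinAt_euclidean]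
  refine forall_congr' fun i => ?_
  rw [hasDerivAt_iff_hasFDerivAt, hasFDerivWithinAt_univ]
  have : (PiLp.proj (𝕜 := ℝ) 2 (fun _ : Fin 2 => ℝ) i).comp
      (ContinuousLinearMap.toSpanSingleton ℝ f') = ContinuousLinearMap.toSpanSingleton ℝ (f' i) := by
    ext; simp
  rw [this]

section Curve

variable {g : ℝ → Pt} {ξ : ℝ}

theorem normal_zero (g : ℝ → Pt) (ξ : ℝ) : normal g ξ 0 = ‖deriv g ξ‖⁻¹ * deriv g ξ 1 := by
  simp [normal, tangent]

theorem normal_one (g : ℝ → Pt) (ξ : ℝ) : normal g ξ 1 = -(‖deriv g ξ‖⁻¹ * deriv g ξ 0) := by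
  simp [normal, tangent]

theorem inner_normal_deriv (g : ℝ → Pt) (ξ : ℝ) : inner ℝ (normal g ξ) (deriv g ξ) = 0 := by
  rw [inner_eq, normal_zero, normal_one]; ring

theorem norm_normal (h : deriv g ξ ≠ 0) : ‖normal g ξ‖ = 1 := by
  have hn : ‖deriv g ξ‖ ≠ 0 := norm_ne_zero_iff.2 h
  have h1 := norm_sq_eq (deriv g ξ)
  have h2 : ‖normal g ξ‖ ^ 2 = 1 := by
    rw [norm_sq_eq, normal_zero, normal_one]
    field_simp
    linarith
  have h3 := norm_nonneg (normal g ξ)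
  nlinarith

/-- Expansion in the moving frame. -/
theorem frame_expansion (h : deriv g ξ ≠ 0) (p : Pt) :
    inner ℝ (normal g ξ) p • normal g ξ
      + (inner ℝ (deriv g ξ) p / ‖deriv g ξ‖ ^ 2) • deriv g ξ = p := by
  have hn : ‖deriv g ξ‖ ≠ 0 := norm_ne_zero_iff.2 h
  have h1 := norm_sq_eq (deriv g ξ)
  ext i
  fin_cases i
  · simp only [inner_eq, PiLp.add_apply, PiLp.smul_apply, smul_eq_mul, normal_zero, normal_one,
      Fin.zero_eta]
    field_simp
    rw [h1]; ring
  · simp only [inner_eq, PiLp.add_apply, PiLp.smul_apply, smul_eq_mul, normal_zero, normal_one,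
      Fin.mk_one]
    field_simp
    rw [h1]; ring

theorem norm_frame_sq (h : deriv g ξ ≠ 0) (x y : ℝ) :
    ‖x • normal g ξ + y • deriv g ξ‖ ^ 2 = x ^ 2 + (y * ‖deriv g ξ‖) ^ 2 := by
  have h0 := inner_normal_deriv g ξ
  rw [norm_add_sq_real, norm_smul, norm_smul, inner_smul_left, inner_smul_right, h0, norm_normal h]
  simp [mul_pow]

/-- With this orientation of the normal and this sign of the curvature the Frenet formula is `n' = κ
g'`, the origin of the Jacobian factor `1 + η κ`. -/
theorem hasDerivAt_normal (hg : ContDiff ℝ 2 g) (h : deriv g ξ ≠ 0) :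
    HasDerivAt (normal g) (curvature g ξ • deriv g ξ) ξ := by
  have hn : ‖deriv g ξ‖ ≠ 0 := norm_ne_zero_iff.2 h
  have h1 := norm_sq_eq (deriv g ξ)
  have hd : HasDerivAt (deriv g) (deriv (deriv g) ξ) ξ := by
    have : ContDiff ℝ 1 (deriv g) := by
      have := hg.iterate_deriv' 1 1
      simpa using this
    exact (this.differentiable one_ne_zero ξ).hasDerivAt
  have hdi : ∀ i : Fin 2, HasDerivAt (fun x => deriv g x i) (deriv (deriv g) ξ i) ξ :=
    fun i => (hasDerivAt_pt_iff.1 hd) i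
  have hN : HasDerivAt (fun x => ‖deriv g x‖)
      ((deriv g ξ 0 * deriv (deriv g) ξ 0 + deriv g ξ 1 * deriv (deriv g) ξ 1) / ‖deriv g ξ‖) ξ := by
    have hs := (((hdi 0).pow 2).add ((hdi 1).pow 2)).sqrt (by
      simp only [Pi.pow_apply, Pi.add_apply]
      rw [← h1]; positivity)
    have he : (fun x => ‖deriv g x‖) = fun x => √(((fun x => deriv g x 0) ^ 2
        + (fun x => deriv g x 1) ^ 2) x) := by
      ext x
      simp only [Pi.add_apply, Pi.pow_apply]
      rw [← norm_sq_eq, Real.sqrt_sq (norm_nonneg _)]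
    rw [he]
    refine hs.congr_deriv ?_
    simp only [Pi.pow_apply, Pi.add_apply]
    rw [← h1, Real.sqrt_sq (norm_nonneg _)]
    field_simp
    norm_num
    ring
  rw [hasDerivAt_pt_iff]
  intro i
  fin_cases i
  · have := (hN.inv hn).mul (hdi 1)
    simp only [Fin.zero_eta, normal_zero]
    refine this.congr_deriv ?_
    simp only [PiLp.smul_apply, smul_eq_mul, curvature, Pi.inv_apply]
    field_simp
    rw [h1]; ring
  · have := ((hN.inv hn).mul (hdi 0)).neg
    simp only [Fin.mk_one, normal_one]
    refine this.congr_deriv ?_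
    simp only [PiLp.smul_apply, smul_eq_mul, curvature, Pi.inv_apply]
    field_simp
    rw [h1]; ring

theorem hasFDerivAt_frenet (hg : ContDiff ℝ 2 g) {z : ℝ × ℝ} (h : deriv g z.2 ≠ 0) :
    HasFDerivAt (frenet g) ((ContinuousLinearMap.fst ℝ ℝ ℝ).smulRight (normal g z.2)
      + (ContinuousLinearMap.snd ℝ ℝ ℝ).smulRight
        ((1 + z.1 * curvature g z.2) • deriv g z.2)) z := by
  have h1 : HasFDerivAt (fun z : ℝ × ℝ => g z.2)
      ((ContinuousLinearMap.snd ℝ ℝ ℝ).smulRight (deriv g z.2)) z := by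
    have := ((hg.differentiable two_ne_zero z.2).hasDerivAt.hasFDerivAt).comp z hasFDerivAt_snd
    refine this.congr_fderiv ?_
    ext <;> simp
  have h2 : HasFDerivAt (fun z : ℝ × ℝ => normal g z.2)
      ((ContinuousLinearMap.snd ℝ ℝ ℝ).smulRight (curvature g z.2 • deriv g z.2)) z := by
    have := ((hasDerivAt_normal hg h).hasFDerivAt).comp z hasFDerivAt_snd
    refine this.congr_fderiv ?_
    ext <;> simp
  have h3 := h1.add ((hasFDerivAt_fst (𝕜 := ℝ) (p := z)).smul h2)
  refine h3.congr_fderiv ?_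
  ext <;> simp [add_mul, mul_assoc]

/-- The derivative of the Frenet map as an isomorphism. -/
def frenetEquiv (g : ℝ → Pt) (z : ℝ × ℝ) (h : deriv g z.2 ≠ 0)
    (hj : 1 + z.1 * curvature g z.2 ≠ 0) : (ℝ × ℝ) ≃L[ℝ] Pt :=
  ContinuousLinearEquiv.equivOfInverse
    ((ContinuousLinearMap.fst ℝ ℝ ℝ).smulRight (normal g z.2)
      + (ContinuousLinearMap.snd ℝ ℝ ℝ).smulRight
        ((1 + z.1 * curvature g z.2) • deriv g z.2))
    ((innerSL ℝ (normal g z.2)).prod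
      (((1 + z.1 * curvature g z.2) * ‖deriv g z.2‖ ^ 2)⁻¹ • innerSL ℝ (deriv g z.2)))
    (by
      intro x
      have h0 := inner_normal_deriv g z.2
      have h0' : inner ℝ (deriv g z.2) (normal g z.2) = 0 := by rw [real_inner_comm, h0]
      have hn : ‖deriv g z.2‖ ≠ 0 := norm_ne_zero_iff.2 h
      ext
      · simp [inner_add_right, inner_smul_right, h0, norm_normal h]
      · simp only [add_apply, ContinuousLinearMap.smulRight_apply,
          ContinuousLinearMap.coe_fst', ContinuousLinearMap.coe_snd',
          ContinuousLinearMap.prod_apply, smul_apply, innerSL_apply_apply,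
          inner_add_right, inner_smul_right, h0', real_inner_self_eq_norm_sq, smul_eq_mul]
        field_simp
        ring)
    (by
      intro p
      have hn : ‖deriv g z.2‖ ≠ 0 := norm_ne_zero_iff.2 h
      have h1 := frame_expansion h p
      conv_rhs => rw [← h1]
      simp only [add_apply, ContinuousLinearMap.smulRight_apply,
          ContinuousLinearMap.coe_fst', ContinuousLinearMap.coe_snd',
          ContinuousLinearMap.prod_apply, smul_apply, innerSL_apply_apply,
          smul_eq_mul, smul_smul]
      congr 2
      field_simp)

/-- The gradient of a function given by the polynomial `qEval m c` in Frenet coordinates. -/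
def frenetGrad (g : ℝ → Pt) {m : ℕ} (c : Coef m) (z : ℝ × ℝ) : Pt :=
  dS m c z.1 z.2 • normal g z.2
    + (dT m c z.1 z.2 / ((1 + z.1 * curvature g z.2) * ‖deriv g z.2‖ ^ 2)) • deriv g z.2

theorem norm_frenetGrad_sq {m : ℕ} (c : Coef m) {z : ℝ × ℝ} (h : deriv g z.2 ≠ 0) :
    ‖frenetGrad g c z‖ ^ 2 = dS m c z.1 z.2 ^ 2
      + (dT m c z.1 z.2 / ((1 + z.1 * curvature g z.2) * ‖deriv g z.2‖)) ^ 2 := by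
  have hn : ‖deriv g z.2‖ ≠ 0 := norm_ne_zero_iff.2 h
  rw [frenetGrad, norm_frame_sq h]
  congr 2
  field_simp

/-- The coordinates are differentiated as an inverse of the Frenet map, whose derivative is
invertible by `frenetEquiv`. Continuity of `ψ` within `s` is all that this requires, so boundary
points of an element are covered. -/
theorem hasGradientWithinAt_of_frenet (hg : ContDiff ℝ 2 g) {m : ℕ} (c : Coef m)
    {s : Set Pt} {ψ : Pt → ℝ × ℝ} {p : Pt} (hp : p ∈ s) (h : deriv g (ψ p).2 ≠ 0)
    (hj : 1 + (ψ p).1 * curvature g (ψ p).2 ≠ 0) (hψ : ContinuousWithinAt ψ s p)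
    (hψs : ∀ q ∈ s, frenet g (ψ q) = q) :
    HasGradientWithinAt (fun q => qEval m c (ψ q).1 (ψ q).2) (frenetGrad g c (ψ p)) s p := by
  have h1 : HasFDerivWithinAt (frenet g) (frenetEquiv g (ψ p) h hj : (ℝ × ℝ) →L[ℝ] Pt) univ (ψ p) :=
    (hasFDerivAt_frenet hg h).hasFDerivWithinAt
  have h2 : HasFDerivWithinAt ψ ((frenetEquiv g (ψ p) h hj).symm : Pt →L[ℝ] ℝ × ℝ) s p := by
    refine HasFDerivWithinAt.of_local_left_inverse (t := univ) ?_ h1 hp ?_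
    · rw [nhdsWithin_univ]; exact hψ
    · filter_upwards [self_mem_nhdsWithin] with q hq using hψs q hq
  have h3 := (qEval_hasFDerivAt m c (ψ p)).comp_hasFDerivWithinAt p h2
  rw [hasGradientWithinAt_iff_hasFDerivWithinAt]
  refine h3.congr_fderiv ?_
  ext q
  have e : ∀ q, (frenetEquiv g (ψ p) h hj).symm q = (inner ℝ (normal g (ψ p).2) q,
    ((1 + (ψ p).1 * curvature g (ψ p).2) * ‖deriv g (ψ p).2‖ ^ 2)⁻¹
      * inner ℝ (deriv g (ψ p).2) q) := fun q => rfl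
  have hn : ‖deriv g (ψ p).2‖ ≠ 0 := norm_ne_zero_iff.2 h
  simp only [frenetGrad, ContinuousLinearMap.comp_apply, add_apply, smul_apply,
    ContinuousLinearEquiv.coe_coe, e, ContinuousLinearMap.coe_fst', ContinuousLinearMap.coe_snd',
    smul_eq_mul, InnerProductSpace.toDual_apply_apply, inner_add_left, real_inner_smul_left]
  field_simp

end Curve

end

/-! ### Uniform bounds along the interface curve -/

section

theorem periodic_deriv {E : Type*} [NormedAddCommGroup E] [NormedSpace ℝ E] {f : ℝ → E} {L : ℝ}
    (h : Function.Periodic f L) : Function.Periodic (deriv f) L := by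
  intro x
  have h1 : (fun y => f (y + L)) = f := funext h
  have h2 := deriv_comp_add_const f L x
  rw [h1] at h2
  exact h2.symm

namespace Interface

variable {Q : Rect} (S : Interface Q)

theorem deriv_contDiff : ContDiff ℝ 1 (deriv S.g) := by
  have := S.smooth.iterate_deriv' 1 1
  simpa using this

theorem deriv_continuous : Continuous (deriv S.g) := S.deriv_contDiff.continuous

theorem deriv_deriv_continuous : Continuous (deriv (deriv S.g)) :=
  S.deriv_contDiff.continuous_deriv le_rfl

theorem Icc_subset_params : Icc S.ξs S.ξe ⊆ S.params := by
  rcases S.tube with ⟨h, -⟩ | ⟨h, -⟩ <;> simp [h]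

theorem params_convex : Convex ℝ S.params := by
  rcases S.tube with ⟨h, -⟩ | ⟨h, -⟩ <;> rw [h]
  exacts [convex_univ, convex_Icc _ _]

/-- Bounds on the parameter set of the curve, by compactness and periodicity. -/
theorem exists_bound {F : ℝ → ℝ} (hF : ContinuousOn F S.params)
    (hper : Function.Periodic S.g (S.ξe - S.ξs) → Function.Periodic F (S.ξe - S.ξs)) :
    ∃ M, 0 < M ∧ ∀ ξ ∈ S.params, |F ξ| ≤ M := by
  obtain ⟨M, hM⟩ := isCompact_Icc.exists_bound_of_continuousOn (hF.mono S.Icc_subset_params)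
  refine ⟨max M 1, by positivity, fun ξ hξ => ?_⟩
  rcases S.tube with ⟨h, hp, -⟩ | ⟨h, -⟩
  · obtain ⟨y, hy, hy'⟩ := (hper hp).exists_mem_Ico (sub_pos.2 S.lt) ξ S.ξs
    rw [hy']
    refine (hM y ⟨hy.1, ?_⟩).trans (le_max_left _ _)
    linarith [hy.2]
  · exact (hM ξ (h ▸ hξ)).trans (le_max_left _ _)

theorem curvature_continuousOn : ContinuousOn (curvature S.g) S.params := by
  have h1 := S.deriv_continuous
  have h2 := S.deriv_deriv_continuous
  unfold curvature
  refine ContinuousOn.div (by fun_prop) (by fun_prop) fun ξ hξ => ?_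
  have := norm_ne_zero_iff.2 (S.regular ξ hξ)
  positivity

theorem curvature_periodic (h : Function.Periodic S.g (S.ξe - S.ξs)) :
    Function.Periodic (curvature S.g) (S.ξe - S.ξs) := by
  intro ξ
  simp only [curvature, periodic_deriv h ξ, periodic_deriv (periodic_deriv h) ξ]

theorem normal_periodic (h : Function.Periodic S.g (S.ξe - S.ξs)) :
    Function.Periodic (normal S.g) (S.ξe - S.ξs) := by
  intro ξ
  simp only [normal, tangent, periodic_deriv h ξ]

theorem frenet_periodic (h : Function.Periodic S.g (S.ξe - S.ξs)) (η ξ : ℝ) :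
    frenet S.g (η, ξ + (S.ξe - S.ξs)) = frenet S.g (η, ξ) := by
  simp only [frenet, h ξ, S.normal_periodic h ξ]

theorem exists_deriv_bounds : ∃ l L : ℝ, 0 < l ∧ 0 < L ∧
    ∀ ξ ∈ S.params, l ≤ ‖deriv S.g ξ‖ ∧ ‖deriv S.g ξ‖ ≤ L := by
  have hc := S.deriv_continuous
  obtain ⟨L, hL, h1⟩ := S.exists_bound (F := fun ξ => ‖deriv S.g ξ‖) hc.norm.continuousOn
    fun h ξ => by simp only [periodic_deriv h ξ]
  obtain ⟨M, hM, h2⟩ := S.exists_bound (F := fun ξ => ‖deriv S.g ξ‖⁻¹)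
    (hc.norm.continuousOn.inv₀ fun ξ hξ => norm_ne_zero_iff.2 (S.regular ξ hξ))
    fun h ξ => by simp only [periodic_deriv h ξ]
  refine ⟨M⁻¹, L, inv_pos.2 hM, hL, fun ξ hξ => ⟨?_, ?_⟩⟩
  · have := h2 ξ hξ
    rw [abs_inv, abs_norm] at this
    exact inv_le_of_inv_le₀ (norm_pos_iff.2 (S.regular ξ hξ)) this
  · simpa using h1 ξ hξ

/-- Positivity at both ends `η = ±δ` gives `1 - δ |κ| > 0`, a lower bound for the Jacobian factor
across the whole tube. Its reciprocal is continuous along the curve, hence bounded. -/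
theorem exists_jacobian_bounds : ∃ j J : ℝ, 0 < j ∧ 0 < J ∧ ∀ ξ ∈ S.params, ∀ η ∈ Icc (-S.δ) S.δ,
    j ≤ 1 + η * curvature S.g ξ ∧ 1 + η * curvature S.g ξ ≤ J := by
  have hc := S.curvature_continuousOn
  have hpos : ∀ ξ ∈ S.params, 0 < 1 - S.δ * |curvature S.g ξ| := by
    intro ξ hξ
    have hδ := S.δ_pos
    rcases abs_cases (curvature S.g ξ) with ⟨h, -⟩ | ⟨h, -⟩
    · have := S.jacobian_pos (-S.δ) ⟨le_rfl, by linarith⟩ ξ hξ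
      rw [h]; linarith
    · have := S.jacobian_pos S.δ ⟨by linarith, le_rfl⟩ ξ hξ
      rw [h]; linarith
  obtain ⟨M, hM, h1⟩ := S.exists_bound (F := curvature S.g) hc S.curvature_periodic
  obtain ⟨N, hN, h2⟩ := S.exists_bound (F := fun ξ => (1 - S.δ * |curvature S.g ξ|)⁻¹)
    (ContinuousOn.inv₀ (by fun_prop) fun ξ hξ => (hpos ξ hξ).ne')
    fun h ξ => by simp only [S.curvature_periodic h ξ]
  refine ⟨N⁻¹, 1 + S.δ * M, inv_pos.2 hN, by have := S.δ_pos; positivity, fun ξ hξ η hη => ?_⟩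
  have hle : |η * curvature S.g ξ| ≤ S.δ * |curvature S.g ξ| := by
    rw [abs_mul]; gcongr; exact abs_le.2 hη
  have h3 : S.δ * |curvature S.g ξ| ≤ S.δ * M :=
    mul_le_mul_of_nonneg_left (h1 ξ hξ) S.δ_pos.le
  have h4 : N⁻¹ ≤ 1 - S.δ * |curvature S.g ξ| := by
    have := h2 ξ hξ
    rw [abs_inv, abs_of_pos (hpos ξ hξ)] at this
    exact inv_le_of_inv_le₀ (hpos ξ hξ) this
  have := abs_le.1 hle
  exact ⟨by linarith, by linarith⟩

/-- The closed tube in Frenet coordinates. -/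
def strip : Set (ℝ × ℝ) := Icc (-S.δ) S.δ ×ˢ S.params

theorem strip_convex : Convex ℝ S.strip := (convex_Icc _ _).prod S.params_convex

theorem exists_frenet_lipschitz : ∃ L : NNReal, 0 < L ∧ LipschitzOnWith L (frenet S.g) S.strip := by
  obtain ⟨l, L, hl, hL, h1⟩ := S.exists_deriv_bounds
  obtain ⟨j, J, hj, hJ, h2⟩ := S.exists_jacobian_bounds
  have hJL : 0 < 1 + J * L := by positivity
  refine ⟨Real.toNNReal (1 + J * L), Real.toNNReal_pos.2 hJL, ?_⟩
  refine S.strip_convex.lipschitzOnWith_of_nnnorm_hasFDerivWithin_le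
    (fun z hz => (hasFDerivAt_frenet S.smooth (S.regular _ hz.2)).hasFDerivWithinAt) fun z hz => ?_
  rw [← NNReal.coe_le_coe, Real.coe_toNNReal _ hJL.le]
  refine ContinuousLinearMap.opNorm_le_bound _ hJL.le fun x => ?_
  have hx1 : ‖x.1‖ ≤ ‖x‖ := norm_fst_le x
  have hx2 : ‖x.2‖ ≤ ‖x‖ := norm_snd_le x
  have hjz := h2 z.2 hz.2 z.1 hz.1
  simp only [add_apply, ContinuousLinearMap.smulRight_apply,
    ContinuousLinearMap.coe_fst', ContinuousLinearMap.coe_snd']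
  refine (norm_add_le _ _).trans ?_
  rw [norm_smul, norm_smul, norm_smul, norm_normal (S.regular _ hz.2),
    Real.norm_of_nonneg (hj.le.trans hjz.1)]
  calc ‖x.1‖ * 1 + ‖x.2‖ * ((1 + z.1 * curvature S.g z.2) * ‖deriv S.g z.2‖)
      ≤ ‖x‖ * 1 + ‖x‖ * (J * L) := by
        gcongr
        exacts [mul_nonneg (hj.le.trans hjz.1) (norm_nonneg _), hjz.2, (h1 _ hz.2).2]
    _ = (1 + J * L) * ‖x‖ := by ring

theorem frenet_continuousOn : ContinuousOn (frenet S.g) S.strip := by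
  obtain ⟨L, -, h⟩ := S.exists_frenet_lipschitz
  exact h.continuousOn

/-- Let `l` bound the speed from below and `M` the second derivative from above. Over a parameter
distance `l / 2 / M` the derivative changes by at most `l / 2`, so the linear part of `g y - g x`
dominates the remainder. -/
theorem exists_local_expansion : ∃ c r : ℝ, 0 < c ∧ 0 < r ∧ ∀ x ∈ S.params, ∀ y ∈ S.params,
    |y - x| ≤ r → c * |y - x| ≤ ‖S.g y - S.g x‖ := by
  obtain ⟨l, L, hl, hL, h1⟩ := S.exists_deriv_bounds
  obtain ⟨M, hM, h2⟩ := S.exists_bound (F := fun ξ => ‖deriv (deriv S.g) ξ‖)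
    S.deriv_deriv_continuous.norm.continuousOn
    fun h ξ => by simp only [periodic_deriv (periodic_deriv h) ξ]
  refine ⟨l / 2, l / 2 / M, by positivity, by positivity, fun x hx y hy hxy => ?_⟩
  have hsub : uIcc x y ⊆ S.params := S.params_convex.ordConnected.uIcc_subset hx hy
  have hd2 : ∀ t ∈ uIcc x y, ‖deriv S.g t - deriv S.g x‖ ≤ l / 2 := by
    intro t ht
    have := (convex_uIcc x y).norm_image_sub_le_of_norm_hasDerivWithin_le (f := deriv S.g)
      (f' := deriv (deriv S.g)) (C := M)
      (fun u _ => (S.deriv_contDiff.differentiable one_ne_zero u).hasDerivAt.hasDerivWithinAt)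
      (fun u hu => by simpa using h2 u (hsub hu)) left_mem_uIcc ht
    refine this.trans ?_
    have h3 : |t - x| ≤ |y - x| := abs_sub_left_of_mem_uIcc ht
    calc M * ‖t - x‖ ≤ M * (l / 2 / M) := by
          gcongr; exact h3.trans hxy
      _ = l / 2 := by field_simp
  have h4 := (convex_uIcc x y).norm_image_sub_le_of_norm_hasDerivWithin_le
    (f := fun t => S.g t - t • deriv S.g x) (f' := fun t => deriv S.g t - deriv S.g x) (C := l / 2)
    (fun u _ => by
      have ha := (S.smooth.differentiable two_ne_zero u).hasDerivAt
      have hb := (hasDerivAt_id u).smul_const (deriv S.g x)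
      rw [one_smul] at hb
      exact (ha.sub hb).hasDerivWithinAt)
    hd2 left_mem_uIcc right_mem_uIcc
  have h5 : S.g y - S.g x = (y - x) • deriv S.g x
      + ((S.g y - y • deriv S.g x) - (S.g x - x • deriv S.g x)) := by
    rw [sub_smul]; abel
  rw [h5]
  have h6 := norm_sub_le_norm_add ((y - x) • deriv S.g x)
    ((S.g y - y • deriv S.g x) - (S.g x - x • deriv S.g x))
  rw [norm_smul] at h6
  have h7 : ‖y - x‖ * l ≤ ‖y - x‖ * ‖deriv S.g x‖ :=
    mul_le_mul_of_nonneg_left (h1 x hx).1 (norm_nonneg _)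
  rw [Real.norm_eq_abs] at h6 h7 h4
  linarith

theorem curve_injOn_of_arc (hp : S.params = Icc S.ξs S.ξe)
    (h : InjOn (frenet S.g) (Icc (-S.δ) S.δ ×ˢ Icc S.ξs S.ξe)) : InjOn S.g S.params := by
  intro x hx y hy hxy
  have h0 : (0 : ℝ) ∈ Icc (-S.δ) S.δ := ⟨by linarith [S.δ_pos], S.δ_pos.le⟩
  rw [hp] at hx hy
  have := h (x₁ := ((0 : ℝ), x)) (x₂ := ((0 : ℝ), y)) ⟨h0, hx⟩ ⟨h0, hy⟩ (by simp [frenet, hxy])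
  exact congrArg Prod.snd this

/-- Close parameters are covered by the local estimate. Pairs of parameters at distance at least `r`
form a compact set on which the chord does not vanish, the arc being simple. On a closed curve this
fails, since parameters a period apart give the same point. -/
theorem exists_expansion_of_arc (hp : S.params = Icc S.ξs S.ξe)
    (h : InjOn (frenet S.g) (Icc (-S.δ) S.δ ×ˢ Icc S.ξs S.ξe)) : ∃ c : ℝ, 0 < c ∧
    ∀ x ∈ S.params, ∀ y ∈ S.params, c * |y - x| ≤ ‖S.g y - S.g x‖ := by
  obtain ⟨c, r, hc, hr, h1⟩ := S.exists_local_expansion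
  have hinj := S.curve_injOn_of_arc hp h
  let F : Set (ℝ × ℝ) := (Icc S.ξs S.ξe ×ˢ Icc S.ξs S.ξe) ∩ {z | r ≤ |z.2 - z.1|}
  have hF : IsCompact F := (isCompact_Icc.prod isCompact_Icc).inter_right
    (isClosed_le continuous_const (by fun_prop))
  have hgc := S.smooth.continuous
  obtain ⟨μ, hμ, h2⟩ : ∃ μ : ℝ, 0 < μ ∧ ∀ z ∈ F, μ ≤ ‖S.g z.2 - S.g z.1‖ := by
    rcases F.eq_empty_or_nonempty with he | hne
    · exact ⟨1, one_pos, by simp [he]⟩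
    · obtain ⟨z, hz, hmin⟩ := hF.exists_isMinOn hne
        (f := fun z : ℝ × ℝ => ‖S.g z.2 - S.g z.1‖) (by fun_prop)
      refine ⟨_, ?_, fun w hw => hmin hw⟩
      rw [norm_pos_iff, sub_ne_zero]
      intro he
      have := hinj (hp ▸ hz.1.2) (hp ▸ hz.1.1) he
      have h3 : r ≤ |z.2 - z.1| := hz.2
      rw [this, sub_self, abs_zero] at h3
      linarith
  have hL := sub_pos.2 S.lt
  refine ⟨min c (μ / (S.ξe - S.ξs)), lt_min hc (by positivity), fun x hx y hy => ?_⟩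
  rcases le_or_gt |y - x| r with h3 | h3
  · exact (mul_le_mul_of_nonneg_right (min_le_left _ _) (abs_nonneg _)).trans (h1 x hx y hy h3)
  · rw [hp] at hx hy
    refine le_trans ?_ (h2 (x, y) ⟨⟨hx, hy⟩, h3.le⟩)
    have h4 : |y - x| ≤ S.ξe - S.ξs := abs_le.2 ⟨by linarith [hx.2, hy.1], by linarith [hx.1, hy.2]⟩
    calc _ ≤ μ / (S.ξe - S.ξs) * (S.ξe - S.ξs) := by
          gcongr; exact min_le_right _ _
      _ = μ := by field_simp

/-- A point of the tube lies on the curve only if its normal coordinate vanishes. -/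
theorem fst_eq_zero_of_mem {η ξ : ℝ} (hη : η ∈ Icc (-S.δ) S.δ) (hξ : ξ ∈ S.params)
    (h : frenet S.g (η, ξ) ∈ S.Γ) : η = 0 := by
  obtain ⟨ζ, hζ, he⟩ := h
  have h0 : (0 : ℝ) ∈ Icc (-S.δ) S.δ := ⟨by linarith [S.δ_pos], S.δ_pos.le⟩
  have he' : frenet S.g (0, ζ) = frenet S.g (η, ξ) := by rw [← he]; simp [frenet]
  rcases S.tube with ⟨hp, hper, -, hinj⟩ | ⟨hp, -, hinj⟩
  · have hP : ∀ η, Function.Periodic (fun ξ => frenet S.g (η, ξ)) (S.ξe - S.ξs) :=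
      fun η ξ => S.frenet_periodic hper η ξ
    obtain ⟨x, hx, hx'⟩ := (hP η).exists_mem_Ico (sub_pos.2 S.lt) ξ S.ξs
    obtain ⟨y, hy, hy'⟩ := (hP 0).exists_mem_Ico (sub_pos.2 S.lt) ζ S.ξs
    rw [add_sub_cancel] at hx hy
    have := hinj (x₁ := ((0 : ℝ), y)) (x₂ := (η, x)) ⟨h0, hy⟩ ⟨hη, hx⟩
      (by simpa only [← hx', ← hy'] using he')
    exact (congrArg Prod.fst this).symm
  · rw [hp] at hξ hζ
    have := hinj (x₁ := ((0 : ℝ), ζ)) (x₂ := (η, ξ)) ⟨h0, hζ⟩ ⟨hη, hξ⟩ he'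
    exact (congrArg Prod.fst this).symm

end Interface

end

section

/-! ### Expansion of the Laplacian in Frenet coordinates -/

/-- Continuous and bounded on a set. -/
def ContBdd (I : Set ℝ) (F : ℝ → ℝ) : Prop := ContinuousOn F I ∧ ∃ M, ∀ x ∈ I, |F x| ≤ M

namespace ContBdd

variable {I : Set ℝ} {F G : ℝ → ℝ}

theorem const (r : ℝ) : ContBdd I fun _ => r := ⟨continuousOn_const, |r|, fun _ _ => le_rfl⟩

theorem add (hF : ContBdd I F) (hG : ContBdd I G) : ContBdd I fun x => F x + G x := by
  obtain ⟨h1, M, hM⟩ := hF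
  obtain ⟨h2, N, hN⟩ := hG
  exact ⟨h1.add h2, M + N, fun x hx => (abs_add_le _ _).trans (add_le_add (hM x hx) (hN x hx))⟩

theorem mul (hF : ContBdd I F) (hG : ContBdd I G) : ContBdd I fun x => F x * G x := by
  obtain ⟨h1, M, hM⟩ := hF
  obtain ⟨h2, N, hN⟩ := hG
  refine ⟨h1.mul h2, M * N, fun x hx => ?_⟩
  rw [abs_mul]
  exact mul_le_mul (hM x hx) (hN x hx) (abs_nonneg _) ((abs_nonneg _).trans (hM x hx))

theorem sum {ι : Type*} {s : Finset ι} {F : ι → ℝ → ℝ} (h : ∀ i ∈ s, ContBdd I (F i)) :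
    ContBdd I fun x => ∑ i ∈ s, F i x := by
  classical
  induction s using Finset.induction_on with
  | empty => simpa using const 0
  | insert i s hi ih =>
    simp only [Finset.sum_insert hi]
    exact (h i (Finset.mem_insert_self _ _)).add
      (ih fun j hj => h j (Finset.mem_insert_of_mem hj))

theorem congr (hF : ContBdd I F) (h : ∀ x ∈ I, G x = F x) : ContBdd I G := by
  obtain ⟨h1, M, hM⟩ := hF
  exact ⟨h1.congr h, M, fun x hx => by rw [h x hx]; exact hM x hx⟩

end ContBdd

/-- A family of functions that is smooth at `0`, with derivatives at `0` that depend continuously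
and boundedly on the parameter. -/
def SmoothFamily (I : Set ℝ) (f : ℝ → ℝ → ℝ) : Prop :=
  (∀ ξ ∈ I, ContDiffAt ℝ ∞ (f ξ) 0) ∧ ∀ l : ℕ, ContBdd I fun ξ => iteratedDeriv l (f ξ) 0

theorem contDiffAt_nat {f : ℝ → ℝ} {x : ℝ} (h : ContDiffAt ℝ ∞ f x) (n : ℕ) : ContDiffAt ℝ n f x :=
  h.of_le (by exact_mod_cast le_top)

namespace SmoothFamily

variable {I : Set ℝ} {f k : ℝ → ℝ → ℝ}

theorem mul (hf : SmoothFamily I f) (hk : SmoothFamily I k) :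
    SmoothFamily I fun ξ η => f ξ η * k ξ η := by
  refine ⟨fun ξ hξ => (hf.1 ξ hξ).mul (hk.1 ξ hξ), fun l => ?_⟩
  refine (ContBdd.sum (s := Finset.range (l + 1)) fun i _ =>
    ((ContBdd.const (l.choose i : ℝ)).mul (hf.2 i)).mul (hk.2 (l - i))).congr fun ξ hξ => ?_
  exact iteratedDeriv_fun_mul (contDiffAt_nat (hf.1 ξ hξ) l) (contDiffAt_nat (hk.1 ξ hξ) l)

theorem add (hf : SmoothFamily I f) (hk : SmoothFamily I k) :
    SmoothFamily I fun ξ η => f ξ η + k ξ η := by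
  refine ⟨fun ξ hξ => (hf.1 ξ hξ).add (hk.1 ξ hξ), fun l => ?_⟩
  refine ((hf.2 l).add (hk.2 l)).congr fun ξ hξ => ?_
  exact iteratedDeriv_fun_add (contDiffAt_nat (hf.1 ξ hξ) l) (contDiffAt_nat (hk.1 ξ hξ) l)

theorem of_contBdd {F : ℝ → ℝ} (hF : ContBdd I F) : SmoothFamily I fun ξ _ => F ξ := by
  refine ⟨fun ξ _ => contDiffAt_const, fun l => ?_⟩
  simp only [iteratedDeriv_const]
  split_ifs
  · exact hF
  · exact ContBdd.const 0

theorem pow (i : ℕ) : SmoothFamily I fun _ η => η ^ i :=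
  ⟨fun _ _ => contDiffAt_id.pow i, fun _ => ContBdd.const _⟩

/-- Leibniz' rule for `f⁻¹ * f = 1` expresses the derivative of order `l` of the inverse by those of
lower order. As the value at zero is `1`, no division is needed. -/
theorem inv (hf : SmoothFamily I f) (h1 : ∀ ξ ∈ I, f ξ 0 = 1) :
    SmoothFamily I fun ξ η => (f ξ η)⁻¹ := by
  have hsm : ∀ ξ ∈ I, ContDiffAt ℝ ∞ (fun η => (f ξ η)⁻¹) 0 := fun ξ hξ =>
    (hf.1 ξ hξ).inv (by rw [h1 ξ hξ]; exact one_ne_zero)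
  refine ⟨hsm, fun l => ?_⟩
  induction l using Nat.strong_induction_on with
  | _ l ih =>
    rcases Nat.eq_zero_or_pos l with rfl | hl
    · refine (ContBdd.const 1).congr fun ξ hξ => ?_
      simp [h1 ξ hξ]
    · refine ((ContBdd.const (-1)).mul (ContBdd.sum (s := Finset.range l) fun i hi =>
        ((ContBdd.const (l.choose i : ℝ)).mul (ih i (Finset.mem_range.1 hi))).mul
          (hf.2 (l - i)))).congr fun ξ hξ => ?_
      have h2 := iteratedDeriv_fun_mul (contDiffAt_nat (hsm ξ hξ) l) (contDiffAt_nat (hf.1 ξ hξ) l)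
      have h3 : iteratedDeriv l (fun η => (f ξ η)⁻¹ * f ξ η) 0 = 0 := by
        have : (fun η => (f ξ η)⁻¹ * f ξ η) =ᶠ[nhds 0] fun _ => 1 := by
          have hne : ∀ᶠ η in nhds 0, f ξ η ≠ 0 :=
            (hf.1 ξ hξ).continuousAt.eventually_ne (by rw [h1 ξ hξ]; exact one_ne_zero)
          filter_upwards [hne] with η hη using inv_mul_cancel₀ hη
        rw [this.iteratedDeriv_eq l, iteratedDeriv_const, if_neg hl.ne']
      rw [h3, Finset.sum_range_succ] at h2
      simp only [Nat.choose_self, Nat.cast_one, one_mul, Nat.sub_self, iteratedDeriv_zero,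
        h1 ξ hξ, mul_one] at h2
      linarith

/-- The derivative of order `j` of `A η ^ i` at zero vanishes if `j < i`. -/
theorem iteratedDeriv_mul_pow_eq_zero {A : ℝ → ℝ} (hA : ContDiffAt ℝ ∞ A 0) {i j : ℕ}
    (h : j < i) : iteratedDeriv j (fun η => A η * η ^ i) 0 = 0 := by
  have hp : ContDiffAt ℝ j (fun η : ℝ => η ^ i) 0 := contDiffAt_id.pow i
  rw [iteratedDeriv_fun_mul (contDiffAt_nat hA j) hp]
  refine Finset.sum_eq_zero fun k _ => ?_
  rw [iteratedDeriv_fun_pow_zero, if_neg (by omega), Nat.cast_zero, mul_zero]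

end SmoothFamily

section Expansion

variable {Q : Rect} (S : Interface Q)

theorem Interface.contBdd {F : ℝ → ℝ} (hF : ContinuousOn F S.params)
    (hper : Function.Periodic S.g (S.ξe - S.ξs) → Function.Periodic F (S.ξe - S.ξs)) :
    ContBdd S.params F :=
  ⟨hF, (S.exists_bound hF hper).imp fun _ h => h.2⟩

theorem Interface.deriv_curvature_continuousOn (h : ContDiff ℝ 3 S.g) :
    ContinuousOn (deriv (curvature S.g)) S.params := by
  have h1 : ContDiff ℝ 2 (deriv S.g) := by
    have := h.iterate_deriv' 2 1
    simpa using this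
  have h2 : ContDiff ℝ 1 (deriv (deriv S.g)) := by
    have := h1.iterate_deriv' 1 1
    simpa using this
  have hU : IsOpen {ξ | deriv S.g ξ ≠ 0} := isOpen_ne_fun S.deriv_continuous continuous_const
  have h1' : ContDiff ℝ 1 (deriv S.g) := h1.of_le (by norm_num)
  have hi1 : ∀ i, ContDiff ℝ 1 fun ξ => deriv S.g ξ i := fun i => contDiff_euclidean.1 h1' i
  have hi2 : ∀ i, ContDiff ℝ 1 fun ξ => deriv (deriv S.g) ξ i := fun i => contDiff_euclidean.1 h2 i
  have hk : ContDiffOn ℝ 1 (curvature S.g) {ξ | deriv S.g ξ ≠ 0} := by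
    unfold curvature
    refine ContDiffOn.div ?_ ?_ ?_
    · exact (((hi1 0).mul (hi2 1)).sub ((hi1 1).mul (hi2 0))).contDiffOn
    · exact (h1'.contDiffOn.norm ℝ fun ξ hξ => hξ).pow 3
    · intro ξ hξ
      have := norm_ne_zero_iff.2 (show deriv S.g ξ ≠ 0 from hξ)
      positivity
  exact (hk.continuousOn_deriv_of_isOpen hU le_rfl).mono fun ξ hξ => S.regular ξ hξ

/-- Structure of the interface conditions of higher order. -/
theorem Interface.frenetLaplacian_expansion (m : ℕ) (h3 : 3 ≤ m → ContDiff ℝ 3 S.g) :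
    ∃ α γ ρ : ℕ → ℕ → ℝ → ℝ,
      (∀ j i, j + 2 ≤ m → ContBdd S.params (α j i) ∧ ContBdd S.params (γ j i) ∧
        ContBdd S.params (ρ j i)) ∧
      (∀ j i ξ, ξ ∈ S.params → j < i → α j i ξ = 0 ∧ γ j i ξ = 0) ∧
      (∀ j i ξ, ξ ∈ S.params → j + 1 < i → ρ j i ξ = 0) ∧
      ∀ (c : Coef m) (j : ℕ) (hj : j + 2 ≤ m), ∀ ξ ∈ S.params,
        iteratedDeriv j (fun η => frenetLaplacian S.g (qEval m c) η ξ) 0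
          = ((j + 2).factorial : ℝ) * (row c ⟨j + 2, Nat.lt_succ_of_le hj⟩).eval ξ
            + ∑ i : Fin (m + 1), (α j i ξ * (row c i).derivative.derivative.eval ξ
              + γ j i ξ * (row c i).derivative.eval ξ + ρ j i ξ * ((i : ℕ) * (row c i).eval ξ)) := by
  have hc1 := S.deriv_continuous
  have hc2 := S.deriv_deriv_continuous
  have hne : ∀ ξ ∈ S.params, ‖deriv S.g ξ‖ ≠ 0 := fun ξ hξ => norm_ne_zero_iff.2 (S.regular ξ hξ)
  -- The derivative of the curvature enters only with a factor `η`. For `m ≤ 2` only `j = 0` occurs,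
  -- where `η = 0`, so it may be replaced by zero and two derivatives of the curve suffice.
  let κ' : ℝ → ℝ := if 3 ≤ m then deriv (curvature S.g) else 0
  have bκ : ContBdd S.params (curvature S.g) := S.contBdd S.curvature_continuousOn S.curvature_periodic
  have bκ' : ContBdd S.params κ' := by
    by_cases hm : 3 ≤ m
    · simp only [κ', if_pos hm]
      exact S.contBdd (S.deriv_curvature_continuousOn (h3 hm))
        fun h => periodic_deriv (S.curvature_periodic h)
    · simp only [κ', if_neg hm]
      exact ContBdd.const 0
  have bn : ContBdd S.params fun ξ => ‖deriv S.g ξ‖⁻¹ := by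
    refine S.contBdd (hc1.norm.continuousOn.inv₀ hne) fun h ξ => ?_
    simp only [periodic_deriv h ξ]
  have bi : ContBdd S.params fun ξ => inner ℝ (deriv S.g ξ) (deriv (deriv S.g) ξ)
      / ‖deriv S.g ξ‖ ^ 2 := by
    refine S.contBdd ?_ fun h ξ => ?_
    · refine ContinuousOn.div (by fun_prop) (by fun_prop) fun ξ hξ => ?_
      exact pow_ne_zero 2 (hne ξ hξ)
    · simp only [periodic_deriv h ξ, periodic_deriv (periodic_deriv h) ξ]
  have sψ : SmoothFamily S.params fun ξ η => psi S.g η ξ := by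
    have h1 : SmoothFamily S.params fun ξ η => 1 + η ^ 1 * curvature S.g ξ :=
      (SmoothFamily.of_contBdd (ContBdd.const 1)).add
        ((SmoothFamily.pow 1).mul (SmoothFamily.of_contBdd bκ))
    have h2 := h1.inv fun ξ _ => by simp
    simpa only [pow_one, psi] using h2
  have sψn : SmoothFamily S.params fun ξ η => psi S.g η ξ * ‖deriv S.g ξ‖⁻¹ :=
    sψ.mul (SmoothFamily.of_contBdd bn)
  have sA : SmoothFamily S.params fun ξ η => (psi S.g η ξ / ‖deriv S.g ξ‖) ^ 2 := by
    simpa only [pow_two, div_eq_mul_inv] using sψn.mul sψn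
  have sB : SmoothFamily S.params fun ξ η => curvature S.g ξ * psi S.g η ξ :=
    (SmoothFamily.of_contBdd bκ).mul sψ
  have sD : SmoothFamily S.params fun ξ η => -1 * ((psi S.g η ξ / ‖deriv S.g ξ‖) ^ 2 *
      (η ^ 1 * κ' ξ * psi S.g η ξ
        + inner ℝ (deriv S.g ξ) (deriv (deriv S.g) ξ) / ‖deriv S.g ξ‖ ^ 2)) :=
    (SmoothFamily.of_contBdd (ContBdd.const (-1))).mul (sA.mul
      ((((SmoothFamily.pow 1).mul (SmoothFamily.of_contBdd bκ')).mul sψ).add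
        (SmoothFamily.of_contBdd bi)))
  -- Row `i` meets `η ^ i` in the tangential terms and `i η ^ (i - 1)` in the curvature term; the
  -- coefficient functions are normal derivatives at zero of these products, which explains where
  -- they vanish. The truncated exponent at `i = 0` is harmless because that term carries the factor
  -- `i`.
  refine ⟨fun j i ξ => iteratedDeriv j (fun η => (psi S.g η ξ / ‖deriv S.g ξ‖) ^ 2 * η ^ i) 0,
    fun j i ξ => iteratedDeriv j (fun η => -1 * ((psi S.g η ξ / ‖deriv S.g ξ‖) ^ 2 *
      (η ^ 1 * κ' ξ * psi S.g η ξ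
        + inner ℝ (deriv S.g ξ) (deriv (deriv S.g) ξ) / ‖deriv S.g ξ‖ ^ 2)) * η ^ i) 0,
    fun j i ξ => iteratedDeriv j (fun η => curvature S.g ξ * psi S.g η ξ * η ^ (i - 1)) 0,
    fun j i _ => ⟨(sA.mul (SmoothFamily.pow i)).2 j, (sD.mul (SmoothFamily.pow i)).2 j,
      (sB.mul (SmoothFamily.pow (i - 1))).2 j⟩,
    fun j i ξ hξ hij => ⟨SmoothFamily.iteratedDeriv_mul_pow_eq_zero (sA.1 ξ hξ) hij,
      SmoothFamily.iteratedDeriv_mul_pow_eq_zero (sD.1 ξ hξ) hij⟩,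
    fun j i ξ hξ hij => SmoothFamily.iteratedDeriv_mul_pow_eq_zero (sB.1 ξ hξ) (by omega), ?_⟩
  intro c j hj ξ hξ
  have e1 : ∀ η, deriv (fun s => qEval m c s ξ) η
      = ∑ i : Fin (m + 1), ((i : ℕ) * η ^ ((i : ℕ) - 1)) * (row c i).eval ξ := by
    intro η
    simp only [qEval_eq_sum_row]
    exact (HasDerivAt.fun_sum fun (i : Fin (m + 1)) _ =>
      (hasDerivAt_pow (i : ℕ) η).mul_const ((row c i).eval ξ)).deriv
  have e2 : ∀ η, iteratedDeriv 2 (fun s => qEval m c s ξ) η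
      = ∑ i : Fin (m + 1), ((i : ℕ) * (((i : ℕ) - 1 : ℕ) * η ^ ((i : ℕ) - 1 - 1)))
        * (row c i).eval ξ := by
    intro η
    rw [iteratedDeriv_succ, iteratedDeriv_one, funext e1]
    exact (HasDerivAt.fun_sum fun (i : Fin (m + 1)) _ =>
      (((hasDerivAt_pow ((i : ℕ) - 1) η).const_mul ((i : ℕ) : ℝ)).mul_const
        ((row c i).eval ξ))).deriv
  have e3 : ∀ η ζ, deriv (fun t => qEval m c η t) ζ
      = ∑ i : Fin (m + 1), η ^ (i : ℕ) * (row c i).derivative.eval ζ := by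
    intro η ζ
    simp only [qEval_eq_sum_row]
    exact (HasDerivAt.fun_sum fun i _ => ((row c i).hasDerivAt ζ).const_mul _).deriv
  have e4 : ∀ η, iteratedDeriv 2 (fun t => qEval m c η t) ξ
      = ∑ i : Fin (m + 1), η ^ (i : ℕ) * (row c i).derivative.derivative.eval ξ := by
    intro η
    rw [iteratedDeriv_succ, iteratedDeriv_one, funext (e3 η)]
    exact (HasDerivAt.fun_sum fun i _ => ((row c i).derivative.hasDerivAt ξ).const_mul _).deriv
  let Lκ : ℝ → ℝ := fun η => ∑ i : Fin (m + 1),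
    ((((i : ℕ) * (((i : ℕ) - 1 : ℕ) : ℝ)) * (row c i).eval ξ) * η ^ ((i : ℕ) - 1 - 1)
    + (row c i).derivative.derivative.eval ξ * ((psi S.g η ξ / ‖deriv S.g ξ‖) ^ 2 * η ^ (i : ℕ))
    + (row c i).derivative.eval ξ * ((-1 * ((psi S.g η ξ / ‖deriv S.g ξ‖) ^ 2 *
      (η ^ 1 * κ' ξ * psi S.g η ξ
        + inner ℝ (deriv S.g ξ) (deriv (deriv S.g) ξ) / ‖deriv S.g ξ‖ ^ 2))) * η ^ (i : ℕ))
    + ((i : ℕ) * (row c i).eval ξ) * (curvature S.g ξ * psi S.g η ξ * η ^ ((i : ℕ) - 1)))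
  have hL : ∀ η, (3 ≤ m ∨ η = 0) → frenetLaplacian S.g (qEval m c) η ξ = Lκ η := by
    intro η hη
    have hκ : η * deriv (curvature S.g) ξ = η ^ 1 * κ' ξ := by
      rcases hη with h | h
      · simp [κ', h]
      · simp [h]
    simp only [frenetLaplacian, hκ, e1, e2, e3, e4, Lκ, Finset.sum_add_distrib]
    simp only [Finset.mul_sum]
    simp only [← Finset.sum_add_distrib, sub_eq_add_neg, ← Finset.sum_neg_distrib]
    refine Finset.sum_congr rfl fun i _ => ?_
    ring
  have hLj : iteratedDeriv j (fun η => frenetLaplacian S.g (qEval m c) η ξ) 0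
      = iteratedDeriv j Lκ 0 := by
    by_cases hm : 3 ≤ m
    · rw [funext fun η => hL η (Or.inl hm)]
    · obtain rfl : j = 0 := by omega
      simpa using hL 0 (Or.inr rfl)
  have d1 : ∀ n : ℕ, ContDiffAt ℝ j (fun η : ℝ => η ^ n) 0 := fun n => contDiffAt_id.pow n
  have d2 : ∀ n : ℕ, ContDiffAt ℝ j
      (fun η => (psi S.g η ξ / ‖deriv S.g ξ‖) ^ 2 * η ^ n) 0 := fun n =>
    contDiffAt_nat ((sA.mul (SmoothFamily.pow n)).1 ξ hξ) j
  have d3 := fun n : ℕ => contDiffAt_nat ((sD.mul (SmoothFamily.pow n)).1 ξ hξ) j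
  have d4 := fun n : ℕ => contDiffAt_nat ((sB.mul (SmoothFamily.pow n)).1 ξ hξ) j
  rw [hLj, iteratedDeriv_fun_sum fun i _ => (((contDiffAt_const.mul (d1 _)).add
    (contDiffAt_const.mul (d2 _))).add (contDiffAt_const.mul (d3 _))).add
    (contDiffAt_const.mul (d4 _))]
  -- The second normal derivative contributes `i (i - 1) η ^ (i - 2)`, whose derivative of order `j`
  -- at zero survives only for `i = j + 2`. This is the leading term.
  have hterm : ∀ i : Fin (m + 1), iteratedDeriv j (fun η : ℝ =>
      (((i : ℕ) * (((i : ℕ) - 1 : ℕ) : ℝ)) * (row c i).eval ξ) * η ^ ((i : ℕ) - 1 - 1)) 0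
      = if (i : ℕ) = j + 2 then ((j + 2).factorial : ℝ) * (row c i).eval ξ else 0 := by
    intro i
    rw [iteratedDeriv_const_mul _ (d1 _), iteratedDeriv_fun_pow_zero]
    by_cases hi : (i : ℕ) = j + 2
    · rw [if_pos hi, if_pos (by omega), hi]
      have h1 : j + 2 - 1 - 1 = j := by omega
      have h2 : j + 2 - 1 = j + 1 := by omega
      rw [h1, h2, Nat.factorial_succ, Nat.factorial_succ]
      push_cast
      ring
    · rw [if_neg hi]
      split_ifs with h
      · have : (i : ℕ) = 0 ∨ (i : ℕ) - 1 = 0 := by omega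
        rcases this with h' | h' <;> simp [h']
      · simp
  have hsum : ∑ i : Fin (m + 1), (if (i : ℕ) = j + 2 then
      ((j + 2).factorial : ℝ) * (row c i).eval ξ else 0)
      = ((j + 2).factorial : ℝ) * (row c ⟨j + 2, Nat.lt_succ_of_le hj⟩).eval ξ := by
    rw [Finset.sum_eq_single ⟨j + 2, Nat.lt_succ_of_le hj⟩]
    · simp
    · intro b _ hb
      rw [if_neg fun h => hb (Fin.ext h)]
    · simp
  rw [← hsum, ← Finset.sum_add_distrib]
  refine Finset.sum_congr rfl fun i _ => ?_
  rw [iteratedDeriv_fun_add (((contDiffAt_const.mul (d1 _)).add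
    (contDiffAt_const.mul (d2 _))).add (contDiffAt_const.mul (d3 _)))
    (contDiffAt_const.mul (d4 _)), iteratedDeriv_fun_add ((contDiffAt_const.mul (d1 _)).add
    (contDiffAt_const.mul (d2 _))) (contDiffAt_const.mul (d3 _)),
    iteratedDeriv_fun_add (contDiffAt_const.mul (d1 _)) (contDiffAt_const.mul (d2 _)), hterm,
    iteratedDeriv_const_mul _ (d2 _), iteratedDeriv_const_mul _ (d3 _),
    iteratedDeriv_const_mul _ (d4 _)]
  ring

end Expansion

end

section

/-! ### Interface conditions transfer bounds across the interface -/

theorem rescale_linear {m : ℕ} (h a l x y : ℝ) (c d : Coef m) :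
    rescale h a l (x • c + y • d) = x • rescale h a l c + y • rescale h a l d := by
  funext i j
  simp only [rescale, row_add, row_smul, Polynomial.add_comp, Polynomial.mul_comp,
    Polynomial.C_comp, Polynomial.coeff_add, Polynomial.coeff_C_mul, Pi.add_apply, Pi.smul_apply,
    smul_eq_mul]
  ring

theorem seminorm_add_le {m : ℕ} (c d : Coef m) : seminorm (c + d) ≤ seminorm c + seminorm d := by
  unfold seminorm
  rw [← Finset.sum_add_distrib]
  refine Finset.sum_le_sum fun i _ => ?_
  rw [← Finset.sum_add_distrib]
  refine Finset.sum_le_sum fun j _ => ?_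
  split_ifs
  · simp
  · exact abs_add_le _ _

section RowBounds

variable {m : ℕ} {d : Coef m} {k : Fin (m + 1)} {V t : ℝ}

theorem abs_sum_fin_le (F : Fin (m + 1) → ℝ) {M : ℝ} (h : ∀ l, |F l| ≤ M) :
    |∑ l, F l| ≤ (m + 1) * M := by
  refine (Finset.abs_sum_le_sum_abs _ _).trans ((Finset.sum_le_sum fun l _ => h l).trans ?_)
  simp

theorem abs_mul_row_eval_le (hV : 0 ≤ V) (ht : |t| ≤ 1)
    (h : ∀ l : Fin (m + 1), ¬ ((k : ℕ) = 0 ∧ (l : ℕ) = 0) → |d k l| ≤ V) :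
    |(k : ℕ) * (row d k).eval t| ≤ (m + 1) ^ 3 * V := by
  have hk : ((k : ℕ) : ℝ) ≤ m := by exact_mod_cast Nat.lt_succ_iff.1 k.2
  rw [row_eval, Finset.mul_sum]
  refine (abs_sum_fin_le _ (M := m * V) fun l => ?_).trans ?_
  · by_cases hl : (k : ℕ) = 0
    · rw [hl]; simp; positivity
    · rw [abs_mul, abs_mul, Nat.abs_cast]
      calc _ ≤ (m : ℝ) * (V * 1) := by
            gcongr
            · exact h l fun h' => hl h'.1
            · exact abs_pow_le_one ht _
        _ = _ := by ring
  · nlinarith [mul_nonneg (Nat.cast_nonneg (α := ℝ) m) hV, Nat.cast_nonneg (α := ℝ) m,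
      mul_nonneg (sq_nonneg (m : ℝ)) hV, mul_nonneg (pow_nonneg (Nat.cast_nonneg (α := ℝ) m) 3) hV]

theorem row_derivative_eval (d : Coef m) (k : Fin (m + 1)) (t : ℝ) :
    (row d k).derivative.eval t = ∑ l : Fin (m + 1), d k l * ((l : ℕ) * t ^ ((l : ℕ) - 1)) := by
  simp [row, Polynomial.eval_finsetSum, Polynomial.derivative_X_pow]

theorem row_derivative_derivative_eval (d : Coef m) (k : Fin (m + 1)) (t : ℝ) :
    (row d k).derivative.derivative.eval t
      = ∑ l : Fin (m + 1), d k l * ((l : ℕ) * (((l : ℕ) - 1 : ℕ) * t ^ ((l : ℕ) - 1 - 1))) := by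
  simp [row, Polynomial.eval_finsetSum, Polynomial.derivative_X_pow]

theorem abs_row_derivative_eval_le (hV : 0 ≤ V) (ht : |t| ≤ 1)
    (h : ∀ l : Fin (m + 1), ¬ ((k : ℕ) = 0 ∧ (l : ℕ) = 0) → |d k l| ≤ V) :
    |(row d k).derivative.eval t| ≤ (m + 1) ^ 3 * V := by
  rw [row_derivative_eval]
  refine (abs_sum_fin_le _ (M := m * V) fun l => ?_).trans ?_
  · have hk : ((l : ℕ) : ℝ) ≤ m := by exact_mod_cast Nat.lt_succ_iff.1 l.2
    by_cases hl : (l : ℕ) = 0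
    · rw [hl]; simp; positivity
    · rw [abs_mul, abs_mul, Nat.abs_cast]
      calc _ ≤ V * ((m : ℝ) * 1) := by
            gcongr
            · exact h l fun h' => hl h'.2
            · exact abs_pow_le_one ht _
        _ = _ := by ring
  · nlinarith [mul_nonneg (Nat.cast_nonneg (α := ℝ) m) hV, Nat.cast_nonneg (α := ℝ) m,
      mul_nonneg (sq_nonneg (m : ℝ)) hV, mul_nonneg (pow_nonneg (Nat.cast_nonneg (α := ℝ) m) 3) hV]

theorem abs_row_derivative_derivative_eval_le (hV : 0 ≤ V) (ht : |t| ≤ 1)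
    (h : ∀ l : Fin (m + 1), ¬ ((k : ℕ) = 0 ∧ (l : ℕ) = 0) → |d k l| ≤ V) :
    |(row d k).derivative.derivative.eval t| ≤ (m + 1) ^ 3 * V := by
  rw [row_derivative_derivative_eval]
  refine (abs_sum_fin_le _ (M := m * m * V) fun l => ?_).trans ?_
  · have hk : ((l : ℕ) : ℝ) ≤ m := by exact_mod_cast Nat.lt_succ_iff.1 l.2
    have hk' : (((l : ℕ) - 1 : ℕ) : ℝ) ≤ m := by
      have := Nat.lt_succ_iff.1 l.2
      exact_mod_cast (by omega : (l : ℕ) - 1 ≤ m)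
    by_cases hl : (l : ℕ) = 0
    · rw [hl]; simp; positivity
    · rw [abs_mul, abs_mul, abs_mul, Nat.abs_cast, Nat.abs_cast]
      calc _ ≤ V * ((m : ℝ) * (m * 1)) := by
            gcongr
            · exact h l fun h' => hl h'.2
            · exact abs_pow_le_one ht _
        _ = _ := by ring
  · nlinarith [mul_nonneg (Nat.cast_nonneg (α := ℝ) m) hV, Nat.cast_nonneg (α := ℝ) m,
      mul_nonneg (sq_nonneg (m : ℝ)) hV, mul_nonneg (pow_nonneg (Nat.cast_nonneg (α := ℝ) m) 3) hV]

end RowBounds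

theorem derivative_comp_affine (p : Polynomial ℝ) (x a l : ℝ) :
    (Polynomial.C x * p.comp (Polynomial.C a + Polynomial.C l * Polynomial.X)).derivative
      = Polynomial.C (x * l) *
        p.derivative.comp (Polynomial.C a + Polynomial.C l * Polynomial.X) := by
  rw [Polynomial.derivative_C_mul, Polynomial.derivative_comp]
  simp only [Polynomial.derivative_add, Polynomial.derivative_C, Polynomial.derivative_C_mul,
    Polynomial.derivative_X, zero_add, mul_one, map_mul]
  ring

section

variable {Q : Rect} (S : Interface Q)

/-- Normal derivatives of the Laplacian on the interface. -/
def lapDeriv (g : ℝ → Pt) {m : ℕ} (j : ℕ) (c : Coef m) (ξ : ℝ) : ℝ :=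
  iteratedDeriv j (fun η => frenetLaplacian g (qEval m c) η ξ) 0

theorem Interface.lapDeriv_linear {m : ℕ} (h3 : 3 ≤ m → ContDiff ℝ 3 S.g) {j : ℕ} (hj : j + 2 ≤ m)
    (x y : ℝ) (c d : Coef m) {ξ : ℝ} (hξ : ξ ∈ S.params) :
    lapDeriv S.g j (x • c + y • d) ξ = x * lapDeriv S.g j c ξ + y * lapDeriv S.g j d ξ := by
  obtain ⟨α, γ, ρ, -, -, -, H⟩ := S.frenetLaplacian_expansion m h3
  simp only [lapDeriv]
  rw [H _ j hj ξ hξ, H _ j hj ξ hξ, H _ j hj ξ hξ]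
  simp only [row_add, row_smul, Polynomial.derivative_add, Polynomial.derivative_C_mul,
    Polynomial.eval_add, Polynomial.eval_mul, Polynomial.eval_C, mul_add, Finset.mul_sum]
  rw [add_add_add_comm, ← Finset.sum_add_distrib]
  congr 1
  · ring
  · exact Finset.sum_congr rfl fun i _ => by ring

theorem Interface.lapDeriv_continuousOn {m : ℕ} (h3 : 3 ≤ m → ContDiff ℝ 3 S.g) {j : ℕ}
    (hj : j + 2 ≤ m) (c : Coef m) : ContinuousOn (lapDeriv S.g j c) S.params := by
  obtain ⟨α, γ, ρ, hb, -, -, H⟩ := S.frenetLaplacian_expansion m h3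
  refine ContinuousOn.congr ?_ fun ξ hξ => H c j hj ξ hξ
  refine (Polynomial.continuous _).continuousOn.const_mul _ |>.add ?_
  refine continuousOn_finsetSum _ fun i _ => ?_
  obtain ⟨h1, h2, h3⟩ := hb j i hj
  exact ((h1.1.mul (Polynomial.continuous _).continuousOn).add
    (h2.1.mul (Polynomial.continuous _).continuousOn)).add
    (h3.1.mul ((Polynomial.continuous _).continuousOn.const_mul _))

/-- Orthogonality gives `f ∫ E² = -∫ F E`, and the right side is at most `(M² (b - a) + ∫ E²) / 2`;
as `f ≥ 1`, half of `∫ E²` can be absorbed on the left. -/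
theorem sq_integral_le_of_orthogonal {a b f M : ℝ} (hab : a ≤ b) (hf : 1 ≤ f) {E F : ℝ → ℝ}
    (hE : ContinuousOn E (Icc a b)) (hF : ContinuousOn F (Icc a b))
    (hM : ∀ ξ ∈ Icc a b, |F ξ| ≤ M) (h0 : ∫ ξ in a..b, (f * E ξ + F ξ) * E ξ = 0) :
    ∫ ξ in a..b, E ξ ^ 2 ≤ M ^ 2 * (b - a) := by
  rw [← uIcc_of_le hab] at hE hF
  have i1 : IntervalIntegrable (fun ξ => E ξ ^ 2) volume a b := (hE.pow 2).intervalIntegrable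
  have i2 : IntervalIntegrable (fun ξ => F ξ * E ξ) volume a b := (hF.mul hE).intervalIntegrable
  have e1 : ∫ ξ in a..b, (f * E ξ + F ξ) * E ξ
      = f * (∫ ξ in a..b, E ξ ^ 2) + ∫ ξ in a..b, F ξ * E ξ := by
    rw [← intervalIntegral.integral_const_mul, ← intervalIntegral.integral_add (i1.const_mul f) i2]
    congr 1; ext ξ; ring
  have h2 : 0 ≤ ∫ ξ in a..b, E ξ ^ 2 :=
    intervalIntegral.integral_nonneg hab fun _ _ => sq_nonneg _
  have h3 : ∫ ξ in a..b, (-(F ξ * E ξ)) ≤ ∫ ξ in a..b, (M ^ 2 / 2 + E ξ ^ 2 / 2) := by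
    refine intervalIntegral.integral_mono_on hab i2.neg
      ((intervalIntegrable_const).add (i1.div_const 2)) fun ξ hξ => ?_
    have h4 := abs_le.1 (hM ξ hξ)
    have h5 : F ξ ^ 2 ≤ M ^ 2 := sq_le_sq' h4.1 h4.2
    nlinarith [sq_nonneg (F ξ + E ξ)]
  rw [intervalIntegral.integral_neg, intervalIntegral.integral_add intervalIntegrable_const
    (i1.div_const 2), intervalIntegral.integral_const, intervalIntegral.integral_div,
    smul_eq_mul] at h3
  rw [e1] at h0
  nlinarith

theorem integral_comp_affine {a b : ℝ} (hab : a < b) (F : ℝ → ℝ) :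
    ∫ t in (0:ℝ)..1, F (a + (b - a) * t) = (b - a)⁻¹ * ∫ ξ in a..b, F ξ := by
  have h := intervalIntegral.integral_comp_mul_add (a := 0) (b := 1) F (sub_pos.2 hab).ne' a
  simp only [mul_zero, zero_add, mul_one, smul_eq_mul, sub_add_cancel] at h
  rw [← h]
  congr 1; ext t; rw [add_comm]

/-- One step of the recursion for the rows of the jump of the coefficients. -/
theorem Interface.exists_row_bound (m : ℕ) (h3 : 3 ≤ m → ContDiff ℝ 3 S.g) {r : ℝ} (hr : 0 < r)
    {j : ℕ} (hj : j + 2 ≤ m) :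
    ∃ C : ℝ, 0 < C ∧ ∀ (h a b : ℝ) (e : Coef m) (V : ℝ), 0 < h → h ≤ S.δ → a < b →
      Icc a b ⊆ S.params → h ≤ r * (b - a) → 0 ≤ V →
      (∀ i l : Fin (m + 1), (i : ℕ) ≤ j + 1 → ¬ ((i : ℕ) = 0 ∧ (l : ℕ) = 0) →
        |rescale h a (b - a) e i l| ≤ V) →
      (∀ q : Polynomial ℝ, q.natDegree ≤ m → ∫ ξ in a..b, lapDeriv S.g j e ξ * q.eval ξ = 0) →
      ∀ l, |rescale h a (b - a) e ⟨j + 2, Nat.lt_succ_of_le hj⟩ l| ≤ C * V := by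
  obtain ⟨α, γ, ρ, hb, hαγ, hρ, H⟩ := S.frenetLaplacian_expansion m h3
  obtain ⟨K, hK, hK'⟩ := coeff_sq_le_integral m
  choose! Mα hMα using fun i => (hb j i hj).1.2
  choose! Mγ hMγ using fun i => (hb j i hj).2.1.2
  choose! Mρ hMρ using fun i => (hb j i hj).2.2.2
  have hδ := S.δ_pos
  set D : ℝ := (m + 1) ^ 3 with hD
  -- A bound for all powers of `h` up to the order `m`, since `h ≤ δ`.
  set W : ℝ := (1 + S.δ) ^ m with hW
  set A : ℝ := ∑ i : Fin (m + 1), (|Mα i| * (r ^ 2 * W * D) + |Mγ i| * (r * W * D)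
    + |Mρ i| * (W * D)) with hA
  have hA0 : 0 ≤ A := Finset.sum_nonneg fun i _ => by positivity
  refine ⟨√K * A + 1, by positivity, fun h a b e V hh hhδ hab hI hhr hV hVe hq l => ?_⟩
  set ℓ := b - a with hℓ
  have hℓ0 : 0 < ℓ := sub_pos.2 hab
  set i₀ : Fin (m + 1) := ⟨j + 2, Nat.lt_succ_of_le hj⟩ with hi₀
  have hhW : ∀ n : ℕ, n ≤ m → h ^ n ≤ W := fun n hn =>
    (pow_le_pow_left₀ hh.le (by linarith) n).trans (pow_le_pow_right₀ (by linarith) hn)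
  have hhℓ : h / ℓ ≤ r := (div_le_iff₀ hℓ0).2 hhr
  let F : ℝ → ℝ := fun ξ => ∑ i : Fin (m + 1), (α j i ξ * (row e i).derivative.derivative.eval ξ
              + γ j i ξ * (row e i).derivative.eval ξ + ρ j i ξ * ((i : ℕ) * (row e i).eval ξ))
  have hFc : ContinuousOn F (Icc a b) := by
    refine continuousOn_finsetSum _ fun i _ => ?_
    obtain ⟨h1, h2, h3⟩ := hb j i hj
    exact (((h1.1.mono hI).mul (Polynomial.continuous _).continuousOn).add
      ((h2.1.mono hI).mul (Polynomial.continuous _).continuousOn)).add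
      ((h3.1.mono hI).mul ((Polynomial.continuous _).continuousOn.const_mul _))
  -- After scaling, row `i` carries the weight `h ^ i` and each tangential derivative a factor `ℓ =
  -- b - a`. Multiplication by `h ^ (j + 2)` leaves only nonnegative powers of `h` and of `h / ℓ ≤
  -- r`, because `α` and `γ` see rows `i ≤ j` only and `ρ` sees rows `i ≤ j + 1` only.
  have hFb : ∀ ξ ∈ Icc a b, |F ξ| ≤ A * V / h ^ (j + 2) := by
    intro ξ hξ
    have hξp := hI hξ
    set t := (ξ - a) / ℓ with ht
    have hξt : a + ℓ * t = ξ := by rw [ht]; field_simp; ring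
    have ht1 : |t| ≤ 1 := by
      rw [abs_le]
      have h0 : 0 ≤ t := div_nonneg (by linarith [hξ.1]) hℓ0.le
      have h1 : t ≤ 1 := (div_le_one hℓ0).2 (by rw [hℓ]; linarith [hξ.2])
      exact ⟨by linarith, h1⟩
    rw [le_div_iff₀ (by positivity), hA, Finset.sum_mul]
    refine (mul_le_mul_of_nonneg_right (Finset.abs_sum_le_sum_abs _ _) (by positivity)).trans ?_
    rw [Finset.sum_mul]
    refine Finset.sum_le_sum fun i _ => ?_
    have hrow : ∀ i, (row (rescale h a ℓ e) i).eval t = h ^ (i : ℕ) * (row e i).eval ξ := by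
      intro i
      rw [row_rescale]; simp [hξt]
    have hrow1 : ∀ i, (row (rescale h a ℓ e) i).derivative.eval t
        = h ^ (i : ℕ) * ℓ * (row e i).derivative.eval ξ := by
      intro i
      rw [row_rescale, derivative_comp_affine]; simp [hξt]
    have hrow2 : ∀ i, (row (rescale h a ℓ e) i).derivative.derivative.eval t
        = h ^ (i : ℕ) * ℓ * ℓ * (row e i).derivative.derivative.eval ξ := by
      intro i
      rw [row_rescale, derivative_comp_affine, derivative_comp_affine]
      simp [hξt]
    have t1 : |α j i ξ * (row e i).derivative.derivative.eval ξ| * h ^ (j + 2)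
        ≤ |Mα i| * (r ^ 2 * W * D) * V := by
      by_cases hij : j < (i : ℕ)
      · rw [(hαγ j i ξ hξp hij).1]; simp; positivity
      · have hle := abs_row_derivative_derivative_eval_le hV ht1
          fun l hl => hVe i l (by omega) hl
        rw [hrow2, abs_mul, abs_of_pos (by positivity)] at hle
        have hp : h ^ (j + 2) = h ^ (j - (i : ℕ)) * (h / ℓ) ^ 2 * (h ^ (i : ℕ) * ℓ * ℓ) := by
          field_simp
          rw [← pow_add, ← pow_add]; congr 1; omega
        calc |α j i ξ * (row e i).derivative.derivative.eval ξ| * h ^ (j + 2)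
            = |α j i ξ| * ((h / ℓ) ^ 2 * h ^ (j - (i : ℕ)) *
              (h ^ (i : ℕ) * ℓ * ℓ * |(row e i).derivative.derivative.eval ξ|)) := by
              rw [hp, abs_mul]; ring
          _ ≤ |Mα i| * (r ^ 2 * W * (D * V)) := by
              have h1 : |α j i ξ| ≤ |Mα i| := (hMα i ξ hξp).trans (le_abs_self _)
              have h2 := hhW (j - (i : ℕ)) (by omega)
              have h3 := abs_nonneg (α j i ξ)
              rw [← hD] at hle
              generalize |α j i ξ| = x at h1 h3 ⊢
              gcongr
          _ = _ := by ring
    have t2 : |γ j i ξ * (row e i).derivative.eval ξ| * h ^ (j + 2)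
        ≤ |Mγ i| * (r * W * D) * V := by
      by_cases hij : j < (i : ℕ)
      · rw [(hαγ j i ξ hξp hij).2]; simp; positivity
      · have hle := abs_row_derivative_eval_le hV ht1
          fun l hl => hVe i l (by omega) hl
        rw [hrow1, abs_mul, abs_of_pos (by positivity)] at hle
        have hp : h ^ (j + 2) = h ^ (j + 1 - (i : ℕ)) * (h / ℓ) * (h ^ (i : ℕ) * ℓ) := by
          field_simp
          rw [← pow_succ, ← pow_add]; congr 1; omega
        calc |γ j i ξ * (row e i).derivative.eval ξ| * h ^ (j + 2)
            = |γ j i ξ| * ((h / ℓ) * h ^ (j + 1 - (i : ℕ)) *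
              (h ^ (i : ℕ) * ℓ * |(row e i).derivative.eval ξ|)) := by
              rw [hp, abs_mul]; ring
          _ ≤ |Mγ i| * (r * W * (D * V)) := by
              have h1 : |γ j i ξ| ≤ |Mγ i| := (hMγ i ξ hξp).trans (le_abs_self _)
              have h2 := hhW (j + 1 - (i : ℕ)) (by omega)
              have h3 := abs_nonneg (γ j i ξ)
              rw [← hD] at hle
              generalize |γ j i ξ| = x at h1 h3 ⊢
              gcongr
          _ = _ := by ring
    have t3 : |ρ j i ξ * ((i : ℕ) * (row e i).eval ξ)| * h ^ (j + 2)
        ≤ |Mρ i| * (W * D) * V := by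
      by_cases hij : j + 1 < (i : ℕ)
      · rw [hρ j i ξ hξp hij]; simp; positivity
      · have hle := abs_mul_row_eval_le hV ht1
          fun l hl => hVe i l (by omega) hl
        rw [hrow, ← mul_assoc, mul_comm ((i : ℕ) : ℝ), mul_assoc, abs_mul,
          abs_of_pos (by positivity)] at hle
        have hp : h ^ (j + 2) = h ^ (j + 2 - (i : ℕ)) * h ^ (i : ℕ) := by
          rw [← pow_add]; congr 1; omega
        calc |ρ j i ξ * ((i : ℕ) * (row e i).eval ξ)| * h ^ (j + 2)
            = |ρ j i ξ| * (h ^ (j + 2 - (i : ℕ)) *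
              (h ^ (i : ℕ) * |(i : ℕ) * (row e i).eval ξ|)) := by
              rw [hp, abs_mul]; ring
          _ ≤ |Mρ i| * (W * (D * V)) := by
              have h1 : |ρ j i ξ| ≤ |Mρ i| := (hMρ i ξ hξp).trans (le_abs_self _)
              have h2 := hhW (j + 2 - (i : ℕ)) (by omega)
              have h3 := abs_nonneg (ρ j i ξ)
              rw [← hD] at hle
              generalize |ρ j i ξ| = x at h1 h3 ⊢
              gcongr
          _ = _ := by ring
    calc _ ≤ (|α j i ξ * (row e i).derivative.derivative.eval ξ|
          + |γ j i ξ * (row e i).derivative.eval ξ|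
          + |ρ j i ξ * ((i : ℕ) * (row e i).eval ξ)|) * h ^ (j + 2) := by
          gcongr
          exact (abs_add_le _ _).trans (by gcongr; exact abs_add_le _ _)
      _ ≤ _ := by rw [add_mul, add_mul, add_mul, add_mul]; linarith
  -- The row to be bounded has degree at most `m` and is itself an admissible test polynomial.
  have horth : ∫ ξ in a..b, (((j + 2).factorial : ℝ) * (row e i₀).eval ξ + F ξ)
      * (row e i₀).eval ξ = 0 := by
    rw [← hq (row e i₀) (row_natDegree_le _ _)]
    refine intervalIntegral.integral_congr fun ξ hξ => ?_
    rw [uIcc_of_le hab.le] at hξ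
    simp only [lapDeriv]
    rw [H e j hj ξ (hI hξ)]
  have hE := sq_integral_le_of_orthogonal hab.le
    (by exact_mod_cast Nat.one_le_iff_ne_zero.2 (Nat.factorial_ne_zero _))
    (Polynomial.continuous (row e i₀)).continuousOn hFc hFb horth
  have hcoef := hK' (row (rescale h a ℓ e) i₀) (row_natDegree_le _ _) l
  rw [row_coeff] at hcoef
  have hint : ∫ t in (0:ℝ)..1, (row (rescale h a ℓ e) i₀).eval t ^ 2
      = h ^ (2 * (j + 2)) * (ℓ⁻¹ * ∫ ξ in a..b, (row e i₀).eval ξ ^ 2) := by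
    rw [← integral_comp_affine hab fun ξ => (row e i₀).eval ξ ^ 2,
      ← intervalIntegral.integral_const_mul]
    congr 1; ext t
    rw [row_rescale]
    simp only [Polynomial.eval_mul, Polynomial.eval_C, Polynomial.eval_comp, Polynomial.eval_add,
      Polynomial.eval_X, hi₀, hℓ]
    ring
  have hsq : rescale h a ℓ e i₀ l ^ 2 ≤ K * (A * V) ^ 2 := by
    refine hcoef.trans ?_
    rw [hint]
    gcongr
    -- The weight of row `j + 2` cancels the power of `h` in the bound for `F` exactly.
    calc h ^ (2 * (j + 2)) * (ℓ⁻¹ * ∫ ξ in a..b, (row e i₀).eval ξ ^ 2)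
        ≤ h ^ (2 * (j + 2)) * (ℓ⁻¹ * ((A * V / h ^ (j + 2)) ^ 2 * ℓ)) := by gcongr
      _ = (A * V) ^ 2 := by
          rw [div_pow, ← pow_mul, mul_comm (j + 2) 2]
          field_simp
  calc |rescale h a ℓ e i₀ l| ≤ √(K * (A * V) ^ 2) := Real.abs_le_sqrt hsq
    _ = √K * (A * V) := by
        rw [Real.sqrt_mul hK.le, Real.sqrt_sq (by positivity)]
    _ ≤ (√K * A + 1) * V := by nlinarith

end

end

/-! ### The interface conditions row by row -/

section

theorem poly_eq_zero_of_integral_sq {a b : ℝ} (hab : a < b) {p : Polynomial ℝ}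
    (h : ∫ ξ in a..b, p.eval ξ * p.eval ξ = 0) : p = 0 := by
  have hz : ∀ t ∈ Ioo a b, p.eval t * p.eval t = 0 := by
    by_contra! hne
    obtain ⟨t, ht, hne⟩ := hne
    refine (intervalIntegral.integral_pos hab (p.continuous.mul p.continuous).continuousOn
      (fun t _ => mul_self_nonneg _) ⟨t, Ioo_subset_Icc_self ht, ?_⟩).ne' h
    exact lt_of_le_of_ne (mul_self_nonneg _) hne.symm
  refine Polynomial.eq_zero_of_infinite_isRoot _ ((Ioo_infinite hab).mono fun t ht => ?_)
  exact mul_self_eq_zero.1 (hz t ht)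

theorem qEval_zero_left {m : ℕ} (c : Coef m) (ξ : ℝ) : qEval m c 0 ξ = (row c 0).eval ξ := by
  rw [qEval_eq_sum_row, Finset.sum_eq_single 0]
  · simp
  · intro i _ hi
    have : (i : ℕ) ≠ 0 := fun h => hi (Fin.ext h)
    simp [this]
  · simp

theorem deriv_qEval_zero_left {m : ℕ} (hm : 1 ≤ m) (c : Coef m) (ξ : ℝ) :
    deriv (fun η => qEval m c η ξ) 0 = (row c ⟨1, by omega⟩).eval ξ := by
  simp only [qEval_eq_sum_row]
  have := (HasDerivAt.fun_sum (u := Finset.univ) fun (i : Fin (m + 1)) _ =>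
    (hasDerivAt_pow (i : ℕ) (0 : ℝ)).mul_const ((row c i).eval ξ)).deriv
  rw [this, Finset.sum_eq_single ⟨1, by omega⟩]
  · simp
  · intro i _ hi
    have h1 : (i : ℕ) ≠ 1 := fun h => hi (Fin.ext h)
    rcases Nat.eq_zero_or_pos (i : ℕ) with h0 | h0
    · simp [h0]
    · have : (i : ℕ) - 1 ≠ 0 := by omega
      simp [this]
  · simp

namespace JumpConditions

variable {Q : Rect} {S : Interface Q} {m : ℕ} {βm βp a b : ℝ} {cm cp : Coef m}

/-- The jump of the values is a polynomial of degree at most `m`; tested against itself it has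
vanishing `L²` norm. -/
theorem row_zero_eq {g : ℝ → Pt} (hab : a < b) (H : JumpConditions g m βm βp a b cm cp) :
    row cm 0 = row cp 0 := by
  have h := H.value (row cp 0 - row cm 0)
    ((Polynomial.natDegree_sub_le _ _).trans (max_le (row_natDegree_le _ _) (row_natDegree_le _ _)))
  simp only [qEval_zero_left, ← Polynomial.eval_sub] at h
  exact (sub_eq_zero.1 (poly_eq_zero_of_integral_sq hab h)).symm

theorem row_one_eq {g : ℝ → Pt} (hm : 1 ≤ m) (hab : a < b)
    (H : JumpConditions g m βm βp a b cm cp) : row (βp • cp + -βm • cm) ⟨1, by omega⟩ = 0 := by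
  have h := H.flux (row (βp • cp + -βm • cm) ⟨1, by omega⟩) (row_natDegree_le _ _)
  simp only [deriv_qEval_zero_left hm] at h
  refine poly_eq_zero_of_integral_sq hab ?_
  rw [← h]
  congr 1; ext ξ
  congr 1
  rw [row_add, row_smul, row_smul]
  simp
  ring

theorem integral_lapDeriv (h3 : 3 ≤ m → ContDiff ℝ 3 S.g) (hab : a < b) (hI : Icc a b ⊆ S.params)
    (H : JumpConditions S.g m βm βp a b cm cp) {j : ℕ} (hj : j + 2 ≤ m) {q : Polynomial ℝ}
    (hq : q.natDegree ≤ m) :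
    ∫ ξ in a..b, lapDeriv S.g j (βp • cp + -βm • cm) ξ * q.eval ξ = 0 := by
  rw [← H.laplacian j hj q hq]
  refine intervalIntegral.integral_congr fun ξ hξ => ?_
  rw [uIcc_of_le hab.le] at hξ
  simp only [S.lapDeriv_linear h3 hj _ _ _ _ (hI hξ)]
  simp only [lapDeriv]
  ring

end JumpConditions

variable {Q : Rect} (S : Interface Q)

/-- Recursion on the number `n` of rows already bounded: row zero is bounded by assumption, row one
vanishes, and the condition of order `j` on the Laplacian yields row `j + 2`. The constant
coefficient can be left out, since every term of the recursion differentiates row zero or multiplies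
it by `i = 0`. -/
theorem Interface.exists_rows_bound (m : ℕ) (h3 : 3 ≤ m → ContDiff ℝ 3 S.g) {r : ℝ} (hr : 0 < r)
    (n : ℕ) : ∃ C : ℝ, 1 ≤ C ∧ ∀ (h a b : ℝ) (e : Coef m) (V : ℝ), 0 < h → h ≤ S.δ → a < b →
      Icc a b ⊆ S.params → h ≤ r * (b - a) → 0 ≤ V →
      (∀ l : Fin (m + 1), (l : ℕ) ≠ 0 → |rescale h a (b - a) e 0 l| ≤ V) →
      (∀ i l : Fin (m + 1), (i : ℕ) = 1 → rescale h a (b - a) e i l = 0) →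
      (∀ j, j + 2 ≤ m → ∀ q : Polynomial ℝ, q.natDegree ≤ m →
        ∫ ξ in a..b, lapDeriv S.g j e ξ * q.eval ξ = 0) →
      ∀ i l : Fin (m + 1), (i : ℕ) < n → ¬ ((i : ℕ) = 0 ∧ (l : ℕ) = 0) →
        |rescale h a (b - a) e i l| ≤ C * V := by
  induction n with
  | zero => exact ⟨1, le_rfl, fun _ _ _ _ _ _ _ _ _ _ _ _ _ _ i l h => absurd h (by omega)⟩
  | succ n ih =>
    obtain ⟨C, hC, H⟩ := ih
    rcases n with _ | _ | j
    · refine ⟨1, le_rfl, fun h a b e V _ _ _ _ _ _ h0 _ _ i l hi hil => ?_⟩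
      obtain rfl : i = 0 := Fin.ext (by simpa using hi)
      rw [one_mul]
      exact h0 l fun hl => hil ⟨rfl, hl⟩
    · refine ⟨C, hC, fun h a b e V hh hhδ hab hI hhr hV h0 h1 hq i l hi hil => ?_⟩
      rcases Nat.lt_succ_iff_lt_or_eq.1 hi with hi | hi
      · exact H h a b e V hh hhδ hab hI hhr hV h0 h1 hq i l hi hil
      · rw [h1 i l hi, abs_zero]; positivity
    · by_cases hj : j + 2 ≤ m
      · obtain ⟨D, hD, H'⟩ := S.exists_row_bound m h3 hr hj
        refine ⟨max C (D * C), hC.trans (le_max_left _ _),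
          fun h a b e V hh hhδ hab hI hhr hV h0 h1 hq i l hi hil => ?_⟩
        have hb := H h a b e V hh hhδ hab hI hhr hV h0 h1 hq
        rcases Nat.lt_succ_iff_lt_or_eq.1 hi with hi | hi
        · exact (hb i l hi hil).trans (by gcongr; exact le_max_left _ _)
        · obtain rfl : i = ⟨j + 2, Nat.lt_succ_of_le hj⟩ := Fin.ext hi
          refine (H' h a b e (C * V) hh hhδ hab hI hhr (by positivity)
            (fun i l hi hil => hb i l (by omega) hil) (hq j hj) l).trans ?_
          rw [← mul_assoc]
          gcongr
          exact le_max_right _ _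
      · refine ⟨C, hC, fun h a b e V hh hhδ hab hI hhr hV h0 h1 hq i l hi hil => ?_⟩
        have := i.2
        exact H h a b e V hh hhδ hab hI hhr hV h0 h1 hq i l (by omega) hil

/-- The interface conditions bound the fluxes on either side by the gradient on the other side. -/
theorem Interface.exists_transfer {m : ℕ} (hm : 1 ≤ m) (h3 : 3 ≤ m → ContDiff ℝ 3 S.g) {r : ℝ}
    (hr : 0 < r) : ∃ C : ℝ, 0 < C ∧ ∀ (h a b βm βp : ℝ) (cm cp : Coef m), 0 < h → h ≤ S.δ → a < b →
      Icc a b ⊆ S.params → h ≤ r * (b - a) → 0 < βm → βm ≤ βp →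
      JumpConditions S.g m βm βp a b cm cp →
      βp * seminorm (rescale h a (b - a) cp) ≤ C * βp * seminorm (rescale h a (b - a) cm) ∧
      βm * seminorm (rescale h a (b - a) cm) ≤ C * βp * seminorm (rescale h a (b - a) cp) := by
  obtain ⟨C, hC, H⟩ := S.exists_rows_bound m h3 hr (m + 1)
  refine ⟨(m + 1) ^ 2 * C + 1, by positivity,
    fun h a b βm βp cm cp hh hhδ hab hI hhr hβm hβ J => ?_⟩
  -- The flux and Laplacian conditions concern only this weighted difference, so the ratio of the
  -- two coefficients plays no role in the recursion.
  set e : Coef m := βp • cp + -βm • cm with he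
  set ec := rescale h a (b - a) e with hec
  set ecm := rescale h a (b - a) cm with hecm
  set ecp := rescale h a (b - a) cp with hecp
  have hlin : ec = βp • ecp + -βm • ecm := rescale_linear _ _ _ _ _ _ _
  have hrow0 : ∀ l, ecm 0 l = ecp 0 l := by
    intro l
    simp only [hecm, hecp, rescale, J.row_zero_eq hab]
  have hrow1 : ∀ i l : Fin (m + 1), (i : ℕ) = 1 → ec i l = 0 := by
    intro i l hi
    rw [show i = ⟨1, by omega⟩ from Fin.ext hi]
    have := J.row_one_eq hm hab
    simp only [hec, rescale, he, this, Polynomial.zero_comp, Polynomial.coeff_zero, mul_zero]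
  have hq : ∀ j, j + 2 ≤ m → ∀ q : Polynomial ℝ, q.natDegree ≤ m →
        ∫ ξ in a..b, lapDeriv S.g j e ξ * q.eval ξ = 0 :=
    fun j hj q hq => J.integral_lapDeriv h3 hab hI hj hq
  have key : ∀ V, 0 ≤ V → (∀ l : Fin (m + 1), (l : ℕ) ≠ 0 → |ec 0 l| ≤ V) →
      seminorm ec ≤ (m + 1) ^ 2 * C * V := by
    intro V hV hl
    have hb := H h a b e V hh hhδ hab hI hhr hV hl hrow1 hq
    have : seminorm ec ≤ ∑ _i : Fin (m + 1), ∑ _j : Fin (m + 1), C * V := by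
      refine Finset.sum_le_sum fun i _ => Finset.sum_le_sum fun j _ => ?_
      split_ifs with hij
      · positivity
      · exact hb i j i.2 hij
    refine this.trans_eq ?_
    simp
    ring
  have hβp : 0 < βp := hβm.trans_le hβ
  -- Row zero is common to both sides, hence in the difference it is multiplied by a number between
  -- `0` and `βp`. It may be estimated by whichever side is wanted, which gives both inequalities.
  have hdiff : ∀ l, ec 0 l = (βp - βm) * ecm 0 l := by
    intro l
    rw [hlin]
    simp only [Pi.add_apply, Pi.smul_apply, smul_eq_mul, ← hrow0]
    ring
  constructor
  · have h1 := key (βp * seminorm ecm) (mul_nonneg hβp.le (seminorm_nonneg _)) fun l hl => by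
      rw [hdiff, abs_mul, abs_of_nonneg (sub_nonneg.2 hβ)]
      gcongr
      · linarith
      · exact abs_le_seminorm _ _ _ fun h => hl h.2
    have h2 : βp • ecp = ec + βm • ecm := by rw [hlin]; module
    have h4 := seminorm_smul βp ecp
    rw [abs_of_pos hβp, h2] at h4
    have h5 := seminorm_add_le ec (βm • ecm)
    rw [seminorm_smul, abs_of_pos hβm] at h5
    have h6 : βm * seminorm ecm ≤ βp * seminorm ecm :=
      mul_le_mul_of_nonneg_right hβ (seminorm_nonneg _)
    calc _ = _ := h4.symm
      _ ≤ _ := h5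
      _ ≤ (m + 1) ^ 2 * C * (βp * seminorm ecm) + βp * seminorm ecm := by gcongr
      _ = _ := by ring
  · have h1 := key (βp * seminorm ecp) (mul_nonneg hβp.le (seminorm_nonneg _)) fun l hl => by
      rw [hdiff, hrow0, abs_mul, abs_of_nonneg (sub_nonneg.2 hβ)]
      gcongr
      · linarith
      · exact abs_le_seminorm _ _ _ fun h => hl h.2
    have h2 : βm • ecm = (-1 : ℝ) • ec + βp • ecp := by rw [hlin]; module
    have h4 := seminorm_smul βm ecm
    rw [abs_of_pos hβm, h2] at h4
    have h5 := seminorm_add_le ((-1 : ℝ) • ec) (βp • ecp)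
    rw [seminorm_smul, seminorm_smul, abs_of_pos hβp, abs_neg, abs_one, one_mul] at h5
    calc _ = _ := h4.symm
      _ ≤ _ := h5
      _ ≤ (m + 1) ^ 2 * C * (βp * seminorm ecp) + βp * seminorm ecp := by gcongr
      _ = _ := by ring

end

section

/-! ### Elements and edges of a Cartesian mesh -/

namespace Mesh

variable {Q : Rect} (T : Mesh Q) (K : T.Elt)

/-- Width of an element. -/
def wx : ℝ := T.x K.1.succ - T.x K.1.castSucc

/-- Height of an element. -/
def wy : ℝ := T.y K.2.succ - T.y K.2.castSucc

theorem wx_pos : 0 < T.wx K := sub_pos.2 (T.x_mono Fin.castSucc_lt_succ)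

theorem wy_pos : 0 < T.wy K := sub_pos.2 (T.y_mono Fin.castSucc_lt_succ)

theorem cell_eq_preimage : T.cell K = EuclideanSpace.equiv (Fin 2) ℝ ⁻¹'
    Icc ![T.x K.1.castSucc, T.y K.2.castSucc] ![T.x K.1.succ, T.y K.2.succ] := by
  ext p
  simp only [cell, mem_ofPred_eq, mem_preimage, mem_Icc, Pi.le_def, Fin.forall_fin_two,
    Matrix.cons_val_zero, Matrix.cons_val_one, PiLp.coe_continuousLinearEquiv]
  tauto

theorem isCompact_cell : IsCompact (T.cell K) := by
  rw [cell_eq_preimage]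
  exact (EuclideanSpace.equiv (Fin 2) ℝ).toHomeomorph.isCompact_preimage.2 isCompact_Icc

theorem isClosed_cell : IsClosed (T.cell K) := (T.isCompact_cell K).isClosed

theorem convex_cell : Convex ℝ (T.cell K) := by
  rw [cell_eq_preimage]
  exact (convex_Icc _ _).linear_preimage (EuclideanSpace.equiv (Fin 2) ℝ).toLinearMap

theorem interior_cell : interior (T.cell K) = {p | p 0 ∈ Ioo (T.x K.1.castSucc) (T.x K.1.succ) ∧
    p 1 ∈ Ioo (T.y K.2.castSucc) (T.y K.2.succ)} := by
  rw [cell_eq_preimage]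
  have := (EuclideanSpace.equiv (Fin 2) ℝ).toHomeomorph.preimage_interior
    (Icc ![T.x K.1.castSucc, T.y K.2.castSucc] ![T.x K.1.succ, T.y K.2.succ])
  rw [← pi_univ_Icc, interior_pi_set finite_univ] at this
  rw [← pi_univ_Icc]
  refine Eq.trans this.symm ?_
  ext p
  simp [Fin.forall_fin_two]

theorem interior_nonempty : (interior (T.cell K)).Nonempty := by
  have h1 := T.wx_pos K
  have h2 := T.wy_pos K
  unfold wx at h1
  unfold wy at h2
  refine ⟨!₂[(T.x K.1.castSucc + T.x K.1.succ) / 2, (T.y K.2.castSucc + T.y K.2.succ) / 2], ?_⟩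
  rw [interior_cell]
  simp only [mem_ofPred_eq, mem_Ioo, Matrix.cons_val_zero, Matrix.cons_val_one]
  exact ⟨⟨by linarith, by linarith⟩, by linarith, by linarith⟩

theorem closure_interior_cell : closure (interior (T.cell K)) = T.cell K := by
  rw [(T.convex_cell K).closure_interior_eq_closure_of_nonempty_interior (T.interior_nonempty K),
    (T.isClosed_cell K).closure_eq]

theorem uniqueDiffOn_cell : UniqueDiffOn ℝ (T.cell K) :=
  uniqueDiffOn_convex (T.convex_cell K) (T.interior_nonempty K)

theorem volume_cell : volume (T.cell K) = ENNReal.ofReal (T.wx K * T.wy K) := by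
  rw [cell_eq_preimage]
  have := (PiLp.volume_preserving_ofLp (Fin 2)).measure_preimage
    (s := Icc ![T.x K.1.castSucc, T.y K.2.castSucc] ![T.x K.1.succ, T.y K.2.succ])
    measurableSet_Icc.nullMeasurableSet
  refine Eq.trans this ?_
  rw [Real.volume_Icc_pi, Fin.prod_univ_two, ENNReal.ofReal_mul (T.wx_pos K).le]
  rfl

theorem volume_cell_ne_top : volume (T.cell K) ≠ ⊤ := (T.isCompact_cell K).measure_lt_top.ne

theorem cell_ae_eq_interior : T.cell K =ᵐ[volume] interior (T.cell K) := by
  have h := (T.convex_cell K).addHaar_frontier volume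
  exact (interior_ae_eq_of_null_frontier h).symm

theorem volume_interior_cell : volume (interior (T.cell K)) = ENNReal.ofReal (T.wx K * T.wy K) := by
  rw [← T.volume_cell K, measure_congr (T.cell_ae_eq_interior K)]

theorem dist_le_h {p q : Pt} (hp : p ∈ T.cell K) (hq : q ∈ T.cell K) : dist p q ≤ T.h :=
  (Metric.dist_le_diam_of_mem (T.isCompact_cell K).isBounded hp hq).trans
    (le_ciSup (f := fun K : T.Elt => Metric.diam (T.cell K)) (finite_range _).bddAbove K)

theorem vertex_mem (i : Fin 4) : T.vertex K i ∈ T.cell K := by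
  have h1 := T.wx_pos K
  have h2 := T.wy_pos K
  unfold wx at h1
  unfold wy at h2
  fin_cases i <;>
    simp only [vertex, cell, mem_ofPred_eq, mem_Icc, Matrix.cons_val_zero,
      Matrix.cons_val_one, Fin.zero_eta, Fin.mk_one, Fin.reduceFinMk, Matrix.cons_val] <;>
    refine ⟨⟨?_, ?_⟩, ?_, ?_⟩ <;> linarith

theorem wx_le_h : T.wx K ≤ T.h := by
  have h := T.dist_le_h K (T.vertex_mem K 1) (T.vertex_mem K 0)
  refine le_trans ?_ h
  have h1 := PiLp.norm_apply_le (p := 2) (T.vertex K 1 - T.vertex K 0) 0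
  rw [dist_eq_norm]
  refine le_trans ?_ h1
  simp [vertex, wx, le_abs_self]

theorem wy_le_h : T.wy K ≤ T.h := by
  have h := T.dist_le_h K (T.vertex_mem K 3) (T.vertex_mem K 0)
  refine le_trans ?_ h
  have h1 := PiLp.norm_apply_le (p := 2) (T.vertex K 3 - T.vertex K 0) 1
  rw [dist_eq_norm]
  refine le_trans ?_ h1
  simp [vertex, wy, le_abs_self]

theorem h_pos : 0 < T.h := (T.wx_pos (0, 0)).trans_le (T.wx_le_h (0, 0))

theorem x_ge (i : Fin (T.nx + 2)) : Q.x₀ ≤ T.x i := T.x_first ▸ T.x_mono.monotone (Fin.zero_le i)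
theorem x_le (i : Fin (T.nx + 2)) : T.x i ≤ Q.x₁ := T.x_last ▸ T.x_mono.monotone (Fin.le_last i)
theorem y_ge (i : Fin (T.ny + 2)) : Q.y₀ ≤ T.y i := T.y_first ▸ T.y_mono.monotone (Fin.zero_le i)
theorem y_le (i : Fin (T.ny + 2)) : T.y i ≤ Q.y₁ := T.y_last ▸ T.y_mono.monotone (Fin.le_last i)

theorem interior_cell_subset_dom : interior (T.cell K) ⊆ Q.dom := by
  rw [interior_cell]
  rintro p ⟨⟨h1, h2⟩, h3, h4⟩
  exact ⟨⟨(T.x_ge _).trans_lt h1, h2.trans_le (T.x_le _)⟩,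
    (T.y_ge _).trans_lt h3, h4.trans_le (T.y_le _)⟩

namespace Edge

variable {T} (B : T.Edge)

theorem lo_lt_hi : B.lo < B.hi := by
  rcases B with e | e
  · exact T.y_mono Fin.castSucc_lt_succ
  · exact T.x_mono Fin.castSucc_lt_succ

theorem length_pos : 0 < B.length := sub_pos.2 B.lo_lt_hi

theorem length_le_h : B.length ≤ T.h := by
  rcases B with e | e
  · exact T.wy_le_h (e.1.castSucc, e.2)
  · exact T.wx_le_h (e.1, e.2.castSucc)

theorem continuous_pt : Continuous B.pt := by
  rcases B with e | e
  · refine (PiLp.continuous_toLp 2 _).comp (continuous_pi fun i => ?_)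
    fin_cases i <;> simp <;> fun_prop
  · refine (PiLp.continuous_toLp 2 _).comp (continuous_pi fun i => ?_)
    fin_cases i <;> simp <;> fun_prop

theorem pt_injective : Function.Injective B.pt := by
  intro s t h
  rcases B with e | e
  · simpa [pt] using congrArg (fun p : Pt => p 1) h
  · simpa [pt] using congrArg (fun p : Pt => p 0) h

theorem pt_mem_fst {t : ℝ} (ht : t ∈ Icc B.lo B.hi) : B.pt t ∈ T.cell B.fst := by
  rcases B with e | e
  · refine ⟨⟨?_, ?_⟩, ht⟩
    · exact (T.x_mono Fin.castSucc_lt_succ).le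
    · exact le_rfl
  · refine ⟨ht, ⟨?_, ?_⟩⟩
    · exact (T.y_mono Fin.castSucc_lt_succ).le
    · exact le_rfl

theorem pt_mem_snd {t : ℝ} (ht : t ∈ Icc B.lo B.hi) : B.pt t ∈ T.cell B.snd := by
  rcases B with e | e
  · refine ⟨⟨?_, ?_⟩, ht⟩
    · exact (congrArg T.x (Fin.succ_castSucc e.1)).ge
    · refine (T.x_mono.monotone ?_)
      rw [Fin.le_def]; simp [snd]
  · refine ⟨ht, ⟨?_, ?_⟩⟩
    · exact (congrArg T.y (Fin.succ_castSucc e.2)).ge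
    · refine (T.y_mono.monotone ?_)
      rw [Fin.le_def]; simp [snd]

theorem pt_notMem_interior_fst (t : ℝ) : B.pt t ∉ interior (T.cell B.fst) := by
  rw [interior_cell]
  rcases B with e | e
  · rintro ⟨⟨-, h⟩, -⟩
    exact lt_irrefl _ h
  · rintro ⟨-, -, h⟩
    exact lt_irrefl _ h

theorem pt_notMem_interior_snd (t : ℝ) : B.pt t ∉ interior (T.cell B.snd) := by
  rw [interior_cell]
  rcases B with e | e
  · rintro ⟨⟨h, -⟩, -⟩
    exact lt_irrefl _ ((congrArg T.x (Fin.succ_castSucc e.1)).trans_lt h)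
  · rintro ⟨-, h, -⟩
    exact lt_irrefl _ ((congrArg T.y (Fin.succ_castSucc e.2)).trans_lt h)

theorem norm_normal : ‖B.normal‖ = 1 := by
  rcases B with e | e <;> simp [normal, EuclideanSpace.norm_eq]

theorem carrier_inter {S : Interface Q} (hT : T.Admissible S) :
    (S.Γ ∩ B.carrier).Subsingleton ∨ B.carrier ⊆ S.Γ := by
  rcases B with e | e
  · have : Edge.carrier (T := T) (Sum.inl e) ⊆ T.vEdge e.1.castSucc.succ e.2 := by
      rintro p ⟨t, ht, rfl⟩
      exact ⟨rfl, ht⟩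
    rcases hT.vEdge e.1.castSucc.succ e.2 with h | h
    · exact Or.inl (h.anti (inter_subset_inter_right _ this))
    · exact Or.inr (this.trans h)
  · have : Edge.carrier (T := T) (Sum.inr e) ⊆ T.hEdge e.1 e.2.castSucc.succ := by
      rintro p ⟨t, ht, rfl⟩
      exact ⟨ht, rfl⟩
    rcases hT.hEdge e.1 e.2.castSucc.succ with h | h
    · exact Or.inl (h.anti (inter_subset_inter_right _ this))
    · exact Or.inr (this.trans h)

end Edge

end Mesh

end

section

/-! ### Fictitious elements -/

/-- Frenet coordinates with values in `[-h, h] × [a, b]`. -/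
def frenetInv (g : ℝ → Pt) (h a b : ℝ) : Pt → ℝ × ℝ :=
  Function.invFunOn (frenet g) (Icc (-h) h ×ˢ Icc a b)

namespace Mesh.IsFictitiousInterval

variable {Q : Rect} {S : Interface Q} {T : Mesh Q} {K : T.Elt} {a b : ℝ}

theorem inv_mem (F : T.IsFictitiousInterval S K a b) {p : Pt} (hp : p ∈ T.cell K) :
    frenetInv S.g T.h a b p ∈ Icc (-T.h) T.h ×ˢ Icc a b :=
  Function.invFunOn_mem (F.2.2.2 hp)

theorem frenet_inv (F : T.IsFictitiousInterval S K a b) {p : Pt} (hp : p ∈ T.cell K) :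
    frenet S.g (frenetInv S.g T.h a b p) = p :=
  Function.invFunOn_eq (F.2.2.2 hp)

theorem inv_frenet (F : T.IsFictitiousInterval S K a b) {z : ℝ × ℝ}
    (hz : z ∈ Icc (-T.h) T.h ×ˢ Icc a b) : frenetInv S.g T.h a b (frenet S.g z) = z :=
  F.2.2.1.leftInvOn_invFunOn hz

theorem le (F : T.IsFictitiousInterval S K a b) : a ≤ b := by
  obtain ⟨-, ⟨ξ, -, ha, hb⟩, -⟩ := F
  exact ha.2 hb.1

theorem subset_strip (F : T.IsFictitiousInterval S K a b) (hδ : T.h ≤ S.δ) :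
    Icc (-T.h) T.h ×ˢ Icc a b ⊆ S.strip := by
  rintro ⟨η, ξ⟩ ⟨hη, hξ⟩
  exact ⟨⟨by linarith [hη.1], hη.2.trans hδ⟩, F.1 hξ⟩

/-- A continuous injection of a compact box maps closed sets to closed sets, so its inverse is
continuous. -/
theorem continuousOn_inv (F : T.IsFictitiousInterval S K a b) (hδ : T.h ≤ S.δ) :
    ContinuousOn (frenetInv S.g T.h a b) (T.cell K) := by
  have hR : IsCompact (Icc (-T.h) T.h ×ˢ Icc a b : Set (ℝ × ℝ)) :=
    isCompact_Icc.prod isCompact_Icc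
  have hc := S.frenet_continuousOn.mono (F.subset_strip hδ)
  refine ContinuousOn.mono ?_ F.2.2.2
  rw [continuousOn_iff_isClosed]
  intro t ht
  refine ⟨frenet S.g '' (Icc (-T.h) T.h ×ˢ Icc a b ∩ t),
    ((hR.inter_right ht).image_of_continuousOn (hc.mono inter_subset_left)).isClosed, ?_⟩
  ext p
  constructor
  · rintro ⟨hp, z, hz, rfl⟩
    rw [mem_preimage, F.inv_frenet hz] at hp
    exact ⟨⟨z, ⟨hz, hp⟩, rfl⟩, z, hz, rfl⟩
  · rintro ⟨⟨z, ⟨hz, hzt⟩, rfl⟩, -⟩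
    exact ⟨by rw [mem_preimage, F.inv_frenet hz]; exact hzt, z, hz, rfl⟩

theorem mem_params (F : T.IsFictitiousInterval S K a b) {p : Pt} (hp : p ∈ T.cell K) :
    (frenetInv S.g T.h a b p).2 ∈ S.params := F.1 (F.inv_mem hp).2

theorem inv_mem_strip (F : T.IsFictitiousInterval S K a b) (hδ : T.h ≤ S.δ) {p : Pt}
    (hp : p ∈ T.cell K) : frenetInv S.g T.h a b p ∈ S.strip := F.subset_strip hδ (F.inv_mem hp)

theorem mem_Γ_iff (F : T.IsFictitiousInterval S K a b) (hδ : T.h ≤ S.δ) {p : Pt}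
    (hp : p ∈ T.cell K) : p ∈ S.Γ ↔ (frenetInv S.g T.h a b p).1 = 0 := by
  constructor
  · intro h
    refine S.fst_eq_zero_of_mem (F.inv_mem_strip hδ hp).1 (F.mem_params hp) ?_
    rw [Prod.mk.eta, F.frenet_inv hp]
    exact h
  · intro h
    refine ⟨_, F.mem_params hp, ?_⟩
    have := F.frenet_inv hp
    rwa [frenet, h, zero_smul, add_zero] at this

/-- Points closest to a vertex of an interface element have distance at most `h`. -/
theorem foot_dist_le (hK : T.IsInterfaceElt S K) {i : Fin 4} {ξ : ℝ}
    (h : ‖T.vertex K i - S.g ξ‖ = Metric.infDist (T.vertex K i) S.Γ) :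
    ‖T.vertex K i - S.g ξ‖ ≤ T.h := by
  obtain ⟨q, hq, hqΓ⟩ := hK
  rw [h]
  exact (Metric.infDist_le_dist_of_mem hqΓ).trans
    (T.dist_le_h K (T.vertex_mem K i) (interior_subset hq))

/-- Otherwise `a` and `a + (ξe - ξs)` would be two parameters in the box with the same image,
against injectivity. -/
theorem length_lt_period (F : T.IsFictitiousInterval S K a b)
    (hper : Function.Periodic S.g (S.ξe - S.ξs)) : b - a < S.ξe - S.ξs := by
  by_contra! h
  have hL := sub_pos.2 S.lt
  have h0 : (0 : ℝ) ∈ Icc (-T.h) T.h := ⟨by linarith [T.h_pos], T.h_pos.le⟩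
  have := F.2.2.1 (x₁ := ((0 : ℝ), a)) (x₂ := ((0 : ℝ), a + (S.ξe - S.ξs)))
    ⟨h0, le_rfl, F.le⟩ ⟨h0, by simp only; linarith, by simp only; linarith⟩
    (S.frenet_periodic hper 0 a).symm
  have := congrArg Prod.snd this
  simp only at this
  linarith

/-- On a closed curve a closest point is a foot point. -/
theorem foot_inv (F : T.IsFictitiousInterval S K a b) (hK : T.IsInterfaceElt S K)
    (hu : S.params = univ) {i : Fin 4} {ξ : ℝ} (hξ : ξ ∈ Icc a b)
    (h : ‖T.vertex K i - S.g ξ‖ = Metric.infDist (T.vertex K i) S.Γ) :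
    (frenetInv S.g T.h a b (T.vertex K i)).2 = ξ := by
  set V := T.vertex K i
  have hξp : ξ ∈ S.params := F.1 hξ
  have hmin : ∀ ζ, ‖V - S.g ξ‖ ^ 2 ≤ ‖V - S.g ζ‖ ^ 2 := by
    intro ζ
    gcongr
    rw [h, ← dist_eq_norm]
    exact Metric.infDist_le_dist_of_mem ⟨ζ, hu ▸ mem_univ ζ, rfl⟩
  have hd : HasDerivAt (fun ζ => ‖V - S.g ζ‖ ^ 2) (2 * inner ℝ (V - S.g ξ) (-deriv S.g ξ)) ξ :=
    ((S.smooth.differentiable two_ne_zero ξ).hasDerivAt.const_sub V).norm_sq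
  -- The distance is minimal over the whole line, so the derivative vanishes and the vertex lies on
  -- the normal at `ξ`. For an arc the closest point could be an end point and this could fail.
  have h0 : 2 * inner ℝ (V - S.g ξ) (-deriv S.g ξ) = 0 :=
    IsLocalMin.hasDerivAt_eq_zero (Filter.Eventually.of_forall hmin) hd
  have h1 : inner ℝ (deriv S.g ξ) (V - S.g ξ) = 0 := by
    rw [inner_neg_right, real_inner_comm] at h0
    linarith
  have h2 := frame_expansion (S.regular ξ hξp) (V - S.g ξ)
  rw [h1, zero_div, zero_smul, add_zero] at h2
  set η := inner ℝ (normal S.g ξ) (V - S.g ξ)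
  have hη : |η| ≤ T.h := by
    have := abs_real_inner_le_norm (normal S.g ξ) (V - S.g ξ)
    rw [norm_normal (S.regular ξ hξp), one_mul] at this
    exact this.trans (foot_dist_le hK h)
  have h3 : frenet S.g (η, ξ) = V := by
    rw [frenet, h2]; simp
  rw [← h3, F.inv_frenet ⟨abs_le.1 hη, hξ⟩]

end Mesh.IsFictitiousInterval

open Mesh

/-- The parameter interval of a fictitious element is not long. -/
theorem Interface.exists_length_le {Q : Rect} (S : Interface Q) : ∃ C : ℝ, 0 < C ∧
    ∀ (T : Mesh Q) (K : T.Elt) (a b : ℝ), T.h ≤ S.δ → T.IsInterfaceElt S K →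
      T.IsFictitiousInterval S K a b → b - a ≤ C * T.h := by
  rcases S.tube with ⟨hu, hper, -⟩ | ⟨hI, -, hinj⟩
  · obtain ⟨c, r, hc, hr, hloc⟩ := S.exists_local_expansion
    have hL := sub_pos.2 S.lt
    refine ⟨3 / c + (S.ξe - S.ξs) * 3 / (c * r), by positivity, fun T K a b hδ hK F => ?_⟩
    have hh := T.h_pos
    obtain ⟨ξ, hξ, ⟨⟨i, hi⟩, ha⟩, ⟨⟨j, hj⟩, hb⟩⟩ := F.2.1
    -- On a closed curve `a` and `b` could be almost a period apart, where a small chord says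
    -- nothing about the parameters. Instead, the tangential coordinate is continuous on the
    -- connected element and takes the values `a` and `b`, hence all values between.
    have hpre : IsPreconnected
        ((fun p => (frenetInv S.g T.h a b p).2) '' T.cell K) :=
      (T.convex_cell K).isPreconnected.image _ (F.continuousOn_inv hδ).snd
    have hsub : Icc a b ⊆ (fun p => (frenetInv S.g T.h a b p).2) '' T.cell K := by
      refine hpre.Icc_subset ⟨T.vertex K i, T.vertex_mem K i, ?_⟩
        ⟨T.vertex K j, T.vertex_mem K j, ?_⟩
      · exact F.foot_inv hK hu ⟨le_rfl, F.le⟩ (hi ▸ (hξ i).2)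
      · exact F.foot_inv hK hu ⟨F.le, le_rfl⟩ (hj ▸ (hξ j).2)
    have hnear : ∀ x ∈ Icc a b, ∃ p ∈ T.cell K, ‖p - S.g x‖ ≤ T.h := by
      intro x hx
      obtain ⟨p, hp, rfl⟩ := hsub hx
      refine ⟨p, hp, ?_⟩
      have h1 := F.frenet_inv hp
      rw [frenet] at h1
      dsimp only
      rw [sub_eq_of_eq_add' h1.symm, norm_smul, norm_normal (S.regular _ (F.mem_params hp)), mul_one]
      exact abs_le.2 (F.inv_mem hp).1
    have h3 : ∀ x ∈ Icc a b, ‖S.g x - S.g a‖ ≤ 3 * T.h := by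
      intro x hx
      obtain ⟨p, hp, hpx⟩ := hnear x hx
      obtain ⟨q, hq, hqa⟩ := hnear a ⟨le_rfl, F.le⟩
      have h4 := T.dist_le_h K hp hq
      rw [dist_eq_norm] at h4
      have : S.g x - S.g a = -(p - S.g x) + (p - q) + (q - S.g a) := by abel
      rw [this]
      refine (norm_add₃_le).trans ?_
      rw [norm_neg]
      linarith
    rcases le_or_gt (b - a) r with hle | hlt
    · have h4 := hloc a (hu ▸ mem_univ _) b (hu ▸ mem_univ _)
        (by rw [abs_of_nonneg (sub_nonneg.2 F.le)]; exact hle)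
      rw [abs_of_nonneg (sub_nonneg.2 F.le)] at h4
      have h5 := h4.trans (h3 b ⟨F.le, le_rfl⟩)
      have h6 : b - a ≤ 3 / c * T.h := by
        rw [div_mul_eq_mul_div, le_div_iff₀ hc]; linarith
      have h7 : 0 ≤ (S.ξe - S.ξs) * 3 / (c * r) * T.h := by positivity
      rw [add_mul]
      linarith
    -- If the interval is longer than `r`, the intermediate parameter `a + r` shows `c r ≤ 3 h`.
    -- Thus `h` is bounded below, and the period, which bounds the length, is at most a multiple of
    -- `h`.
    · have h4 := hloc a (hu ▸ mem_univ _) (a + r) (hu ▸ mem_univ _) (by simp [abs_of_pos hr])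
      rw [add_sub_cancel_left, abs_of_pos hr] at h4
      have h5 := h4.trans (h3 (a + r) ⟨by linarith, by linarith⟩)
      have h6 := F.length_lt_period hper
      have h7 : S.ξe - S.ξs ≤ (S.ξe - S.ξs) * 3 / (c * r) * T.h := by
        rw [div_mul_eq_mul_div, le_div_iff₀ (by positivity), mul_assoc]
        gcongr
      have h8 : 0 ≤ 3 / c * T.h := by positivity
      rw [add_mul]
      linarith
  -- For an arc chord and parameter distance are comparable globally, so the two closest points
  -- suffice.
  · obtain ⟨c, hc, hexp⟩ := S.exists_expansion_of_arc hI hinj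
    refine ⟨3 / c, by positivity, fun T K a b hδ hK F => ?_⟩
    obtain ⟨ξ, hξ, ⟨⟨i, hi⟩, ha⟩, ⟨⟨j, hj⟩, hb⟩⟩ := F.2.1
    have h1 := IsFictitiousInterval.foot_dist_le hK (hξ i).2
    have h2 := IsFictitiousInterval.foot_dist_le hK (hξ j).2
    rw [hi] at h1
    rw [hj] at h2
    have h4 := T.dist_le_h K (T.vertex_mem K i) (T.vertex_mem K j)
    rw [dist_eq_norm] at h4
    have h5 := hexp a (F.1 ⟨le_rfl, F.le⟩) b (F.1 ⟨F.le, le_rfl⟩)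
    rw [abs_of_nonneg (sub_nonneg.2 F.le)] at h5
    have h6 : ‖S.g b - S.g a‖ ≤ 3 * T.h := by
      have : S.g b - S.g a = -(T.vertex K j - S.g b) + -(T.vertex K i - T.vertex K j)
        + (T.vertex K i - S.g a) := by abel
      rw [this]
      refine (norm_add₃_le).trans ?_
      rw [norm_neg, norm_neg]
      linarith
    rw [div_mul_eq_mul_div, le_div_iff₀ hc]
    linarith

/-- The parameter interval of a fictitious element is not short. -/
theorem Interface.exists_le_length {Q : Rect} (S : Interface Q) {c : ℝ} (hc : 0 < c) :
    ∃ r : ℝ, 0 < r ∧ ∀ (T : Mesh Q) (K : T.Elt) (a b : ℝ), T.h ≤ S.δ → T.QuasiUniform c →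
      T.IsFictitiousInterval S K a b → T.h ≤ r * (b - a) := by
  obtain ⟨L, hL, hLip⟩ := S.exists_frenet_lipschitz
  have hL' : (0 : ℝ) < L := hL
  refine ⟨2 * L ^ 2 / c ^ 2, by positivity, fun T K a b hδ hq F => ?_⟩
  have hh := T.h_pos
  -- Comparison of areas: at least `(c h) ^ 2` for the element, at most `L ^ 2 * 2 h (b - a)` for
  -- the fictitious element containing it.
  have h1 : volume (T.cell K) ≤ (L : ENNReal) ^ 2 * volume (Icc (-T.h) T.h ×ˢ Icc a b) :=
    (measure_mono F.2.2.2).trans (volume_image_le (hLip.mono (F.subset_strip hδ)))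
  rw [T.volume_cell, Measure.volume_eq_prod, Measure.prod_prod, Real.volume_Icc, Real.volume_Icc,
    ← ENNReal.ofReal_mul (by linarith), ← ENNReal.ofReal_coe_nnreal,
    ← ENNReal.ofReal_pow (by positivity), ← ENNReal.ofReal_mul (by positivity),
    ENNReal.ofReal_le_ofReal_iff (mul_nonneg (by positivity)
      (mul_nonneg (by linarith) (sub_nonneg.2 F.le)))] at h1
  have h2 : c * T.h * (c * T.h) ≤ T.wx K * T.wy K :=
    mul_le_mul (hq.1 _) (hq.2 _) (by positivity) (T.wx_pos K).le
  have h3 : T.h * (c ^ 2 * T.h) ≤ T.h * (2 * L ^ 2 * (b - a)) := by nlinarith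
  have h4 := le_of_mul_le_mul_left h3 hh
  rw [div_mul_eq_mul_div, le_div_iff₀ (by positivity)]
  linarith

end

/-! ### The two sides of the interface within an element -/

section

theorem Rect.isOpen_dom (Q : Rect) : IsOpen Q.dom := by
  have h : ∀ i : Fin 2, Continuous fun p : Pt => p i := fun i => PiLp.continuous_apply 2 _ i
  exact (isOpen_Ioo.preimage (h 0)).inter (isOpen_Ioo.preimage (h 1))

namespace Mesh

variable {Q : Rect} (T : Mesh Q) (S : Interface Q)

/-- The closure of the part of an element on the negative side of the interface. -/
def sideM (K : T.Elt) : Set Pt := closure (interior (T.cell K) ∩ S.Ωm)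

/-- The closure of the part of an element on the positive side of the interface. -/
def sideP (K : T.Elt) : Set Pt := closure (interior (T.cell K) ∩ S.Ωp)

namespace IsFictitiousInterval

variable {T S} {K : T.Elt} {a b : ℝ}

/-- The sign `s` treats both sides at once. Follow the segment from `p` to a point of the curve in
the element up to the first time `τ` at which the curve is met. Before `τ` the normal coordinate
keeps its sign and the path stays in the union of the disjoint open sets `A` and `B`. Near the point
of contact the orientation of the normal decides for `A`, and connectedness carries this back to
`p`. -/
theorem mem_side (F : T.IsFictitiousInterval S K a b) (hδ : T.h ≤ S.δ)
    (hK : T.IsInterfaceElt S K) {A B : Set Pt} (hA : IsOpen A) (hB : IsOpen B)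
    (hAB : Disjoint A B) (hsplit : Q.dom \ S.Γ ⊆ A ∪ B) {s : ℝ} (hs : |s| = 1)
    (horient : ∀ ξ ∈ S.params, S.g ξ ∈ Q.dom → ∃ r > 0, ∀ η ∈ Ioo 0 r, frenet S.g (s * η, ξ) ∈ A)
    {p : Pt} (hp : p ∈ interior (T.cell K)) (hη : 0 < s * (frenetInv S.g T.h a b p).1) :
    p ∈ A := by
  set u := frenetInv S.g T.h a b with hu
  have hs2 : s * s = 1 := by rw [← abs_mul_abs_self, hs, one_mul]
  obtain ⟨q, hq, hqΓ⟩ := hK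
  let γ : ℝ → Pt := fun t => p + t • (q - p)
  have hγc : Continuous γ := by fun_prop
  have hγi : ∀ t ∈ Icc (0:ℝ) 1, γ t ∈ interior (T.cell K) := fun t ht =>
    (T.convex_cell K).interior.add_smul_sub_mem hp hq ht
  have hγK : MapsTo γ (Icc 0 1) (T.cell K) := fun t ht => interior_subset (hγi t ht)
  have huγ : ContinuousOn (fun t => u (γ t)) (Icc 0 1) :=
    (F.continuousOn_inv hδ).comp hγc.continuousOn hγK
  have hfc : ContinuousOn (fun t => s * (u (γ t)).1) (Icc 0 1) := huγ.fst.const_mul s |>.congr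
    fun _ _ => rfl
  let Z : Set ℝ := Icc 0 1 ∩ (fun t => s * (u (γ t)).1) ⁻¹' {0}
  have hZc : IsClosed Z := hfc.preimage_isClosed_of_isClosed isClosed_Icc isClosed_singleton
  have hZ1 : (1 : ℝ) ∈ Z := by
    refine ⟨⟨zero_le_one, le_rfl⟩, ?_⟩
    have : γ 1 = q := by simp [γ]
    have h0 := (F.mem_Γ_iff hδ (interior_subset hq)).1 hqΓ
    simp only [mem_preimage, this, mem_singleton_iff, mul_eq_zero]
    exact Or.inr h0
  have hZb : BddBelow Z := ⟨0, fun t ht => ht.1.1⟩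
  set τ := sInf Z with hτ
  have hτZ : τ ∈ Z := hZc.csInf_mem ⟨1, hZ1⟩ hZb
  have hγ0 : γ 0 = p := by simp [γ]
  have hτ0 : 0 < τ := by
    refine lt_of_le_of_ne hτZ.1.1 fun h => ?_
    have h2 := hτZ.2
    rw [← h] at h2
    simp only [mem_preimage, hγ0, mem_singleton_iff] at h2
    exact hη.ne' h2
  have hsubI : Ico 0 τ ⊆ Icc 0 1 := fun t ht => ⟨ht.1, ht.2.le.trans hτZ.1.2⟩
  have hpos : ∀ t ∈ Ico 0 τ, 0 < s * (u (γ t)).1 := by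
    intro t ht
    by_contra! hle
    have hsub : Icc 0 t ⊆ Icc 0 1 := fun x hx => ⟨hx.1, hx.2.trans (hsubI ht).2⟩
    have hivt := intermediate_value_Icc' ht.1 (hfc.mono hsub)
    obtain ⟨x, hx, hx0⟩ := hivt ⟨hle, by simp only [hγ0]; exact hη.le⟩
    exact (csInf_le hZb ⟨hsub hx, hx0⟩).not_gt (hx.2.trans_lt ht.2)
  have hJ : γ '' Ico 0 τ ⊆ A ∪ B := by
    rintro _ ⟨t, ht, rfl⟩
    refine hsplit ⟨T.interior_cell_subset_dom K (hγi t (hsubI ht)), fun hΓ => ?_⟩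
    have h0 := (F.mem_Γ_iff hδ (hγK (hsubI ht))).1 hΓ
    have := hpos t ht
    rw [hu, h0, mul_zero] at this
    exact lt_irrefl _ this
  have hJp : IsPreconnected (γ '' Ico 0 τ) := isPreconnected_Ico.image _ hγc.continuousOn
  have hτK : γ τ ∈ T.cell K := hγK hτZ.1
  set ζ := (u (γ τ)).2 with hζ
  have hs0 : s ≠ 0 := fun h => by simp [h] at hs
  have huτ : u (γ τ) = (0, ζ) := by
    have : s * (u (γ τ)).1 = 0 := hτZ.2
    exact Prod.ext ((mul_eq_zero.1 this).resolve_left hs0) rfl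
  have hζp : ζ ∈ S.params := F.mem_params hτK
  have hgζ : S.g ζ = γ τ := by
    have := F.frenet_inv hτK
    rw [← hu, huτ] at this
    simpa [frenet] using this
  have hgdom : S.g ζ ∈ Q.dom := hgζ ▸ T.interior_cell_subset_dom K (hγi τ hτZ.1)
  obtain ⟨r, hr, hrA⟩ := horient ζ hζp hgdom
  have hzs : ((0 : ℝ), ζ) ∈ S.strip := ⟨⟨by linarith [S.δ_pos], S.δ_pos.le⟩, hζp⟩
  obtain ⟨ρ, hρ, hρd⟩ : ∃ ρ > 0, Metric.ball ((0 : ℝ), ζ) ρ ∩ S.strip ⊆ frenet S.g ⁻¹' Q.dom := by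
    refine Metric.mem_nhdsWithin_iff.1 ((S.frenet_continuousOn _ hzs) ?_)
    refine Q.isOpen_dom.mem_nhds ?_
    simpa [frenet] using hgdom
  -- A half ball in Frenet coordinates: it is convex, its image avoids the curve and stays in the
  -- domain, so it lies in one of `A`, `B`; a short piece of the normal selects `A`.
  let X : Set (ℝ × ℝ) := (Metric.ball ((0 : ℝ), ζ) ρ ∩ S.strip) ∩ {z | 0 < s * z.1}
  have hXc : Convex ℝ X := by
    refine ((convex_ball _ _).inter S.strip_convex).inter ?_
    intro x hx y hy a b ha hb hab
    have hx' : 0 < s * x.1 := hx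
    have hy' : 0 < s * y.1 := hy
    show 0 < s * (a * x.1 + b * y.1)
    rcases ha.eq_or_lt with h | h
    · obtain rfl : b = 1 := by linarith
      rw [← h]; simpa using hy'
    · nlinarith [mul_pos h hx', mul_nonneg hb hy'.le]
  have hXim : frenet S.g '' X ⊆ A ∪ B := by
    rintro _ ⟨z, ⟨⟨hz1, hz2⟩, hz3⟩, rfl⟩
    refine hsplit ⟨hρd ⟨hz1, hz2⟩, fun hΓ => ?_⟩
    have h0 := S.fst_eq_zero_of_mem hz2.1 hz2.2 hΓ
    have hz3' : 0 < s * z.1 := hz3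
    rw [h0, mul_zero] at hz3'
    exact lt_irrefl _ hz3'
  have hXA : frenet S.g '' X ⊆ A := by
    refine (hXc.isPreconnected.image _ (S.frenet_continuousOn.mono
      fun z hz => hz.1.2)).subset_left_of_subset_union hA hB hAB hXim ?_
    set ε := min r (min ρ S.δ) / 2 with hε
    have hm : 0 < min r (min ρ S.δ) := lt_min hr (lt_min hρ S.δ_pos)
    have h1 : ε < r := (half_lt_self hm).trans_le (min_le_left _ _)
    have h2 : ε < ρ := (half_lt_self hm).trans_le ((min_le_right _ _).trans (min_le_left _ _))
    have h3 : ε < S.δ := (half_lt_self hm).trans_le ((min_le_right _ _).trans (min_le_right _ _))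
    have h4 : 0 < ε := half_pos hm
    have h5 : |s * ε| = ε := by rw [abs_mul, hs, one_mul, abs_of_pos h4]
    refine ⟨_, ⟨(s * ε, ζ), ⟨⟨?_, ?_⟩, ?_⟩, rfl⟩, hrA ε ⟨h4, h1⟩⟩
    · rw [mem_ball_iff_norm, Prod.norm_def]
      simp only [Prod.fst_sub, Prod.snd_sub, sub_zero, sub_self, norm_zero, Real.norm_eq_abs, h5]
      exact max_lt h2 hρ
    · refine ⟨abs_le.1 ?_, hζp⟩
      simp only
      rw [h5]; exact h3.le
    · show 0 < s * (s * ε)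
      rw [← mul_assoc, hs2, one_mul]; exact h4
  -- Shortly before `τ` the path has entered that half ball.
  obtain ⟨ε, hε, hεt⟩ := Metric.continuousWithinAt_iff.1 (huγ τ hτZ.1) ρ hρ
  set t := max 0 (τ - ε / 2) with ht
  have ht0 : t ∈ Ico 0 τ := ⟨le_max_left _ _, max_lt hτ0 (by linarith)⟩
  have htd : dist t τ < ε := by
    rw [Real.dist_eq, abs_sub_comm, abs_of_pos (by linarith [ht0.2])]
    have := le_max_right 0 (τ - ε / 2)
    linarith
  have h1 := hεt (hsubI ht0) htd
  rw [huτ] at h1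
  have h2 : γ t ∈ A := by
    have h3 := F.frenet_inv (hγK (hsubI ht0))
    rw [← h3]
    exact hXA ⟨_, ⟨⟨h1, F.inv_mem_strip hδ (hγK (hsubI ht0))⟩, hpos t ht0⟩, rfl⟩
  have h3 := hJp.subset_left_of_subset_union hA hB hAB hJ ⟨γ t, ⟨t, ht0, rfl⟩, h2⟩
  exact hγ0 ▸ h3 ⟨0, ⟨le_rfl, hτ0⟩, rfl⟩

theorem mem_Ωm_iff (F : T.IsFictitiousInterval S K a b) (hδ : T.h ≤ S.δ)
    (hK : T.IsInterfaceElt S K) {p : Pt} (hp : p ∈ interior (T.cell K)) :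
    (p ∈ S.Ωm ↔ (frenetInv S.g T.h a b p).1 < 0) ∧
    (p ∈ S.Ωp ↔ 0 < (frenetInv S.g T.h a b p).1) := by
  have hm : (frenetInv S.g T.h a b p).1 < 0 → p ∈ S.Ωm := fun h =>
    F.mem_side hδ hK S.isOpen_Ωm S.isOpen_Ωp S.disjoint S.split.subset (s := -1) (by simp)
      (fun ξ hξ hd => by
        obtain ⟨r, hr, H⟩ := S.orient ξ hξ hd
        exact ⟨r, hr, fun η hη => by simpa using (H η hη).1⟩) hp (by linarith)
  have hpp : 0 < (frenetInv S.g T.h a b p).1 → p ∈ S.Ωp := fun h =>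
    F.mem_side hδ hK S.isOpen_Ωp S.isOpen_Ωm S.disjoint.symm (union_comm S.Ωm S.Ωp ▸ S.split.subset)
      (s := 1) (by simp)
      (fun ξ hξ hd => by
        obtain ⟨r, hr, H⟩ := S.orient ξ hξ hd
        exact ⟨r, hr, fun η hη => by simpa using (H η hη).2⟩) hp (by linarith)
  have hne : p ∈ S.Ωm ∪ S.Ωp → (frenetInv S.g T.h a b p).1 ≠ 0 := by
    intro h h0
    rw [← S.split] at h
    exact h.2 ((F.mem_Γ_iff hδ (interior_subset hp)).2 h0)
  refine ⟨⟨fun h => ?_, hm⟩, fun h => ?_, hpp⟩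
  · rcases lt_trichotomy (frenetInv S.g T.h a b p).1 0 with h1 | h1 | h1
    · exact h1
    · exact absurd h1 (hne (Or.inl h))
    · exact absurd (hpp h1) (disjoint_left.1 S.disjoint h)
  · rcases lt_trichotomy (frenetInv S.g T.h a b p).1 0 with h1 | h1 | h1
    · exact absurd h (disjoint_left.1 S.disjoint (hm h1))
    · exact absurd h1 (hne (Or.inr h))
    · exact h1

theorem nonpos_of_mem_sideM (F : T.IsFictitiousInterval S K a b) (hδ : T.h ≤ S.δ)
    (hK : T.IsInterfaceElt S K) {p : Pt} (hp : p ∈ T.sideM S K) :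
    (frenetInv S.g T.h a b p).1 ≤ 0 := by
  have hc : IsClosed (T.cell K ∩ (fun p => (frenetInv S.g T.h a b p).1) ⁻¹' Iic 0) :=
    (F.continuousOn_inv hδ).fst.preimage_isClosed_of_isClosed (T.isClosed_cell K) isClosed_Iic
  refine (closure_minimal ?_ hc hp).2
  exact fun q hq => ⟨interior_subset hq.1, ((F.mem_Ωm_iff hδ hK hq.1).1.1 hq.2).le⟩

theorem nonneg_of_mem_sideP (F : T.IsFictitiousInterval S K a b) (hδ : T.h ≤ S.δ)
    (hK : T.IsInterfaceElt S K) {p : Pt} (hp : p ∈ T.sideP S K) :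
    0 ≤ (frenetInv S.g T.h a b p).1 := by
  have hc : IsClosed (T.cell K ∩ (fun p => (frenetInv S.g T.h a b p).1) ⁻¹' Ici 0) :=
    (F.continuousOn_inv hδ).fst.preimage_isClosed_of_isClosed (T.isClosed_cell K) isClosed_Ici
  refine (closure_minimal ?_ hc hp).2
  exact fun q hq => ⟨interior_subset hq.1, ((F.mem_Ωm_iff hδ hK hq.1).2.1 hq.2).le⟩

theorem sideM_subset (T : Mesh Q) (S : Interface Q) (K : T.Elt) : T.sideM S K ⊆ T.cell K :=
  closure_minimal (fun _ h => interior_subset h.1) (T.isClosed_cell K)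

theorem mem_Γ_of_mem_sides (F : T.IsFictitiousInterval S K a b) (hδ : T.h ≤ S.δ)
    (hK : T.IsInterfaceElt S K) {p : Pt} (hp : p ∈ T.sideM S K ∩ T.sideP S K) : p ∈ S.Γ :=
  (F.mem_Γ_iff hδ (sideM_subset T S K hp.1)).2
    (le_antisymm (F.nonpos_of_mem_sideM hδ hK hp.1) (F.nonneg_of_mem_sideP hδ hK hp.2))

theorem volume_Γ_inter_cell (F : T.IsFictitiousInterval S K a b) (hδ : T.h ≤ S.δ) :
    volume (S.Γ ∩ T.cell K) = 0 := by
  obtain ⟨L, -, hLip⟩ := S.exists_frenet_lipschitz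
  have hsub : S.Γ ∩ T.cell K ⊆ frenet S.g '' ({0} ×ˢ Icc a b) := by
    rintro p ⟨hΓ, hp⟩
    refine ⟨frenetInv S.g T.h a b p, ⟨(F.mem_Γ_iff hδ hp).1 hΓ, (F.inv_mem hp).2⟩, F.frenet_inv hp⟩
  refine measure_mono_null hsub (le_antisymm ?_ bot_le)
  refine (volume_image_le (hLip.mono ?_)).trans ?_
  · refine Subset.trans (prod_mono ?_ subset_rfl) (F.subset_strip hδ)
    rintro x rfl
    exact ⟨by linarith [T.h_pos], T.h_pos.le⟩
  · rw [Measure.volume_eq_prod, Measure.prod_prod]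
    simp

/-- The curve has measure zero in the element, so the points of the interior off the curve are
dense, and each of them belongs to one side. -/
theorem cell_subset_sides (F : T.IsFictitiousInterval S K a b) (hδ : T.h ≤ S.δ)
    (hK : T.IsInterfaceElt S K) : T.cell K ⊆ T.sideM S K ∪ T.sideP S K := by
  rw [← T.closure_interior_cell, sideM, sideP, ← closure_union]
  refine closure_minimal (fun q hq => ?_) isClosed_closure
  rw [mem_closure_iff]
  intro V hV hqV
  by_contra hne
  have hsub : V ∩ interior (T.cell K) ⊆ S.Γ ∩ T.cell K := by
    rintro x ⟨hxV, hx⟩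
    refine ⟨?_, interior_subset hx⟩
    by_contra hxΓ
    have h0 : (frenetInv S.g T.h a b x).1 ≠ 0 := fun h =>
      hxΓ ((F.mem_Γ_iff hδ (interior_subset hx)).2 h)
    refine hne ⟨x, hxV, ?_⟩
    rcases lt_or_gt_of_ne h0 with h | h
    · exact Or.inl ⟨hx, (F.mem_Ωm_iff hδ hK hx).1.2 h⟩
    · exact Or.inr ⟨hx, (F.mem_Ωm_iff hδ hK hx).2.2 h⟩
  have hpos := (hV.inter isOpen_interior).measure_pos volume ⟨q, hqV, hq⟩
  exact hpos.ne' (measure_mono_null hsub (F.volume_Γ_inter_cell hδ))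

theorem eventually_nonpos (F : T.IsFictitiousInterval S K a b) (hδ : T.h ≤ S.δ)
    (hK : T.IsInterfaceElt S K) {p : Pt} (hp : p ∉ T.sideP S K) :
    ∀ᶠ q in nhdsWithin p (T.cell K), (frenetInv S.g T.h a b q).1 ≤ 0 := by
  have hU : IsOpen (T.sideP S K)ᶜ := isClosed_closure.isOpen_compl
  filter_upwards [mem_nhdsWithin_of_mem_nhds (hU.mem_nhds hp), self_mem_nhdsWithin] with q hq hqK
  exact F.nonpos_of_mem_sideM hδ hK ((F.cell_subset_sides hδ hK hqK).resolve_right hq)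

theorem eventually_nonneg (F : T.IsFictitiousInterval S K a b) (hδ : T.h ≤ S.δ)
    (hK : T.IsInterfaceElt S K) {p : Pt} (hp : p ∉ T.sideM S K) :
    ∀ᶠ q in nhdsWithin p (T.cell K), 0 ≤ (frenetInv S.g T.h a b q).1 := by
  have hU : IsOpen (T.sideM S K)ᶜ := isClosed_closure.isOpen_compl
  filter_upwards [mem_nhdsWithin_of_mem_nhds (hU.mem_nhds hp), self_mem_nhdsWithin] with q hq hqK
  exact F.nonneg_of_mem_sideP hδ hK ((F.cell_subset_sides hδ hK hqK).resolve_left hq)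

/-- A point of both sides lies on the curve. If the edge meets the curve at most once, one parameter
is excluded. If the edge is part of the curve, then near an interior point of the edge the element
contains no further points of the curve, so only one side is present there. -/
theorem ae_edge_notMem_sides (F : T.IsFictitiousInterval S K a b) (hδ : T.h ≤ S.δ)
    (hK : T.IsInterfaceElt S K) (hT : T.Admissible S) (B : T.Edge)
    (h1 : ∀ t ∈ Icc B.lo B.hi, B.pt t ∈ T.cell K)
    (h2 : ∀ t, B.pt t ∉ interior (T.cell K)) :
    ∀ᵐ t ∂volume.restrict (Icc B.lo B.hi), B.pt t ∉ T.sideM S K ∩ T.sideP S K := by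
  rw [ae_restrict_iff' measurableSet_Icc]
  rcases B.carrier_inter hT with hsub | hsub
  · have hs : {t | t ∈ Icc B.lo B.hi ∧ B.pt t ∈ S.Γ}.Subsingleton := by
      rintro s ⟨hs, hsΓ⟩ t ⟨ht, htΓ⟩
      exact B.pt_injective (hsub ⟨hsΓ, s, hs, rfl⟩ ⟨htΓ, t, ht, rfl⟩)
    have h0 := hs.measure_zero volume
    rw [measure_eq_zero_iff_ae_notMem] at h0
    filter_upwards [h0] with t ht htI hbad
    exact ht ⟨htI, F.mem_Γ_of_mem_sides hδ hK hbad⟩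
  · have hends : ∀ᵐ t : ℝ, t ≠ B.lo ∧ t ≠ B.hi := by
      have e1 : ∀ᵐ t : ℝ, t ≠ B.lo := by simp [ae_iff]
      have e2 : ∀ᵐ t : ℝ, t ≠ B.hi := by simp [ae_iff]
      exact e1.and e2
    filter_upwards [hends] with t₀ hne ht₀ hbad
    have hlo : B.lo < t₀ := lt_of_le_of_ne ht₀.1 hne.1.symm
    have hhi : t₀ < B.hi := lt_of_le_of_ne ht₀.2 hne.2
    set u := frenetInv S.g T.h a b with hu
    have huc := F.continuousOn_inv hδ
    have hη0 : ∀ t ∈ Icc B.lo B.hi, (u (B.pt t)).1 = 0 := fun t ht =>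
      (F.mem_Γ_iff hδ (h1 t ht)).1 (hsub ⟨t, ht, rfl⟩)
    let x : ℝ → ℝ := fun t => (u (B.pt t)).2
    have hxc : ContinuousOn x (Icc B.lo B.hi) := (huc.comp B.continuous_pt.continuousOn h1).snd
    have hxi : InjOn x (Icc B.lo B.hi) := by
      intro s hs t ht hst
      apply B.pt_injective
      rw [← F.frenet_inv (h1 s hs), ← F.frenet_inv (h1 t ht), ← hu]
      congr 1
      exact Prod.ext ((hη0 s hs).trans (hη0 t ht).symm) hst
    -- Along the edge the tangential coordinate is continuous and injective, hence strictly
    -- monotone, and covers a neighbourhood. A point of the curve in the element near `B.pt t₀`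
    -- therefore has the same coordinates as a point of the edge and coincides with it.
    have hnhds : x '' Icc B.lo B.hi ∈ nhds (x t₀) := by
      have hivt := intermediate_value_uIcc (f := x) (a := B.lo) (b := B.hi)
        (by rwa [uIcc_of_le B.lo_lt_hi.le])
      rw [uIcc_of_le B.lo_lt_hi.le] at hivt
      refine Filter.mem_of_superset ?_ hivt
      have hL : B.lo ∈ Icc B.lo B.hi := ⟨le_rfl, B.lo_lt_hi.le⟩
      have hR : B.hi ∈ Icc B.lo B.hi := ⟨B.lo_lt_hi.le, le_rfl⟩
      rcases hxc.strictMonoOn_of_injOn_Icc' B.lo_lt_hi.le hxi with hm | hm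
      · refine Filter.mem_of_superset (Icc_mem_nhds (hm hL ht₀ hlo) (hm ht₀ hR hhi)) ?_
        exact Icc_subset_uIcc
      · refine Filter.mem_of_superset (Icc_mem_nhds (hm ht₀ hR hhi) (hm hL ht₀ hlo)) ?_
        exact Icc_subset_uIcc'
    have hev : ∀ᶠ q in nhdsWithin (B.pt t₀) (T.cell K), (u q).2 ∈ x '' Icc B.lo B.hi :=
      (huc _ (h1 t₀ ht₀)).snd hnhds
    obtain ⟨ρ, hρ, hball⟩ := Metric.mem_nhdsWithin_iff.1 hev
    let W := Metric.ball (B.pt t₀) ρ ∩ interior (T.cell K)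
    have hWη : ∀ q ∈ W, (u q).1 ≠ 0 := by
      rintro q ⟨hqb, hqi⟩ h0
      obtain ⟨t, ht, hxt⟩ := hball ⟨hqb, interior_subset hqi⟩
      have : u q = u (B.pt t) := Prod.ext (h0.trans (hη0 t ht).symm) hxt.symm
      have hq : q = B.pt t := by
        rw [← F.frenet_inv (interior_subset hqi), ← F.frenet_inv (h1 t ht), ← hu, this]
      exact h2 t (hq ▸ hqi)
    have hWp : IsPreconnected W :=
      ((convex_ball _ _).inter (T.convex_cell K).interior).isPreconnected
    obtain ⟨q, hqb, hqi, hqm⟩ := mem_closure_iff.1 hbad.1 _ Metric.isOpen_ball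
      (Metric.mem_ball_self hρ)
    obtain ⟨q', hqb', hqi', hqp⟩ := mem_closure_iff.1 hbad.2 _ Metric.isOpen_ball
      (Metric.mem_ball_self hρ)
    have hneg := (F.mem_Ωm_iff hδ hK hqi).1.1 hqm
    have hpos := (F.mem_Ωm_iff hδ hK hqi').2.1 hqp
    obtain ⟨y, hy, hy0⟩ := hWp.intermediate_value (a := q) (b := q') ⟨hqb, hqi⟩ ⟨hqb', hqi'⟩
      (f := fun p => (u p).1) (huc.fst.mono fun p hp => interior_subset hp.2) ⟨hneg.le, hpos.le⟩
    exact hWη y hy hy0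

end IsFictitiousInterval

end Mesh

end

/-! ### One-sided gradients and their measurability -/

section

variable {Q : Rect}

/-- The points of an interface element where both sides of the interface meet. -/
def Mesh.ridge (T : Mesh Q) (S : Interface Q) (K : T.Elt) : Set Pt :=
  {p | T.IsInterfaceElt S K ∧ p ∈ T.sideM S K ∩ T.sideP S K}

open Classical in
/-- `v` is continuous on the element `K`, and its gradient is given by the continuous fields `Gm` and
`Gp` on the two sides of the interface. -/
structure PiecewiseGrad (T : Mesh Q) (S : Interface Q) (K : T.Elt) (v : Pt → ℝ) (Gm Gp : Pt → Pt) :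
    Prop where
  cont : ContinuousOn v (T.cell K)
  contM : ContinuousOn Gm (T.cell K)
  contP : ContinuousOn Gp (T.cell K)
  grad : ∀ p ∈ T.cell K, p ∉ T.ridge S K →
    HasGradientWithinAt v (if p ∈ T.sideM S K then Gm p else Gp p) (T.cell K) p
  const : (∀ p ∈ T.cell K, Gm p = 0) → (∀ p ∈ T.cell K, Gp p = 0) →
    ∀ p ∈ T.cell K, ∀ q ∈ T.cell K, v p = v q

theorem gradientWithin_cell_eq {T : Mesh Q} {K : T.Elt} {v : Pt → ℝ} {p G : Pt}
    (hp : p ∈ T.cell K) (h : HasGradientWithinAt v G (T.cell K) p) :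
    gradientWithin v (T.cell K) p = G := by
  have h1 := h.differentiableWithinAt.hasGradientWithinAt
  rw [hasGradientWithinAt_iff_hasFDerivWithinAt] at h h1
  exact (InnerProductSpace.toDual ℝ Pt).injective ((T.uniqueDiffOn_cell K).eq hp h1 h)

theorem eq_of_gradientWithin_eq_zero {T : Mesh Q} {K : T.Elt} {v : Pt → ℝ}
    (h : ∀ p ∈ T.cell K, HasGradientWithinAt v 0 (T.cell K) p) {p q : Pt} (hp : p ∈ T.cell K)
    (hq : q ∈ T.cell K) : v p = v q := by
  have h1 : ∀ p ∈ T.cell K, HasFDerivWithinAt v 0 (T.cell K) p := fun p hp => by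
    have := h p hp
    rwa [hasGradientWithinAt_iff_hasFDerivWithinAt, map_zero] at this
  exact (T.convex_cell K).is_const_of_fderivWithin_eq_zero (𝕜 := ℝ)
    (fun p hp => (h1 p hp).differentiableWithinAt)
    (fun p hp => (h1 p hp).fderivWithin (T.uniqueDiffOn_cell K p hp)) hp hq

theorem dS_dT_affine {m : ℕ} {c d : Coef m} {x k a l : ℝ}
    (h : ∀ s t, qEval m d s t = qEval m c (x + k * s) (a + l * t)) (s t : ℝ) :
    dS m d s t = k * dS m c (x + k * s) (a + l * t) ∧
    dT m d s t = l * dT m c (x + k * s) (a + l * t) := by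
  have h1 := qEval_hasFDerivAt m d (s, t)
  have hA : HasFDerivAt (fun z : ℝ × ℝ => (x + k * z.1, a + l * z.2))
      ((k • ContinuousLinearMap.fst ℝ ℝ ℝ).prod (l • ContinuousLinearMap.snd ℝ ℝ ℝ)) (s, t) :=
    ((hasFDerivAt_fst.const_mul k).const_add x).prodMk ((hasFDerivAt_snd.const_mul l).const_add a)
  have h2 := (qEval_hasFDerivAt m c (x + k * s, a + l * t)).comp (s, t) hA
  have h3 : (fun z : ℝ × ℝ => qEval m d z.1 z.2)
      = (fun z : ℝ × ℝ => qEval m c z.1 z.2) ∘ fun z : ℝ × ℝ => (x + k * z.1, a + l * z.2) := by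
    ext z; exact h z.1 z.2
  rw [h3] at h1
  have h4 := h1.unique h2
  constructor
  · have := DFunLike.congr_fun h4 (1, 0)
    simp at this
    linarith
  · have := DFunLike.congr_fun h4 (0, 1)
    simp at this
    linarith

/-! ### Functions on interface elements -/

section InterfaceElement

variable {T : Mesh Q} {S : Interface Q} {K : T.Elt} {a b : ℝ} {m : ℕ}

theorem Mesh.IsFictitiousInterval.hasGradientWithinAt (F : T.IsFictitiousInterval S K a b)
    (hδ : T.h ≤ S.δ) (c : Coef m) {p : Pt} (hp : p ∈ T.cell K) :
    HasGradientWithinAt (fun q => qEval m c (frenetInv S.g T.h a b q).1 (frenetInv S.g T.h a b q).2)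
      (frenetGrad S.g c (frenetInv S.g T.h a b p)) (T.cell K) p :=
  hasGradientWithinAt_of_frenet S.smooth c hp (S.regular _ (F.mem_params hp))
    (S.jacobian_pos _ (F.inv_mem_strip hδ hp).1 _ (F.mem_params hp)).ne'
    (F.continuousOn_inv hδ p hp) fun _ hq => F.frenet_inv hq

theorem Interface.normal_continuousOn (S : Interface Q) :
    ContinuousOn (normal S.g) S.params := fun _ hξ =>
  (hasDerivAt_normal S.smooth (S.regular _ hξ)).continuousAt.continuousWithinAt

theorem Interface.frenetGrad_continuousOn (S : Interface Q) (c : Coef m) :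
    ContinuousOn (frenetGrad S.g c) S.strip := by
  have hsnd : MapsTo (Prod.snd : ℝ × ℝ → ℝ) S.strip S.params := fun z hz => hz.2
  have h1 : ContinuousOn (fun z : ℝ × ℝ => normal S.g z.2) S.strip :=
    S.normal_continuousOn.comp continuousOn_snd hsnd
  have h2 : ContinuousOn (fun z : ℝ × ℝ => curvature S.g z.2) S.strip :=
    S.curvature_continuousOn.comp continuousOn_snd hsnd
  have h3 : Continuous (fun z : ℝ × ℝ => deriv S.g z.2) := S.deriv_continuous.comp continuous_snd
  have h4 : Continuous (fun z : ℝ × ℝ => dS m c z.1 z.2) :=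
    (dS_continuous m).comp (continuous_const.prodMk continuous_id)
  have h5 : Continuous (fun z : ℝ × ℝ => dT m c z.1 z.2) :=
    (dT_continuous m).comp (continuous_const.prodMk continuous_id)
  refine (h4.continuousOn.smul h1).add ((h5.continuousOn.div ?_ ?_).smul h3.continuousOn)
  · exact (continuousOn_const.add (continuousOn_fst.mul h2)).mul (h3.norm.pow 2).continuousOn
  · intro z hz
    have := norm_ne_zero_iff.2 (S.regular _ hz.2)
    have := S.jacobian_pos _ hz.1 _ hz.2
    positivity

/-- The values on both sides of the interface of a function in the local immersed space. -/
theorem localIFE_values {βm βp : ℝ} {cm cp : Coef m} (F : T.IsFictitiousInterval S K a b)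
    (hab : a < b) (H : JumpConditions S.g m βm βp a b cm cp) {v : Pt → ℝ}
    (hv : ∀ η ∈ Icc (-T.h) T.h, ∀ ξ ∈ Icc a b, frenet S.g (η, ξ) ∈ T.cell K →
        v (frenet S.g (η, ξ)) = if η < 0 then qEval m cm η ξ else qEval m cp η ξ)
    {p : Pt} (hp : p ∈ T.cell K) :
    ((frenetInv S.g T.h a b p).1 ≤ 0 →
      v p = qEval m cm (frenetInv S.g T.h a b p).1 (frenetInv S.g T.h a b p).2) ∧
    (0 ≤ (frenetInv S.g T.h a b p).1 →
      v p = qEval m cp (frenetInv S.g T.h a b p).1 (frenetInv S.g T.h a b p).2) := by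
  have hz := F.inv_mem hp
  have h1 := F.frenet_inv hp
  set z := frenetInv S.g T.h a b p
  have h2 := hv z.1 hz.1 z.2 hz.2 (by rw [Prod.mk.eta, h1]; exact hp)
  rw [Prod.mk.eta, h1] at h2
  rcases lt_trichotomy z.1 0 with h | h | h
  · rw [if_pos h] at h2
    exact ⟨fun _ => h2, fun h' => absurd h h'.not_gt⟩
  · rw [if_neg h.not_lt] at h2
    refine ⟨fun _ => ?_, fun _ => h2⟩
    rw [h2, h, qEval_zero_left, qEval_zero_left, H.row_zero_eq hab]
  · rw [if_neg h.not_gt] at h2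
    exact ⟨fun h' => absurd h h'.not_gt, fun _ => h2⟩

/-- Each polynomial piece extends through the Frenet coordinates to a differentiable function on the
whole element. The pieces agree where `η = 0`, which gives continuity; off the ridge only one side
is present nearby, so the function locally equals one of the extensions. -/
theorem piecewiseGrad_of_localIFE {βm βp : ℝ} {cm cp : Coef m} (F : T.IsFictitiousInterval S K a b)
    (hδ : T.h ≤ S.δ) (hK : T.IsInterfaceElt S K)
    (hab : a < b) (H : JumpConditions S.g m βm βp a b cm cp) {v : Pt → ℝ}
    (hv : ∀ η ∈ Icc (-T.h) T.h, ∀ ξ ∈ Icc a b, frenet S.g (η, ξ) ∈ T.cell K →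
        v (frenet S.g (η, ξ)) = if η < 0 then qEval m cm η ξ else qEval m cp η ξ) :
    PiecewiseGrad T S K v (fun p => frenetGrad S.g cm (frenetInv S.g T.h a b p))
      (fun p => frenetGrad S.g cp (frenetInv S.g T.h a b p)) := by
  set u := frenetInv S.g T.h a b with hu
  have huc := F.continuousOn_inv hδ
  have hval := fun {p} (hp : p ∈ T.cell K) => localIFE_values F hab H hv hp
  have hfm : ContinuousOn (fun p => qEval m cm (u p).1 (u p).2) (T.cell K) :=
    (qEval_continuous m cm).comp_continuousOn huc
  have hfp : ContinuousOn (fun p => qEval m cp (u p).1 (u p).2) (T.cell K) :=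
    (qEval_continuous m cp).comp_continuousOn huc
  refine ⟨?_, ?_, ?_, ?_, ?_⟩
  · have h1 : ContinuousOn v (T.cell K ∩ (fun p => (u p).1) ⁻¹' Iic 0) :=
      (hfm.mono inter_subset_left).congr fun p hp => (hval hp.1).1 hp.2
    have h2 : ContinuousOn v (T.cell K ∩ (fun p => (u p).1) ⁻¹' Ici 0) :=
      (hfp.mono inter_subset_left).congr fun p hp => (hval hp.1).2 hp.2
    have h3 := h1.union_of_isClosed h2
      (huc.fst.preimage_isClosed_of_isClosed (T.isClosed_cell K) isClosed_Iic)
      (huc.fst.preimage_isClosed_of_isClosed (T.isClosed_cell K) isClosed_Ici)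
    refine h3.mono fun p hp => ?_
    rcases le_total (u p).1 0 with h | h
    · exact Or.inl ⟨hp, h⟩
    · exact Or.inr ⟨hp, h⟩
  · exact (S.frenetGrad_continuousOn cm).comp huc fun p hp => F.inv_mem_strip hδ hp
  · exact (S.frenetGrad_continuousOn cp).comp huc fun p hp => F.inv_mem_strip hδ hp
  · intro p hp hr
    have hr' : ¬ (p ∈ T.sideM S K ∧ p ∈ T.sideP S K) := fun h => hr ⟨hK, h⟩
    by_cases hM : p ∈ T.sideM S K
    · rw [if_pos hM]
      refine (F.hasGradientWithinAt hδ cm hp).congr_of_eventuallyEq_of_mem ?_ hp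
      filter_upwards [F.eventually_nonpos hδ hK fun h => hr' ⟨hM, h⟩, self_mem_nhdsWithin]
        with q hq hqK using (hval hqK).1 hq
    · rw [if_neg hM]
      refine (F.hasGradientWithinAt hδ cp hp).congr_of_eventuallyEq_of_mem ?_ hp
      filter_upwards [F.eventually_nonneg hδ hK hM, self_mem_nhdsWithin]
        with q hq hqK using (hval hqK).2 hq
  · intro hm0 hp0
    have hcm : ∀ {p q}, p ∈ T.cell K → q ∈ T.cell K →
        qEval m cm (u p).1 (u p).2 = qEval m cm (u q).1 (u q).2 := fun {p q} hp hq =>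
      eq_of_gradientWithin_eq_zero (v := fun p => qEval m cm (u p).1 (u p).2)
        (fun p hp => by rw [← hm0 p hp]; exact F.hasGradientWithinAt hδ cm hp) hp hq
    have hcp : ∀ {p q}, p ∈ T.cell K → q ∈ T.cell K →
        qEval m cp (u p).1 (u p).2 = qEval m cp (u q).1 (u q).2 := fun {p q} hp hq =>
      eq_of_gradientWithin_eq_zero (v := fun p => qEval m cp (u p).1 (u p).2)
        (fun p hp => by rw [← hp0 p hp]; exact F.hasGradientWithinAt hδ cp hp) hp hq
    -- Both extensions are constant, and a point of the curve in the element forces the constants to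
    -- agree.
    obtain ⟨o, hoi, hoΓ⟩ := hK
    have ho := interior_subset hoi
    have ho0 := (F.mem_Γ_iff hδ ho).1 hoΓ
    have key : ∀ p ∈ T.cell K, v p = v o := by
      intro p hp
      rcases le_total (u p).1 0 with h | h
      · rw [(hval hp).1 h, (hval ho).1 ho0.le]; exact hcm hp ho
      · rw [(hval hp).2 h, (hval ho).2 ho0.ge]; exact hcp hp ho
    intro p hp q hq
    rw [key p hp, key q hq]

end InterfaceElement

/-! ### Consequences -/

section Ridge

variable {T : Mesh Q} {S : Interface Q}

theorem Mesh.Admissible.volume_ridge (hT : T.Admissible S) (K : T.Elt) :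
    ∀ᵐ p ∂volume.restrict (T.cell K), p ∉ T.ridge S K := by
  rw [ae_iff, Measure.restrict_apply' (T.isClosed_cell K).measurableSet]
  by_cases hK : T.IsInterfaceElt S K
  · obtain ⟨a, b, F⟩ := hT.fictitious K hK
    refine measure_mono_null ?_ (F.volume_Γ_inter_cell hT.h_le)
    rintro p ⟨hp, hpK⟩
    rw [mem_ofPred_eq, not_not] at hp
    exact ⟨F.mem_Γ_of_mem_sides hT.h_le hK hp.2, hpK⟩
  · refine measure_mono_null (t := ∅) ?_ measure_empty
    rintro p ⟨hp, hpK⟩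
    rw [mem_ofPred_eq, not_not] at hp
    exact hK hp.1

theorem Mesh.Admissible.ae_edge_notMem_ridge (hT : T.Admissible S) (B : T.Edge) (K : T.Elt)
    (h1 : ∀ t ∈ Icc B.lo B.hi, B.pt t ∈ T.cell K) (h2 : ∀ t, B.pt t ∉ interior (T.cell K)) :
    ∀ᵐ t ∂volume.restrict (Icc B.lo B.hi), B.pt t ∉ T.ridge S K := by
  by_cases hK : T.IsInterfaceElt S K
  · obtain ⟨a, b, F⟩ := hT.fictitious K hK
    filter_upwards [F.ae_edge_notMem_sides hT.h_le hK hT B h1 h2] with t ht h using ht h.2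
  · exact Filter.Eventually.of_forall fun t h => hK h.1

end Ridge

section Measurability

variable {T : Mesh Q} {S : Interface Q} {K : T.Elt} {v : Pt → ℝ} {Gm Gp : Pt → Pt}

theorem PiecewiseGrad.gradientWithin_eq_of_mem (P : PiecewiseGrad T S K v Gm Gp) {p : Pt}
    (hp : p ∈ T.cell K) (hr : p ∉ T.ridge S K) (hM : p ∈ T.sideM S K) :
    gradientWithin v (T.cell K) p = Gm p := by
  have := P.grad p hp hr
  rw [if_pos hM] at this
  exact gradientWithin_cell_eq hp this

theorem PiecewiseGrad.gradientWithin_eq_of_notMem (P : PiecewiseGrad T S K v Gm Gp) {p : Pt}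
    (hp : p ∈ T.cell K) (hr : p ∉ T.ridge S K) (hM : p ∉ T.sideM S K) :
    gradientWithin v (T.cell K) p = Gp p := by
  have := P.grad p hp hr
  rw [if_neg hM] at this
  exact gradientWithin_cell_eq hp this

theorem PiecewiseGrad.hasGradientWithinAt (P : PiecewiseGrad T S K v Gm Gp) {p : Pt}
    (hp : p ∈ T.cell K) (hr : p ∉ T.ridge S K) :
    HasGradientWithinAt v (gradientWithin v (T.cell K) p) (T.cell K) p :=
  (P.grad p hp hr).differentiableWithinAt.hasGradientWithinAt

/-- A map into an element along which the gradient of a piecewise function can be integrated. -/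
structure Traceable (T : Mesh Q) (S : Interface Q) (K : T.Elt) {X : Type*} [MeasurableSpace X]
    (μ : Measure X) (π : X → Pt) : Prop where
  meas : Measurable π
  mem : ∀ᵐ x ∂μ, π x ∈ T.cell K
  notMem : ∀ᵐ x ∂μ, π x ∉ T.ridge S K
  comp : ∀ {Y : Type} [NormedAddCommGroup Y] [SecondCountableTopology Y] (f : Pt → Y),
    ContinuousOn f (T.cell K) → AEStronglyMeasurable (fun x => f (π x)) μ

variable {X : Type*} [MeasurableSpace X] {μ : Measure X} {π : X → Pt}

theorem PiecewiseGrad.aestronglyMeasurable_grad (P : PiecewiseGrad T S K v Gm Gp)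
    (hπ : Traceable T S K μ π) :
    AEStronglyMeasurable (fun x => gradientWithin v (T.cell K) (π x)) μ := by
  classical
  have hM : MeasurableSet (π ⁻¹' T.sideM S K) := hπ.meas isClosed_closure.measurableSet
  refine (AEStronglyMeasurable.piecewise hM ((hπ.comp Gm P.contM).mono_measure
    Measure.restrict_le_self) ((hπ.comp Gp P.contP).mono_measure
    Measure.restrict_le_self)).congr ?_
  filter_upwards [hπ.mem, hπ.notMem] with x hx hr
  by_cases h : π x ∈ T.sideM S K
  · rw [piecewise_eq_of_mem (π ⁻¹' T.sideM S K) _ _ h, P.gradientWithin_eq_of_mem hx hr h]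
  · rw [piecewise_eq_of_notMem (π ⁻¹' T.sideM S K) _ _ h, P.gradientWithin_eq_of_notMem hx hr h]

theorem PiecewiseGrad.exists_grad_bound (P : PiecewiseGrad T S K v Gm Gp) :
    ∃ M, ∀ p ∈ T.cell K, p ∉ T.ridge S K → ‖gradientWithin v (T.cell K) p‖ ≤ M := by
  obtain ⟨M1, h1⟩ := (T.isCompact_cell K).exists_bound_of_continuousOn P.contM
  obtain ⟨M2, h2⟩ := (T.isCompact_cell K).exists_bound_of_continuousOn P.contP
  refine ⟨max M1 M2, fun p hp hr => ?_⟩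
  by_cases h : p ∈ T.sideM S K
  · rw [P.gradientWithin_eq_of_mem hp hr h]; exact (h1 p hp).trans (le_max_left _ _)
  · rw [P.gradientWithin_eq_of_notMem hp hr h]; exact (h2 p hp).trans (le_max_right _ _)

theorem Mesh.Admissible.traceable_cell (hT : T.Admissible S) (K : T.Elt) :
    Traceable T S K (volume.restrict (T.cell K)) id :=
  ⟨measurable_id, ae_restrict_mem (T.isClosed_cell K).measurableSet, hT.volume_ridge K,
    fun _ hf => hf.aestronglyMeasurable (T.isClosed_cell K).measurableSet⟩

theorem Mesh.Admissible.traceable_edge (hT : T.Admissible S) (B : T.Edge) (K : T.Elt)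
    (h1 : ∀ t ∈ Icc B.lo B.hi, B.pt t ∈ T.cell K) (h2 : ∀ t, B.pt t ∉ interior (T.cell K)) :
    Traceable T S K (volume.restrict (Icc B.lo B.hi)) B.pt := by
  refine ⟨B.continuous_pt.measurable, ?_, hT.ae_edge_notMem_ridge B K h1 h2, fun f hf => ?_⟩
  · filter_upwards [ae_restrict_mem measurableSet_Icc] with t ht using h1 t ht
  · exact (hf.comp B.continuous_pt.continuousOn h1).aestronglyMeasurable measurableSet_Icc

theorem measurable_coeff (T : Mesh Q) (S : Interface Q) (βm βp : ℝ) (K : T.Elt) :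
    Measurable (coeff T S βm βp K) :=
  Measurable.ite isClosed_closure.measurableSet measurable_const measurable_const

theorem abs_coeff_le (T : Mesh Q) (S : Interface Q) (βm βp : ℝ) (K : T.Elt) (p : Pt) :
    |coeff T S βm βp K p| ≤ max |βm| |βp| := by
  unfold coeff
  split_ifs
  exacts [le_max_left _ _, le_max_right _ _]

end Measurability

end

/-! ### Pointwise flux bounds by the energy of an element -/

section

variable {Q : Rect}

theorem integrableOn_norm_grad_sq {T : Mesh Q} {S : Interface Q} (hT : T.Admissible S) {K : T.Elt}
    {v : Pt → ℝ} {Gm Gp : Pt → Pt} (P : PiecewiseGrad T S K v Gm Gp) :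
    IntegrableOn (fun p => ‖gradientWithin v (T.cell K) p‖ ^ 2) (T.cell K) := by
  obtain ⟨M, hM⟩ := P.exists_grad_bound
  have hπ := hT.traceable_cell K
  have : IsFiniteMeasure (volume.restrict (T.cell K)) :=
    ⟨by simpa using (T.volume_cell_ne_top K).lt_top⟩
  refine Integrable.of_bound ((P.aestronglyMeasurable_grad hπ).norm.pow 2) (M ^ 2) ?_
  filter_upwards [hπ.mem, hπ.notMem] with p hp hr
  rw [Real.norm_of_nonneg (by positivity)]
  exact pow_le_pow_left₀ (norm_nonneg _) (hM p hp hr) 2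

/-- The curve is null, so the two sides share an area of at least `(c h) ^ 2`, and one of them has
half of it wherever the curve cuts. -/
theorem Mesh.IsFictitiousInterval.volume_side {T : Mesh Q} {S : Interface Q} {K : T.Elt} {a b c : ℝ}
    (F : T.IsFictitiousInterval S K a b) (hδ : T.h ≤ S.δ) (hc : 0 < c) (hq : T.QuasiUniform c) :
    ENNReal.ofReal (c ^ 2 / 2 * T.h ^ 2) ≤ volume (interior (T.cell K) ∩ S.Ωm) ∨
    ENNReal.ofReal (c ^ 2 / 2 * T.h ^ 2) ≤ volume (interior (T.cell K) ∩ S.Ωp) := by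
  by_contra! hcon
  have hh := T.h_pos
  have h1 : interior (T.cell K) ⊆ (interior (T.cell K) ∩ S.Ωm) ∪ (interior (T.cell K) ∩ S.Ωp)
      ∪ (S.Γ ∩ T.cell K) := by
    intro p hp
    by_cases hΓ : p ∈ S.Γ
    · exact Or.inr ⟨hΓ, interior_subset hp⟩
    · have : p ∈ S.Ωm ∪ S.Ωp := by
        rw [← S.split]; exact ⟨T.interior_cell_subset_dom K hp, hΓ⟩
      rcases this with h | h
      · exact Or.inl (Or.inl ⟨hp, h⟩)
      · exact Or.inl (Or.inr ⟨hp, h⟩)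
  have h2 : volume (interior (T.cell K)) ≤ volume (interior (T.cell K) ∩ S.Ωm)
      + volume (interior (T.cell K) ∩ S.Ωp) := by
    refine (measure_mono h1).trans ((measure_union_le _ _).trans ?_)
    rw [F.volume_Γ_inter_cell hδ, add_zero]
    exact measure_union_le _ _
  have h3 := h2.trans_lt (ENNReal.add_lt_add hcon.1 hcon.2)
  rw [T.volume_interior_cell, ← ENNReal.ofReal_add (by positivity) (by positivity)] at h3
  have h4 := (ENNReal.ofReal_lt_ofReal_iff (by positivity)).1 h3
  have h5 : c * T.h * (c * T.h) ≤ T.wx K * T.wy K :=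
    mul_le_mul (hq.1 K.1) (hq.2 K.2) (by positivity) (T.wx_pos K).le
  nlinarith

/-- On the reference rectangle the derivatives are at most `m` times the seminorm. Undoing the
scaling costs `1 / h` in the normal direction and `1 / (b - a) ≤ r / h` in the tangential one. -/
theorem Interface.exists_frenetGrad_le (S : Interface Q) (m : ℕ) {r : ℝ} (hr : 0 < r) :
    ∃ C : ℝ, 0 < C ∧ ∀ (h a b : ℝ) (c : Coef m), 0 < h → h ≤ S.δ → a < b → h ≤ r * (b - a) →
      Icc a b ⊆ S.params → ∀ z ∈ Icc (-h) h ×ˢ Icc a b,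
        ‖frenetGrad S.g c z‖ ^ 2 ≤ C / h ^ 2 * seminorm (rescale h a (b - a) c) ^ 2 := by
  obtain ⟨l, L, hl, hL, hd⟩ := S.exists_deriv_bounds
  obtain ⟨j, J, hj, hJ, hjac⟩ := S.exists_jacobian_bounds
  refine ⟨((m : ℝ) ^ 2 + 1) * (1 + (r / (j * l)) ^ 2), by positivity,
    fun h a b c hh hδ hab hrab hI z hz => ?_⟩
  have hl0 : 0 < b - a := sub_pos.2 hab
  have hξ := hI hz.2
  have hs : |z.1 / h| ≤ 1 := by
    rw [abs_div, abs_of_pos hh, div_le_one hh]; exact abs_le.2 hz.1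
  have ht : |(z.2 - a) / (b - a)| ≤ 1 := by
    rw [abs_div, abs_of_pos hl0, div_le_one hl0, abs_of_nonneg (by linarith [hz.2.1])]
    linarith [hz.2.2]
  obtain ⟨e1, e2⟩ := dS_dT_affine (d := rescale h a (b - a) c) (c := c) (x := 0) (k := h) (a := a)
    (l := b - a) (fun s t => by rw [qEval_rescale, zero_add]) (z.1 / h) ((z.2 - a) / (b - a))
  have b1 := abs_dS_le (rescale h a (b - a) c) hs ht
  have b2 := abs_dT_le (rescale h a (b - a) c) hs ht
  have e3 : 0 + h * (z.1 / h) = z.1 := by field_simp; ring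
  have e4 : a + (b - a) * ((z.2 - a) / (b - a)) = z.2 := by field_simp; ring
  rw [e3, e4] at e1 e2
  rw [e1, abs_mul, abs_of_pos hh] at b1
  rw [e2, abs_mul, abs_of_pos hl0] at b2
  set N := seminorm (rescale h a (b - a) c)
  have hN : 0 ≤ N := seminorm_nonneg _
  obtain ⟨hj1, -⟩ := hjac z.2 hξ z.1 ⟨by linarith [hz.1.1], hz.1.2.trans hδ⟩
  obtain ⟨hl1, -⟩ := hd z.2 hξ
  have hj0 : 0 < 1 + z.1 * curvature S.g z.2 := hj.trans_le hj1
  rw [norm_frenetGrad_sq c (S.regular _ hξ), ← sq_abs (dS m c z.1 z.2),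
    ← sq_abs (dT m c z.1 z.2 / _), abs_div, abs_mul, abs_of_pos (hj.trans_le hj1), abs_norm]
  have c1 : |dS m c z.1 z.2| ≤ m * N / h := by rw [le_div_iff₀ hh]; linarith
  have c2 : |dT m c z.1 z.2| ≤ m * N * (r / h) := by
    have : |dT m c z.1 z.2| * h ≤ m * N * r := by
      calc _ ≤ |dT m c z.1 z.2| * (r * (b - a)) := by gcongr
        _ = (b - a) * |dT m c z.1 z.2| * r := by ring
        _ ≤ _ := by gcongr
    rw [mul_div_assoc', le_div_iff₀ hh]; exact this
  have c3 : |dT m c z.1 z.2| / ((1 + z.1 * curvature S.g z.2) * ‖deriv S.g z.2‖)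
      ≤ m * N * (r / h) / (j * l) := by gcongr
  calc _ ≤ (m * N / h) ^ 2 + (m * N * (r / h) / (j * l)) ^ 2 := by gcongr
    _ = (m : ℝ) ^ 2 * (1 + (r / (j * l)) ^ 2) / h ^ 2 * N ^ 2 := by field_simp
    _ ≤ _ := by gcongr; linarith

/-- The Remez type estimate for the Frenet map in scaled coordinates. The bound `b - a ≤ C h` makes
this map Lipschitz with a constant of order `h`. The density `w` has to be the squared gradient on
`E` only, so `E` can be one side of the interface. -/
theorem Interface.exists_seminorm_le (S : Interface Q) (m : ℕ) {c : ℝ} (hc : 0 < c) :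
    ∃ k : ℝ, 0 < k ∧ ∀ (T : Mesh Q) (K : T.Elt) (a b : ℝ) (e : Coef m) (E : Set Pt) (w : Pt → ℝ),
      T.h ≤ S.δ → T.QuasiUniform c → T.IsInterfaceElt S K → T.IsFictitiousInterval S K a b →
      a < b → E ⊆ T.cell K →
      MeasurableSet E → ENNReal.ofReal (c ^ 2 / 2 * T.h ^ 2) ≤ volume E → IntegrableOn w (T.cell K) →
      (∀ p, 0 ≤ w p) →
      (∀ p ∈ E, w p = ‖frenetGrad S.g e (frenetInv S.g T.h a b p)‖ ^ 2) →
      k * seminorm (rescale T.h a (b - a) e) ^ 2 ≤ ∫ p in T.cell K, w p := by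
  obtain ⟨l, L, hl, hL, hd⟩ := S.exists_deriv_bounds
  obtain ⟨j, J, hj, hJ, hjac⟩ := S.exists_jacobian_bounds
  obtain ⟨C, hC, hlen⟩ := S.exists_length_le
  obtain ⟨Λ, hΛ, hlip⟩ := S.exists_frenet_lipschitz
  -- One constant for two purposes: the Lipschitz bound of the scaled Frenet map, and the comparison
  -- of the squared gradients in scaled and in Cartesian coordinates.
  set M : NNReal := Λ * (1 + C.toNNReal) + (1 + ((C * (J * L)) ^ 2).toNNReal) with hM
  obtain ⟨k, hk, H⟩ := exists_seminorm_sq_le_integral m M (θ := c ^ 2 / 2) (by positivity)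
  refine ⟨k, hk, fun T K a b e E w hδ hq hK F hab hEK hEm hEv hwi hw0 hwE => ?_⟩
  have hh := T.h_pos
  have hl0 : 0 < b - a := sub_pos.2 hab
  have hlC := hlen T K a b hδ hK F
  have hbox : ∀ z ∈ refRect, (T.h * z.1, a + (b - a) * z.2) ∈ Icc (-T.h) T.h ×ˢ Icc a b := by
    rintro z ⟨⟨h1, h2⟩, h3, h4⟩
    refine ⟨⟨?_, ?_⟩, ?_, ?_⟩ <;> simp only <;> nlinarith
  refine (H (fun z => frenet S.g (T.h * z.1, a + (b - a) * z.2)) T.h.toNNReal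
    (rescale T.h a (b - a) e) E w (Real.toNNReal_pos.2 hh) ?_ ?_ hEm ?_ ?_ (hwi.mono_set hEK)
    fun p _ => hw0 p).trans (setIntegral_mono_set hwi (Filter.Eventually.of_forall hw0)
      hEK.eventuallyLE)
  · have h1 : LipschitzOnWith ((1 + C.toNNReal) * T.h.toNNReal)
        (fun z : ℝ × ℝ => (T.h * z.1, a + (b - a) * z.2)) refRect := by
      refine LipschitzOnWith.of_dist_le_mul fun x _ y _ => ?_
      have hx : dist x.1 y.1 ≤ dist x y := le_max_left _ _
      have hy : dist x.2 y.2 ≤ dist x y := le_max_right _ _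
      rw [Real.dist_eq] at hx hy
      rw [Prod.dist_eq, NNReal.coe_mul, NNReal.coe_add, Real.coe_toNNReal _ hC.le,
        Real.coe_toNNReal _ hh.le, NNReal.coe_one]
      refine max_le ?_ ?_
      · rw [Real.dist_eq, ← mul_sub, abs_mul, abs_of_pos hh]
        calc _ ≤ T.h * dist x y := by gcongr
          _ ≤ _ := by
            gcongr
            nlinarith
      · rw [Real.dist_eq, add_sub_add_left_eq_sub, ← mul_sub, abs_mul, abs_of_pos hl0]
        calc _ ≤ (b - a) * dist x y := by gcongr
          _ ≤ _ := by
            gcongr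
            nlinarith
    have h2 := hlip.comp h1 fun z hz => F.subset_strip hδ (hbox z hz)
    refine h2.weaken ?_
    rw [hM, ← mul_assoc]
    gcongr
    exact le_self_add
  · intro p hp
    have hz := F.inv_mem (hEK hp)
    refine ⟨((frenetInv S.g T.h a b p).1 / T.h, ((frenetInv S.g T.h a b p).2 - a) / (b - a)),
      ⟨⟨?_, ?_⟩, ?_, ?_⟩, ?_⟩
    · rw [le_div_iff₀ hh]; linarith [hz.1.1]
    · rw [div_le_iff₀ hh]; linarith [hz.1.2]
    · exact div_nonneg (by linarith [hz.2.1]) hl0.le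
    · rw [div_le_iff₀ hl0]; linarith [hz.2.2]
    · have e1 : T.h * ((frenetInv S.g T.h a b p).1 / T.h) = (frenetInv S.g T.h a b p).1 := by
        field_simp
      have e2 : a + (b - a) * (((frenetInv S.g T.h a b p).2 - a) / (b - a))
          = (frenetInv S.g T.h a b p).2 := by field_simp; ring
      simp only [e1, e2]
      exact F.frenet_inv (hEK hp)
  · rwa [Real.coe_toNNReal _ hh.le]
  · intro z hz hzE
    have hzb := hbox z hz
    rw [hwE _ hzE, F.inv_frenet hzb, norm_frenetGrad_sq e (S.regular _ (F.1 hzb.2))]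
    obtain ⟨e1, e2⟩ := dS_dT_affine (d := rescale T.h a (b - a) e) (c := e) (x := 0) (k := T.h)
      (a := a) (l := b - a) (fun s t => by rw [qEval_rescale, zero_add]) z.1 z.2
    rw [zero_add] at e1 e2
    rw [gradSq, e1, e2, Real.coe_toNNReal _ hh.le]
    set A := dS m e (T.h * z.1) (a + (b - a) * z.2)
    set B := dT m e (T.h * z.1) (a + (b - a) * z.2)
    obtain ⟨hj1, hj2⟩ := hjac _ (F.1 hzb.2) _ (F.subset_strip hδ hzb).1
    obtain ⟨hl1, hl2⟩ := hd _ (F.1 hzb.2)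
    simp only at hj1 hj2 hl1 hl2 ⊢
    set D := (1 + T.h * z.1 * curvature S.g (a + (b - a) * z.2)) *
      ‖deriv S.g (a + (b - a) * z.2)‖ with hD
    have hD0 : 0 < D := mul_pos (hj.trans_le hj1) (hl.trans_le hl1)
    have hDle : D ≤ J * L := mul_le_mul hj2 hl2 (norm_nonneg _) hJ.le
    have hMr : (M : ℝ) = Λ * (1 + C) + (1 + (C * (J * L)) ^ 2) := by
      rw [hM]; push_cast
      rw [Real.coe_toNNReal _ hC.le, Real.coe_toNNReal _ (by positivity)]
    have hΛ' : (0 : ℝ) < Λ := hΛ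
    have hM1 : 1 ≤ (M : ℝ) := by rw [hMr]; nlinarith [mul_pos hΛ' (by linarith : 0 < 1 + C)]
    have hM2 : (C * (J * L)) ^ 2 ≤ (M : ℝ) := by
      rw [hMr]; nlinarith [mul_pos hΛ' (by linarith : 0 < 1 + C)]
    have t1 : (T.h * A) ^ 2 ≤ M * T.h ^ 2 * A ^ 2 := by
      rw [mul_pow]
      gcongr
      nlinarith [sq_nonneg T.h]
    have t2 : ((b - a) * B) ^ 2 ≤ M * T.h ^ 2 * (B / D) ^ 2 := by
      have : (b - a) * B = ((b - a) * D) * (B / D) := by field_simp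
      rw [this, mul_pow]
      gcongr
      calc ((b - a) * D) ^ 2 ≤ (C * T.h * (J * L)) ^ 2 := by gcongr
        _ = (C * (J * L)) ^ 2 * T.h ^ 2 := by ring
        _ ≤ _ := by gcongr
    linarith

/-- The decisive estimate, insensitive to the cut and to the ratio of the coefficients. The energy
bounds the seminorm on the larger side, the interface conditions bound the fluxes of both sides by
it, and `exists_frenetGrad_le` returns to pointwise values. -/
theorem Interface.exists_flux_bound_immersed (S : Interface Q) {m : ℕ} (hm : 1 ≤ m)
    (h3 : 3 ≤ m → ContDiff ℝ 3 S.g) {c : ℝ} (hc : 0 < c) :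
    ∃ C : ℝ, 0 < C ∧ ∀ (T : Mesh Q) (K : T.Elt) (βm βp : ℝ) (v : Pt → ℝ), T.Admissible S →
      T.QuasiUniform c → T.IsInterfaceElt S K → 0 < βm → βm ≤ βp → IsLocalIFE T S m βm βp K v →
      ∃ Gm Gp, PiecewiseGrad T S K v Gm Gp ∧ ∀ p ∈ T.cell K,
        (βm * ‖Gm p‖) ^ 2 ≤ C * βp ^ 2 / T.h ^ 2 *
          ∫ q in T.cell K, ‖gradientWithin v (T.cell K) q‖ ^ 2 ∧
        (βp * ‖Gp p‖) ^ 2 ≤ C * βp ^ 2 / T.h ^ 2 *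
          ∫ q in T.cell K, ‖gradientWithin v (T.cell K) q‖ ^ 2 := by
  obtain ⟨r, hr, hlen⟩ := S.exists_le_length hc
  obtain ⟨C1, hC1, hup⟩ := S.exists_frenetGrad_le m hr
  obtain ⟨k, hk, hlow⟩ := S.exists_seminorm_le m hc
  obtain ⟨C2, hC2, htr⟩ := S.exists_transfer hm h3 hr
  refine ⟨C1 * (1 + C2) ^ 2 / k, by positivity, fun T K βm βp v hT hq hK hβm hβ hv => ?_⟩
  obtain ⟨a, b, F⟩ := hT.fictitious K hK
  have hδ := hT.h_le
  have hh := T.h_pos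
  have hrl := hlen T K a b hδ hq F
  have hab : a < b := by
    by_contra! h
    nlinarith
  obtain ⟨cm, cp, H, hval⟩ := hv a b F
  have P := piecewiseGrad_of_localIFE F hδ hK hab H hval
  refine ⟨_, _, P, ?_⟩
  have hβp : 0 < βp := hβm.trans_le hβ
  have hwi := integrableOn_norm_grad_sq hT P
  obtain ⟨t1, t2⟩ := htr T.h a b βm βp cm cp hh hδ hab F.1 hrl hβm hβ H
  set E := ∫ q in T.cell K, ‖gradientWithin v (T.cell K) q‖ ^ 2 with hE
  set Nm := seminorm (rescale T.h a (b - a) cm)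
  set Np := seminorm (rescale T.h a (b - a) cp)
  have hNm : 0 ≤ Nm := seminorm_nonneg _
  have hNp : 0 ≤ Np := seminorm_nonneg _
  -- `N` is the seminorm of the piece on a side with at least the guaranteed area; the transfer
  -- inequality covers the opposite side.
  have key : ∃ N, 0 ≤ N ∧ k * N ^ 2 ≤ E ∧ βm * Nm ≤ (1 + C2) * βp * N ∧
      βp * Np ≤ (1 + C2) * βp * N := by
    have hI : ∀ p ∈ interior (T.cell K), p ∈ S.Ωm ∪ S.Ωp → p ∉ T.ridge S K := by
      intro p hp h hr
      have := F.mem_Γ_of_mem_sides hδ hK hr.2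
      rw [← S.split] at h
      exact h.2 this
    rcases F.volume_side hδ hc hq with h | h
    · refine ⟨Nm, hNm, hlow T K a b cm _ _ hδ hq hK F hab ?_ ?_ h hwi (fun p => sq_nonneg _) ?_,
        ?_, ?_⟩
      · exact fun p hp => interior_subset hp.1
      · exact (isOpen_interior.inter S.isOpen_Ωm).measurableSet
      · rintro p ⟨hp, hpm⟩
        rw [P.gradientWithin_eq_of_mem (interior_subset hp) (hI p hp (Or.inl hpm))
          (subset_closure ⟨hp, hpm⟩)]
      · nlinarith [mul_le_mul_of_nonneg_right hβ hNm, mul_nonneg (mul_pos hC2 hβp).le hNm]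
      · nlinarith [mul_nonneg hβp.le hNm]
    · refine ⟨Np, hNp, hlow T K a b cp _ _ hδ hq hK F hab ?_ ?_ h hwi (fun p => sq_nonneg _) ?_,
        ?_, ?_⟩
      · exact fun p hp => interior_subset hp.1
      · exact (isOpen_interior.inter S.isOpen_Ωp).measurableSet
      · rintro p ⟨hp, hpp⟩
        rw [P.gradientWithin_eq_of_notMem (interior_subset hp) (hI p hp (Or.inr hpp))]
        intro hM
        exact ((F.mem_Ωm_iff hδ hK hp).2.1 hpp).not_ge (F.nonpos_of_mem_sideM hδ hK hM)
      · nlinarith [mul_nonneg hβp.le hNp]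
      · nlinarith [mul_nonneg (mul_pos hC2 hβp).le hNp]
  obtain ⟨N, hN, hkN, h1, h2⟩ := key
  have fin : ∀ (β n : ℝ) (G : Pt), 0 ≤ β → 0 ≤ n → ‖G‖ ^ 2 ≤ C1 / T.h ^ 2 * n ^ 2 →
      β * n ≤ (1 + C2) * βp * N →
      (β * ‖G‖) ^ 2 ≤ C1 * (1 + C2) ^ 2 / k * βp ^ 2 / T.h ^ 2 * E := by
    intro β n G hβ0 hn hG hle
    calc (β * ‖G‖) ^ 2 = β ^ 2 * ‖G‖ ^ 2 := by ring
      _ ≤ β ^ 2 * (C1 / T.h ^ 2 * n ^ 2) := by gcongr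
      _ = C1 / T.h ^ 2 * (β * n) ^ 2 := by ring
      _ ≤ C1 / T.h ^ 2 * ((1 + C2) * βp * N) ^ 2 := by gcongr
      _ = C1 * (1 + C2) ^ 2 / k * βp ^ 2 / T.h ^ 2 * (k * N ^ 2) := by field_simp
      _ ≤ _ := by gcongr
  intro p hp
  have hz := F.inv_mem hp
  exact ⟨fin βm Nm _ hβm.le hNm (hup T.h a b cm hh hδ hab hrl F.1 _ hz) h1,
    fin βp Np _ hβp.le hNp (hup T.h a b cp hh hδ hab hrl F.1 _ hz) h2⟩

/-! ### Polynomials on the other elements -/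

theorem hasGradientWithinAt_qEval {m : ℕ} (c : Coef m) (s : Set Pt) (p : Pt) :
    HasGradientWithinAt (fun q : Pt => qEval m c (q 0) (q 1))
      !₂[dS m c (p 0) (p 1), dT m c (p 0) (p 1)] s p := by
  have h0 : ∀ i : Fin 2, HasFDerivAt (fun q : Pt => q i)
      (PiLp.proj (𝕜 := ℝ) 2 (fun _ : Fin 2 => ℝ) i) p := fun i =>
    (PiLp.proj (𝕜 := ℝ) 2 (fun _ : Fin 2 => ℝ) i).hasFDerivAt
  have h1 := (h0 0).prodMk (h0 1)
  have h2 := (qEval_hasFDerivAt m c (p 0, p 1)).comp p h1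
  rw [hasGradientWithinAt_iff_hasFDerivWithinAt]
  refine (h2.congr_fderiv ?_).hasFDerivWithinAt
  ext q
  simp [inner_eq]

theorem piecewiseGrad_of_localPoly {T : Mesh Q} {S : Interface Q} {K : T.Elt} {m : ℕ} {c : Coef m}
    {v : Pt → ℝ} (hv : ∀ p ∈ T.cell K, v p = qEval m c (p 0) (p 1)) :
    PiecewiseGrad T S K v (fun p => !₂[dS m c (p 0) (p 1), dT m c (p 0) (p 1)])
      (fun p => !₂[dS m c (p 0) (p 1), dT m c (p 0) (p 1)]) := by
  have hcoord : Continuous fun p : Pt => (p 0, p 1) :=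
    (PiLp.continuous_apply 2 _ 0).prodMk (PiLp.continuous_apply 2 _ 1)
  have hS : Continuous fun p : Pt => dS m c (p 0) (p 1) :=
    (dS_continuous m).comp (continuous_const.prodMk hcoord)
  have hTc : Continuous fun p : Pt => dT m c (p 0) (p 1) :=
    (dT_continuous m).comp (continuous_const.prodMk hcoord)
  have hG : Continuous fun p : Pt => (!₂[dS m c (p 0) (p 1), dT m c (p 0) (p 1)] : Pt) := by
    refine (PiLp.continuous_toLp 2 _).comp (continuous_pi fun i => ?_)
    fin_cases i
    exacts [hS, hTc]
  have hd : ∀ p ∈ T.cell K, HasGradientWithinAt v !₂[dS m c (p 0) (p 1), dT m c (p 0) (p 1)]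
      (T.cell K) p := fun p hp =>
    (hasGradientWithinAt_qEval c _ p).congr_of_mem hv hp
  refine ⟨?_, hG.continuousOn, hG.continuousOn, ?_, ?_⟩
  · exact ((qEval_continuous m c).comp hcoord).continuousOn.congr hv
  · intro p hp _
    rw [ite_self]
    exact hd p hp
  · intro h0 _ p hp q hq
    exact eq_of_gradientWithin_eq_zero (fun p hp => h0 p hp ▸ hd p hp) hp hq

/-- The same bound without an interface: the Remez type estimate is applied to the whole element,
both fields are the ordinary gradient, and both coefficients are at most `βp`. -/
theorem exists_flux_bound_poly (Q : Rect) (m : ℕ) {c : ℝ} (hc : 0 < c) :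
    ∃ C : ℝ, 0 < C ∧ ∀ (S : Interface Q) (T : Mesh Q) (K : T.Elt) (βm βp : ℝ) (v : Pt → ℝ),
      T.Admissible S →
      T.QuasiUniform c → 0 < βm → βm ≤ βp → IsLocalPoly T m K v →
      ∃ Gm Gp, PiecewiseGrad T S K v Gm Gp ∧ ∀ p ∈ T.cell K,
        (βm * ‖Gm p‖) ^ 2 ≤ C * βp ^ 2 / T.h ^ 2 *
          ∫ q in T.cell K, ‖gradientWithin v (T.cell K) q‖ ^ 2 ∧
        (βp * ‖Gp p‖) ^ 2 ≤ C * βp ^ 2 / T.h ^ 2 *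
          ∫ q in T.cell K, ‖gradientWithin v (T.cell K) q‖ ^ 2 := by
  obtain ⟨k, hk, H⟩ := exists_seminorm_sq_le_integral m 2 (θ := c ^ 2) (by positivity)
  refine ⟨5 * (m ^ 2 + 1) / (c ^ 2 * k), by positivity,
    fun S T K βm βp v hT hq hβm hβ ⟨e, hv⟩ => ?_⟩
  have P := piecewiseGrad_of_localPoly (S := S) hv
  refine ⟨_, _, P, ?_⟩
  have hh := T.h_pos
  have hwx := T.wx_pos K
  have hwy := T.wy_pos K
  have hwi := integrableOn_norm_grad_sq hT P
  have hgr : ∀ p ∈ T.cell K, gradientWithin v (T.cell K) p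
      = !₂[dS m e (p 0) (p 1), dT m e (p 0) (p 1)] := fun p hp => gradientWithin_cell_eq hp
    ((hasGradientWithinAt_qEval e _ p).congr_of_mem hv hp)
  have hnorm : ∀ x y : ℝ, ‖(!₂[x, y] : Pt)‖ ^ 2 = x ^ 2 + y ^ 2 := fun x y => by
    rw [norm_sq_eq]; simp
  set x0 := T.x K.1.castSucc with hx0
  set y0 := T.y K.2.castSucc with hy0
  have hx1 : T.x K.1.succ = x0 + T.wx K := by rw [Mesh.wx]; ring
  have hy1 : T.y K.2.succ = y0 + T.wy K := by rw [Mesh.wy]; ring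
  -- The reference rectangle is `[-1, 1] × [0, 1]`, so the horizontal variable is centred at the
  -- midpoint and scaled by half the width.
  set X := T.wx K / 2 with hX
  obtain ⟨d, hd⟩ := exists_qEval_affine e (x0 + X) X y0 (T.wy K)
  have hdS := dS_dT_affine hd
  set E := ∫ q in T.cell K, ‖gradientWithin v (T.cell K) q‖ ^ 2 with hE
  have hX0 : 0 < X := by positivity
  have hXh : X ≤ T.h := by have := T.wx_le_h K; linarith
  have hpt : ∀ p ∈ T.cell K, ∃ s t, |s| ≤ 1 ∧ |t| ≤ 1 ∧ 0 ≤ t ∧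
      p 0 = x0 + X + X * s ∧ p 1 = y0 + T.wy K * t := by
    rintro p ⟨⟨h1, h2⟩, h3, h4⟩
    rw [hx1] at h2
    rw [hy1] at h4
    refine ⟨(p 0 - x0 - X) / X, (p 1 - y0) / T.wy K, ?_, ?_, ?_, ?_, ?_⟩
    · rw [abs_le, le_div_iff₀ hX0, div_le_iff₀ hX0]; constructor <;> linarith
    · rw [abs_le, le_div_iff₀ hwy, div_le_iff₀ hwy]; constructor <;> linarith
    · exact div_nonneg (by linarith) hwy.le
    · field_simp; ring
    · field_simp; ring
  have hlow : k * seminorm d ^ 2 ≤ E := by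
    refine H (fun z => !₂[x0 + X + X * z.1, y0 + T.wy K * z.2]) T.h.toNNReal d (T.cell K) _
      (Real.toNNReal_pos.2 hh) ?_ ?_ (T.isClosed_cell K).measurableSet ?_ ?_ hwi
      fun p _ => sq_nonneg _
    · refine LipschitzOnWith.of_dist_le_mul fun x _ y _ => ?_
      have hx : dist x.1 y.1 ≤ dist x y := le_max_left _ _
      have hy : dist x.2 y.2 ≤ dist x y := le_max_right _ _
      rw [Real.dist_eq] at hx hy
      rw [NNReal.coe_mul, Real.coe_toNNReal _ hh.le, dist_eq_norm]
      refine abs_le_of_sq_le_sq' ?_ (by positivity) |>.2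
      rw [norm_sq_eq]
      have e0 : ((!₂[x0 + X + X * x.1, y0 + T.wy K * x.2] : Pt)
          - !₂[x0 + X + X * y.1, y0 + T.wy K * y.2]) 0 = X * (x.1 - y.1) := by simp; ring
      have e1 : ((!₂[x0 + X + X * x.1, y0 + T.wy K * x.2] : Pt)
          - !₂[x0 + X + X * y.1, y0 + T.wy K * y.2]) 1 = T.wy K * (x.2 - y.2) := by simp; ring
      rw [e0, e1, mul_pow, mul_pow, ← sq_abs (x.1 - y.1), ← sq_abs (x.2 - y.2)]
      calc _ ≤ T.h ^ 2 * dist x y ^ 2 + T.h ^ 2 * dist x y ^ 2 := by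
            have := T.wy_le_h K
            gcongr
        _ ≤ _ := by
          push_cast
          nlinarith [sq_nonneg (T.h * dist x y)]
    · intro p hp
      obtain ⟨s, t, hs, ht, ht0, h1, h2⟩ := hpt p hp
      refine ⟨(s, t), ⟨abs_le.1 hs, ht0, (abs_le.1 ht).2⟩, ?_⟩
      ext i
      fin_cases i
      · simp [h1]
      · simp [h2]
    · rw [T.volume_cell, Real.coe_toNNReal _ hh.le]
      refine ENNReal.ofReal_le_ofReal ?_
      calc c ^ 2 * T.h ^ 2 = c * T.h * (c * T.h) := by ring
        _ ≤ _ := mul_le_mul (hq.1 K.1) (hq.2 K.2) (by positivity) hwx.le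
    · intro z _ hz
      rw [hgr _ hz, hnorm, gradSq, (hdS _ _).1, (hdS _ _).2, Real.coe_toNNReal _ hh.le]
      simp only [Matrix.cons_val_zero, Matrix.cons_val_one]
      rw [mul_pow, mul_pow, mul_add]
      have h2 : ((2 : NNReal) : ℝ) = 2 := rfl
      rw [h2]
      have hw := T.wy_le_h K
      gcongr
      · nlinarith
      · nlinarith
  set N := seminorm d
  have hN : 0 ≤ N := seminorm_nonneg _
  have hchk : c * T.h ≤ T.wx K := hq.1 K.1
  have hchk' : c * T.h ≤ T.wy K := hq.2 K.2
  have hch : 0 < c * T.h := by positivity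
  have main : ∀ p ∈ T.cell K, ∀ β, 0 ≤ β → β ≤ βp →
      (β * ‖(!₂[dS m e (p 0) (p 1), dT m e (p 0) (p 1)] : Pt)‖) ^ 2
        ≤ 5 * (m ^ 2 + 1) / (c ^ 2 * k) * βp ^ 2 / T.h ^ 2 * E := by
    intro p hp β hβ0 hββ
    obtain ⟨s, t, hs, ht, -, h1, h2⟩ := hpt p hp
    have b1 := abs_dS_le d hs ht
    have b2 := abs_dT_le d hs ht
    rw [(hdS s t).1, ← h1, ← h2, abs_mul, abs_of_pos hX0] at b1
    rw [(hdS s t).2, ← h1, ← h2, abs_mul, abs_of_pos hwy] at b2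
    set A := dS m e (p 0) (p 1)
    set B := dT m e (p 0) (p 1)
    have c1 : |A| ≤ 2 * (m * N / (c * T.h)) := by
      rw [mul_div_assoc', le_div_iff₀ hch]
      have := mul_le_mul_of_nonneg_left hchk (abs_nonneg A)
      have e : |A| * T.wx K = 2 * (X * |A|) := by rw [hX]; ring
      linarith
    have c2 : |B| ≤ m * N / (c * T.h) := by
      rw [le_div_iff₀ hch]
      nlinarith [mul_le_mul_of_nonneg_left hchk' (abs_nonneg B)]
    rw [mul_pow, hnorm, ← sq_abs A, ← sq_abs B]
    calc β ^ 2 * (|A| ^ 2 + |B| ^ 2)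
        ≤ βp ^ 2 * ((2 * (m * N / (c * T.h))) ^ 2 + (m * N / (c * T.h)) ^ 2) := by gcongr
      _ = 5 * m ^ 2 / (c ^ 2 * k) * βp ^ 2 / T.h ^ 2 * (k * N ^ 2) := by field_simp; ring
      _ ≤ _ := by gcongr; linarith
  intro p hp
  exact ⟨main p hp βm hβm.le hβ, main p hp βp (hβm.le.trans hβ) le_rfl⟩

theorem Interface.exists_flux_bound (S : Interface Q) {m : ℕ} (hm : 1 ≤ m)
    (h3 : 3 ≤ m → ContDiff ℝ 3 S.g) {c : ℝ} (hc : 0 < c) :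
    ∃ C : ℝ, 0 < C ∧ ∀ (T : Mesh Q) (βm βp : ℝ) (v : T.Elt → Pt → ℝ), T.Admissible S →
      T.QuasiUniform c → 0 < βm → βm ≤ βp → IsHIFE T S m βm βp v → ∀ K : T.Elt,
      ∃ Gm Gp, PiecewiseGrad T S K (v K) Gm Gp ∧ ∀ p ∈ T.cell K,
        (βm * ‖Gm p‖) ^ 2 ≤ C * βp ^ 2 / T.h ^ 2 * ∫ q in T.cell K, ‖grad T K v q‖ ^ 2 ∧
        (βp * ‖Gp p‖) ^ 2 ≤ C * βp ^ 2 / T.h ^ 2 * ∫ q in T.cell K, ‖grad T K v q‖ ^ 2 := by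
  obtain ⟨C1, hC1, H1⟩ := S.exists_flux_bound_immersed hm h3 hc
  obtain ⟨C2, hC2, H2⟩ := exists_flux_bound_poly Q m hc
  have mono : ∀ {x C C' β h E : ℝ}, 0 ≤ E → C ≤ C' → x ≤ C * β ^ 2 / h ^ 2 * E →
      x ≤ C' * β ^ 2 / h ^ 2 * E := fun hE hC h => h.trans (by gcongr)
  refine ⟨C1 + C2, by positivity, fun T βm βp v hT hq hβm hβ hv K => ?_⟩
  have hE : 0 ≤ ∫ q in T.cell K, ‖grad T K v q‖ ^ 2 := integral_nonneg fun _ => sq_nonneg _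
  by_cases hK : T.IsInterfaceElt S K
  · obtain ⟨Gm, Gp, P, h⟩ := H1 T K βm βp (v K) hT hq hK hβm hβ (hv.immersed K hK)
    exact ⟨Gm, Gp, P, fun p hp => ⟨mono hE (by linarith) (h p hp).1, mono hE (by linarith) (h p hp).2⟩⟩
  · obtain ⟨Gm, Gp, P, h⟩ := H2 S T K βm βp (v K) hT hq hβm hβ (hv.nonInterface K hK)
    exact ⟨Gm, Gp, P, fun p hp => ⟨mono hE (by linarith) (h p hp).1, mono hE (by linarith) (h p hp).2⟩⟩

end

section

variable {Q : Rect}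

/-! ### The immersed finite element space is a vector space -/

theorem integral_linear_mul {a b : ℝ} {F G : ℝ → ℝ} (q : Polynomial ℝ)
    (hF : ContinuousOn F (uIcc a b)) (hG : ContinuousOn G (uIcc a b)) (x y : ℝ) :
    ∫ ξ in a..b, (x * F ξ + y * G ξ) * q.eval ξ
      = x * (∫ ξ in a..b, F ξ * q.eval ξ) + y * ∫ ξ in a..b, G ξ * q.eval ξ := by
  have h1 : IntervalIntegrable (fun ξ => F ξ * q.eval ξ) volume a b :=
    (hF.mul q.continuous.continuousOn).intervalIntegrable
  have h2 : IntervalIntegrable (fun ξ => G ξ * q.eval ξ) volume a b :=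
    (hG.mul q.continuous.continuousOn).intervalIntegrable
  rw [← intervalIntegral.integral_const_mul, ← intervalIntegral.integral_const_mul,
    ← intervalIntegral.integral_add (h1.const_mul x) (h2.const_mul y)]
  congr 1; ext ξ; ring

/-- The conditions are integrals, and splitting them requires integrability; the normal derivatives
of the Laplacian are continuous along the curve thanks to their expansion. -/
theorem JumpConditions.linear {S : Interface Q} {m : ℕ} (hm : 1 ≤ m)
    (h3 : 3 ≤ m → ContDiff ℝ 3 S.g) {βm βp a b : ℝ} (hab : a ≤ b) (hI : Icc a b ⊆ S.params)
    {cm cp dm dp : Coef m} (Hc : JumpConditions S.g m βm βp a b cm cp)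
    (Hd : JumpConditions S.g m βm βp a b dm dp) (x y : ℝ) :
    JumpConditions S.g m βm βp a b (x • cm + y • dm) (x • cp + y • dp) := by
  have hu : uIcc a b = Icc a b := uIcc_of_le hab
  have hz : ∀ c : Coef m, Continuous fun ξ => qEval m c 0 ξ := fun c =>
    (qEval_continuous m c).comp (continuous_const.prodMk continuous_id)
  refine ⟨fun q hq => ?_, fun q hq => ?_, fun j hj q hq => ?_⟩
  · have := integral_linear_mul (a := a) (b := b) (F := fun ξ => qEval m cp 0 ξ - qEval m cm 0 ξ)
      (G := fun ξ => qEval m dp 0 ξ - qEval m dm 0 ξ) q ((hz cp).sub (hz cm)).continuousOn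
      ((hz dp).sub (hz dm)).continuousOn x y
    rw [Hc.value q hq, Hd.value q hq, mul_zero, mul_zero, add_zero] at this
    refine Eq.trans ?_ this
    congr 1; ext ξ
    simp only [qEval_add, qEval_smul]
    ring
  · have hf : ∀ c d : Coef m, Continuous fun ξ => βp * deriv (fun η => qEval m c η ξ) 0
        - βm * deriv (fun η => qEval m d η ξ) 0 := fun c d => by
      simp only [deriv_qEval_zero_left hm]
      exact ((Polynomial.continuous _).const_mul _).sub ((Polynomial.continuous _).const_mul _)
    have := integral_linear_mul (a := a) (b := b) q (hf cp cm).continuousOn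
      (hf dp dm).continuousOn x y
    rw [Hc.flux q hq, Hd.flux q hq, mul_zero, mul_zero, add_zero] at this
    refine Eq.trans ?_ this
    congr 1; ext ξ
    simp only [deriv_qEval_zero_left hm, row_add, row_smul, Polynomial.eval_add,
      Polynomial.eval_mul, Polynomial.eval_C]
    ring
  · have hl : ∀ c d : Coef m, ContinuousOn (fun ξ => βp * lapDeriv S.g j c ξ
        - βm * lapDeriv S.g j d ξ) (uIcc a b) := fun c d => by
      rw [hu]
      exact (((S.lapDeriv_continuousOn h3 hj c).mono hI).const_mul _ |>.sub
        (((S.lapDeriv_continuousOn h3 hj d).mono hI).const_mul _))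
    have := integral_linear_mul q (hl cp cm) (hl dp dm) x y
    have e1 := Hc.laplacian j hj q hq
    have e2 := Hd.laplacian j hj q hq
    simp only [lapDeriv] at this
    rw [e1, e2, mul_zero, mul_zero, add_zero] at this
    refine Eq.trans ?_ this
    refine intervalIntegral.integral_congr fun ξ hξ => ?_
    rw [hu] at hξ
    have l1 := S.lapDeriv_linear h3 hj x y cp dp (hI hξ)
    have l2 := S.lapDeriv_linear h3 hj x y cm dm (hI hξ)
    simp only [lapDeriv] at l1 l2
    rw [l1, l2]
    ring

theorem JumpConditions.zero {S : Interface Q} {m : ℕ} (hm : 1 ≤ m)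
    (h3 : 3 ≤ m → ContDiff ℝ 3 S.g) {βm βp a b : ℝ} (hab : a ≤ b) (hI : Icc a b ⊆ S.params) :
    JumpConditions S.g m βm βp a b 0 0 := by
  have hr : ∀ i, row (0 : Coef m) i = 0 := fun i => by simp [row]
  refine ⟨fun q hq => ?_, fun q hq => ?_, fun j hj q hq => ?_⟩
  · simp [qEval]
  · simp [deriv_qEval_zero_left hm, hr]
  · refine (intervalIntegral.integral_congr (g := fun _ => (0 : ℝ)) fun ξ hξ => ?_).trans
      intervalIntegral.integral_zero
    rw [uIcc_of_le hab] at hξ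
    have l1 := S.lapDeriv_linear h3 hj 0 0 (0 : Coef m) 0 (hI hξ)
    simp only [lapDeriv, smul_zero, add_zero, zero_mul] at l1
    simp only [l1, mul_zero, sub_zero, zero_mul]

theorem iterate_partialDeriv_smooth (k : Fin 2) (n : ℕ) {φ : Pt → ℝ} (h1 : ContDiff ℝ ∞ φ)
    (h2 : HasCompactSupport φ) :
    ContDiff ℝ ∞ ((partialDeriv k)^[n] φ) ∧ HasCompactSupport ((partialDeriv k)^[n] φ) := by
  induction n with
  | zero => exact ⟨h1, h2⟩
  | succ n ih =>
    rw [Function.iterate_succ_apply']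
    set ψ := (partialDeriv k)^[n] φ
    have h : ContDiff ℝ ∞ (fderiv ℝ ψ) := ih.1.fderiv_right (by simp)
    have hc : HasCompactSupport ψ := ih.2
    refine ⟨?_, hc.fderiv_apply (𝕜 := ℝ) (EuclideanSpace.single k 1)⟩
    show ContDiff ℝ ∞ fun x => fderiv ℝ ψ x (EuclideanSpace.single k 1)
    exact h.clm_apply contDiff_const

theorem MemSobolev.linear {m : ℕ} {U : Set Pt} {u v : Pt → ℝ} (hu : MemSobolev m U u)
    (hv : MemSobolev m U v) (x y : ℝ) : MemSobolev m U (x • u + y • v) := by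
  refine ⟨(hu.1.const_smul x).add (hv.1.const_smul y), fun i j hij => ?_⟩
  obtain ⟨w1, hw1, H1⟩ := hu.2 i j hij
  obtain ⟨w2, hw2, H2⟩ := hv.2 i j hij
  refine ⟨x • w1 + y • w2, (hw1.const_smul x).add (hw2.const_smul y), fun φ h1 h2 h3 => ?_⟩
  have key : ∀ (D f g : Pt → ℝ), ContDiff ℝ ∞ D → HasCompactSupport D →
      MemLp f 2 (volume.restrict U) → MemLp g 2 (volume.restrict U) →
      ∫ p in U, (x • f + y • g) p * D p = x * (∫ p in U, f p * D p) + y * ∫ p in U, g p * D p := by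
    intro D f g hD1 hD2 hf hg
    have hD : MemLp D 2 (volume.restrict U) := hD1.continuous.memLp_of_hasCompactSupport hD2
    have i1 := (hf.integrable_mul hD).const_mul x
    have i2 := (hg.integrable_mul hD).const_mul y
    simp only [Pi.mul_apply] at i1 i2
    rw [← integral_const_mul, ← integral_const_mul, ← integral_add i1 i2]
    congr 1; ext p
    simp only [Pi.add_apply, Pi.smul_apply, smul_eq_mul]
    ring
  obtain ⟨d1, d2⟩ := iterate_partialDeriv_smooth 1 j h1 h2
  obtain ⟨d3, d4⟩ := iterate_partialDeriv_smooth 0 i d1 d2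
  rw [key _ _ _ d3 d4 hu.1 hv.1, key _ _ _ h1 h2 hw1 hw2, H1 φ h1 h2 h3, H2 φ h1 h2 h3]
  ring

theorem MemSobolev.zero (m : ℕ) (U : Set Pt) : MemSobolev m U 0 :=
  ⟨MemLp.zero, fun _ _ _ => ⟨0, MemLp.zero, fun _ _ _ _ => by simp⟩⟩

section Space

variable {T : Mesh Q} {S : Interface Q} {m : ℕ} {βm βp : ℝ}

theorem IsHIFE.linear (hm : 1 ≤ m) (h3 : 3 ≤ m → ContDiff ℝ 3 S.g) {u v : T.Elt → Pt → ℝ}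
    (hu : IsHIFE T S m βm βp u) (hv : IsHIFE T S m βm βp v) (x y : ℝ) :
    IsHIFE T S m βm βp (x • u + y • v) where
  support K p hp := by simp [hu.support K p hp, hv.support K p hp]
  nonInterface K hK := by
    obtain ⟨c, hc⟩ := hu.nonInterface K hK
    obtain ⟨d, hd⟩ := hv.nonInterface K hK
    exact ⟨x • c + y • d, fun p hp => by simp [qEval_add, qEval_smul, hc p hp, hd p hp]⟩
  immersed K hK a b F := by
    obtain ⟨cm, cp, Hc, hc⟩ := hu.immersed K hK a b F
    obtain ⟨dm, dp, Hd, hd⟩ := hv.immersed K hK a b F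
    refine ⟨_, _, Hc.linear hm h3 F.le F.1 Hd x y, fun η hη ξ hξ hp => ?_⟩
    have e1 := hc η hη ξ hξ hp
    have e2 := hd η hη ξ hξ hp
    simp only [Pi.add_apply, Pi.smul_apply, smul_eq_mul, e1, e2, qEval_add, qEval_smul]
    split_ifs <;> rfl
  sobolev K hK := ⟨(hu.sobolev K hK).1.linear (hv.sobolev K hK).1 x y,
    (hu.sobolev K hK).2.linear (hv.sobolev K hK).2 x y⟩
  continuous B hB p hp := by simp [hu.continuous B hB p hp, hv.continuous B hB p hp]
  boundary K p hp hf := by simp [hu.boundary K p hp hf, hv.boundary K p hp hf]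

theorem IsHIFE.zero (hm : 1 ≤ m) (h3 : 3 ≤ m → ContDiff ℝ 3 S.g) : IsHIFE T S m βm βp 0 where
  support K p hp := rfl
  nonInterface K hK := ⟨0, fun p hp => by simp [qEval]⟩
  immersed K hK a b F := ⟨0, 0, JumpConditions.zero hm h3 F.le F.1, fun η hη ξ hξ hp => by
    simp [qEval]⟩
  sobolev K hK := ⟨MemSobolev.zero _ _, MemSobolev.zero _ _⟩
  continuous B hB p hp := rfl
  boundary K p hp hf := rfl

/-- The hybrid immersed finite element space as a vector space. -/
def hifeSpace (T : Mesh Q) (S : Interface Q) (m : ℕ) (βm βp : ℝ) (hm : 1 ≤ m)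
    (h3 : 3 ≤ m → ContDiff ℝ 3 S.g) : Submodule ℝ (T.Elt → Pt → ℝ) where
  carrier := {v | IsHIFE T S m βm βp v}
  add_mem' {u v} hu hv := by
    have h : IsHIFE T S m βm βp _ := IsHIFE.linear hm h3 hu hv 1 1
    rw [one_smul, one_smul] at h
    exact h
  zero_mem' := IsHIFE.zero hm h3
  smul_mem' x u hu := by
    have h : IsHIFE T S m βm βp _ := IsHIFE.linear hm h3 hu hu x 0
    rw [zero_smul, add_zero] at h
    exact h

open Classical in
/-- The piecewise functions given by a pair of polynomials on each element, in the coordinates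
`u K` on the element `K`. -/
def piecewisePoly (T : Mesh Q) (m : ℕ) (u : T.Elt → Pt → ℝ × ℝ) :
    (T.Elt → Coef m × Coef m) →ₗ[ℝ] (T.Elt → Pt → ℝ) where
  toFun c K p := if p ∈ T.cell K then
      if (u K p).1 < 0 then qEval m (c K).1 (u K p).1 (u K p).2
      else qEval m (c K).2 (u K p).1 (u K p).2
    else 0
  map_add' c d := by
    ext K p
    simp only [Pi.add_apply, Prod.fst_add, Prod.snd_add, qEval_add]
    split_ifs <;> simp
  map_smul' r c := by
    ext K p
    simp only [Pi.smul_apply, Prod.smul_fst, Prod.smul_snd, qEval_smul, RingHom.id_apply,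
      smul_eq_mul]
    split_ifs <;> simp

/-- With one fictitious interval fixed on each interface element, every function of the space is
given by a pair of coefficient arrays per element, the values outside the elements being zero. The
space thus lies in the range of a linear map from a finite-dimensional space. -/
theorem finiteDimensional_hifeSpace (hT : T.Admissible S) (hm : 1 ≤ m)
    (h3 : 3 ≤ m → ContDiff ℝ 3 S.g) :
    FiniteDimensional ℝ (hifeSpace T S m βm βp hm h3) := by
  classical
  have hF : ∀ K, ∃ ab : ℝ × ℝ, T.IsInterfaceElt S K → T.IsFictitiousInterval S K ab.1 ab.2 := by
    intro K
    by_cases hK : T.IsInterfaceElt S K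
    · obtain ⟨a, b, F⟩ := hT.fictitious K hK
      exact ⟨(a, b), fun _ => F⟩
    · exact ⟨0, fun h => absurd h hK⟩
  choose ab hab using hF
  let u : T.Elt → Pt → ℝ × ℝ := fun K p =>
    if T.IsInterfaceElt S K then frenetInv S.g T.h (ab K).1 (ab K).2 p else (p 0, p 1)
  have hle : hifeSpace T S m βm βp hm h3 ≤ LinearMap.range (piecewisePoly T m u) := by
    intro v hv
    have hv : IsHIFE T S m βm βp v := hv
    have hK : ∀ K, ∃ c : Coef m × Coef m, ∀ p ∈ T.cell K, v K p =
        if (u K p).1 < 0 then qEval m c.1 (u K p).1 (u K p).2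
        else qEval m c.2 (u K p).1 (u K p).2 := by
      intro K
      by_cases hK : T.IsInterfaceElt S K
      · have F := hab K hK
        obtain ⟨cm, cp, -, hc⟩ := hv.immersed K hK _ _ F
        refine ⟨(cm, cp), fun p hp => ?_⟩
        simp only [u, if_pos hK]
        have hz := F.inv_mem hp
        have e := F.frenet_inv hp
        have := hc _ hz.1 _ hz.2 (by rw [Prod.mk.eta, e]; exact hp)
        rwa [Prod.mk.eta, e] at this
      · obtain ⟨c, hc⟩ := hv.nonInterface K hK
        refine ⟨(c, c), fun p hp => ?_⟩
        simp only [u, if_neg hK, ite_self]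
        exact hc p hp
    choose c hc using hK
    refine ⟨c, ?_⟩
    ext K p
    simp only [piecewisePoly, LinearMap.coe_mk, AddHom.coe_mk]
    by_cases hp : p ∈ T.cell K
    · rw [if_pos hp, hc K p hp]
    · rw [if_neg hp, hv.support K p hp]
  exact Submodule.finiteDimensional_of_le hle

end Space

end

section

variable {Q : Rect}

/-! ### The bilinear form and the load functional are linear -/

theorem integral_ae_linear {X : Type*} [MeasurableSpace X] {μ : Measure X} {F G H : X → ℝ}
    (hF : Integrable F μ) (hG : Integrable G μ) {x y : ℝ} (h : ∀ᵐ p ∂μ, H p = x * F p + y * G p) :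
    ∫ p, H p ∂μ = x * (∫ p, F p ∂μ) + y * ∫ p, G p ∂μ := by
  rw [integral_congr_ae h, integral_add (hF.const_mul x) (hG.const_mul y), integral_const_mul,
    integral_const_mul]

/-- Unique solvability of a finite-dimensional variational problem with a definite form. -/
theorem existsUnique_of_definite {W : Type*} [AddCommGroup W] [Module ℝ W] (V : Submodule ℝ W)
    [FiniteDimensional ℝ V] (b : W → W → ℝ) (l : W → ℝ)
    (hleft : ∀ u ∈ V, ∀ v ∈ V, ∀ w ∈ V, ∀ x y : ℝ, b (x • u + y • v) w = x * b u w + y * b v w)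
    (hright : ∀ u ∈ V, ∀ v ∈ V, ∀ w ∈ V, ∀ x y : ℝ, b w (x • u + y • v) = x * b w u + y * b w v)
    (hl : ∀ u ∈ V, ∀ v ∈ V, ∀ x y : ℝ, l (x • u + y • v) = x * l u + y * l v)
    (hdef : ∀ v ∈ V, b v v = 0 → v = 0) : ∃! u, u ∈ V ∧ ∀ v ∈ V, b u v = l v := by
  let A : V →ₗ[ℝ] Module.Dual ℝ V := LinearMap.mk₂ ℝ (fun u v => b u v)
    (fun u v w => by simpa using hleft u u.2 v v.2 w w.2 1 1)
    (fun x u w => by simpa using hleft u u.2 u u.2 w w.2 x 0)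
    (fun w u v => by simpa using hright u u.2 v v.2 w w.2 1 1)
    (fun x w u => by simpa using hright u u.2 u u.2 w w.2 x 0)
  have hinj : Function.Injective A := by
    rw [injective_iff_map_eq_zero]
    exact fun u hu => Subtype.ext (hdef u u.2 (DFunLike.congr_fun hu u))
  have hsurj : Function.Surjective A :=
    (LinearMap.injective_iff_surjective_of_finrank_eq_finrank
      (Subspace.dual_finrank_eq (K := ℝ) (V := V)).symm).1 hinj
  let L : Module.Dual ℝ V :=
    { toFun := fun v => l v
      map_add' := fun u v => by simpa using hl u u.2 v v.2 1 1
      map_smul' := fun x u => by simpa using hl u u.2 u u.2 x 0 }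
  obtain ⟨u, hu⟩ := hsurj L
  refine ⟨u, ⟨u.2, fun v hv => DFunLike.congr_fun hu ⟨v, hv⟩⟩, fun w hw => ?_⟩
  have : A ⟨w, hw.1⟩ = A u := by
    rw [hu]
    exact LinearMap.ext fun v => hw.2 v v.2
  exact congrArg Subtype.val (hinj this)

/-- Every single mesh is quasi-uniform for some constant. This makes the flux bound available, with
a constant depending on the mesh, where no uniformity is assumed. -/
theorem Mesh.exists_quasiUniform (T : Mesh Q) : ∃ c : ℝ, 0 < c ∧ T.QuasiUniform c := by
  have hh := T.h_pos
  have hx : ∀ i : Fin (T.nx + 1), 0 < T.x i.succ - T.x i.castSucc := fun i => T.wx_pos (i, 0)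
  have hy : ∀ j : Fin (T.ny + 1), 0 < T.y j.succ - T.y j.castSucc := fun j => T.wy_pos (0, j)
  obtain ⟨i, hi⟩ := Finite.exists_min fun i : Fin (T.nx + 1) => T.x i.succ - T.x i.castSucc
  obtain ⟨j, hj⟩ := Finite.exists_min fun j : Fin (T.ny + 1) => T.y j.succ - T.y j.castSucc
  refine ⟨min (T.x i.succ - T.x i.castSucc) (T.y j.succ - T.y j.castSucc) / T.h,
    div_pos (lt_min (hx i) (hy j)) hh, fun k => ?_, fun k => ?_⟩
  · rw [div_mul_cancel₀ _ hh.ne']; exact (min_le_left _ _).trans (hi k)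
  · rw [div_mul_cancel₀ _ hh.ne']; exact (min_le_right _ _).trans (hj k)

/-- On each element `v` has a piecewise continuous gradient. -/
def HasPiecewiseGrad (T : Mesh Q) (S : Interface Q) (v : T.Elt → Pt → ℝ) : Prop :=
  ∀ K, ∃ Gm Gp, PiecewiseGrad T S K (v K) Gm Gp

theorem IsHIFE.hasPiecewiseGrad {T : Mesh Q} {S : Interface Q} {m : ℕ} {βm βp : ℝ} (hm : 1 ≤ m)
    (h3 : 3 ≤ m → ContDiff ℝ 3 S.g) (hT : T.Admissible S) (hβm : 0 < βm) (hβ : βm ≤ βp)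
    {v : T.Elt → Pt → ℝ} (hv : IsHIFE T S m βm βp v) : HasPiecewiseGrad T S v := by
  obtain ⟨c, hc, hq⟩ := T.exists_quasiUniform
  obtain ⟨C, -, H⟩ := S.exists_flux_bound hm h3 hc
  intro K
  obtain ⟨Gm, Gp, P, -⟩ := H T βm βp v hT hq hβm hβ hv K
  exact ⟨Gm, Gp, P⟩

section Forms

variable {T : Mesh Q} {S : Interface Q} {u v w : T.Elt → Pt → ℝ} {βm βp : ℝ}

theorem HasPiecewiseGrad.grad_linear (hu : HasPiecewiseGrad T S u) (hv : HasPiecewiseGrad T S v)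
    (x y : ℝ) {K : T.Elt} {p : Pt} (hp : p ∈ T.cell K) (hr : p ∉ T.ridge S K) :
    grad T K (x • u + y • v) p = x • grad T K u p + y • grad T K v p := by
  obtain ⟨_, _, P⟩ := hu K
  obtain ⟨_, _, P'⟩ := hv K
  have h1 := P.hasGradientWithinAt hp hr
  have h2 := P'.hasGradientWithinAt hp hr
  refine gradientWithin_cell_eq hp ?_
  rw [hasGradientWithinAt_iff_hasFDerivWithinAt] at h1 h2 ⊢
  refine ((h1.const_smul x).add (h2.const_smul y)).congr_fderiv ?_
  rw [map_add, map_smul, map_smul]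
  rfl

theorem memLp_of_ae_bound {X : Type*} [MeasurableSpace X] {μ : Measure X} [IsFiniteMeasure μ]
    {E : Type*} [NormedAddCommGroup E] {f : X → E} (hf : AEStronglyMeasurable f μ)
    (h : ∃ M, ∀ᵐ x ∂μ, ‖f x‖ ≤ M) : MemLp f 2 μ := by
  obtain ⟨M, hM⟩ := h
  exact MemLp.of_bound hf M hM

theorem HasPiecewiseGrad.memLp_flux (hv : HasPiecewiseGrad T S v) {K : T.Elt} {X : Type*}
    [MeasurableSpace X] {μ : Measure X} [IsFiniteMeasure μ] {π : X → Pt}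
    (hπ : Traceable T S K μ π) (e : Pt) :
    MemLp (fun x => coeff T S βm βp K (π x) * inner ℝ (grad T K v (π x)) e) 2 μ := by
  obtain ⟨Gm, Gp, P⟩ := hv K
  obtain ⟨M, hM⟩ := P.exists_grad_bound
  refine memLp_of_ae_bound ?_ ⟨max |βm| |βp| * (M * ‖e‖), ?_⟩
  · exact ((measurable_coeff T S βm βp K).comp hπ.meas).aestronglyMeasurable.mul
      ((P.aestronglyMeasurable_grad hπ).inner aestronglyMeasurable_const)
  · filter_upwards [hπ.mem, hπ.notMem] with x hx hr
    rw [norm_mul]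
    have h1 : ‖inner ℝ (grad T K v (π x)) e‖ ≤ M * ‖e‖ :=
      (norm_inner_le_norm _ _).trans (by gcongr; exact hM _ hx hr)
    exact mul_le_mul (abs_coeff_le T S βm βp K _) h1 (norm_nonneg _)
      ((abs_nonneg _).trans (le_max_left _ _))

theorem HasPiecewiseGrad.integrable_cell (hT : T.Admissible S) (hu : HasPiecewiseGrad T S u)
    (hv : HasPiecewiseGrad T S v) (K : T.Elt) :
    Integrable (fun p => coeff T S βm βp K p * inner ℝ (grad T K u p) (grad T K v p))
      (volume.restrict (T.cell K)) := by
  have hπ := hT.traceable_cell K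
  obtain ⟨_, _, P⟩ := hu K
  obtain ⟨_, _, P'⟩ := hv K
  obtain ⟨M, hM⟩ := P.exists_grad_bound
  obtain ⟨M', hM'⟩ := P'.exists_grad_bound
  have : IsFiniteMeasure (volume.restrict (T.cell K)) :=
    ⟨by simpa using (T.volume_cell_ne_top K).lt_top⟩
  refine Integrable.of_bound (C := max |βm| |βp| * (M * M')) ?_ ?_
  · exact (measurable_coeff T S βm βp K).aestronglyMeasurable.mul
      ((P.aestronglyMeasurable_grad hπ).inner (P'.aestronglyMeasurable_grad hπ))
  · filter_upwards [hπ.mem, hπ.notMem] with x hx hr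
    rw [norm_mul]
    have h1 : ‖inner ℝ (grad T K u x) (grad T K v x)‖ ≤ M * M' :=
      (norm_inner_le_norm _ _).trans (mul_le_mul (hM _ hx hr) (hM' _ hx hr) (norm_nonneg _)
        ((norm_nonneg _).trans (hM _ hx hr)))
    exact mul_le_mul (abs_coeff_le T S βm βp K _) h1 (norm_nonneg _)
      ((abs_nonneg _).trans (le_max_left _ _))

theorem Mesh.Admissible.traceable_fst (hT : T.Admissible S) (B : T.Edge) :
    Traceable T S B.fst (volume.restrict (Icc B.lo B.hi)) B.pt :=
  hT.traceable_edge B _ (fun _ => B.pt_mem_fst) B.pt_notMem_interior_fst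

theorem Mesh.Admissible.traceable_snd (hT : T.Admissible S) (B : T.Edge) :
    Traceable T S B.snd (volume.restrict (Icc B.lo B.hi)) B.pt :=
  hT.traceable_edge B _ (fun _ => B.pt_mem_snd) B.pt_notMem_interior_snd

theorem HasPiecewiseGrad.memLp_avgFlux (hT : T.Admissible S) (hv : HasPiecewiseGrad T S v)
    (B : T.Edge) : MemLp (fun t => avgFlux S βm βp v B (B.pt t)) 2
      (volume.restrict (Icc B.lo B.hi)) := by
  have h := ((hv.memLp_flux (βm := βm) (βp := βp) (hT.traceable_fst B) B.normal).add
    (hv.memLp_flux (βm := βm) (βp := βp) (hT.traceable_snd B) B.normal)).const_mul (1 / 2)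
  refine h.ae_eq (Filter.Eventually.of_forall fun t => ?_)
  simp only [avgFlux, Pi.add_apply]
  ring

theorem HasPiecewiseGrad.memLp_jump (hv : HasPiecewiseGrad T S v) (B : T.Edge) :
    MemLp (fun t => jump v B (B.pt t)) 2 (volume.restrict (Icc B.lo B.hi)) := by
  obtain ⟨_, _, P⟩ := hv B.fst
  obtain ⟨_, _, P'⟩ := hv B.snd
  have hc : ContinuousOn (fun t => jump v B (B.pt t)) (Icc B.lo B.hi) :=
    (P.cont.comp B.continuous_pt.continuousOn fun _ => B.pt_mem_fst).sub
      (P'.cont.comp B.continuous_pt.continuousOn fun _ => B.pt_mem_snd)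
  obtain ⟨M, hM⟩ := isCompact_Icc.exists_bound_of_continuousOn hc
  refine memLp_of_ae_bound (hc.aestronglyMeasurable measurableSet_Icc) ⟨M, ?_⟩
  filter_upwards [ae_restrict_mem measurableSet_Icc] with t ht using hM t ht

theorem Mesh.Edge.integral_eq (B : T.Edge) (F : Pt → ℝ) :
    B.integral F = ∫ t in Icc B.lo B.hi, F (B.pt t) := by
  rw [Mesh.Edge.integral, intervalIntegral.integral_of_le B.lo_lt_hi.le, integral_Icc_eq_integral_Ioc]

theorem jump_linear (u v : T.Elt → Pt → ℝ) (x y : ℝ) (B : T.Edge) (p : Pt) :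
    jump (x • u + y • v) B p = x * jump u B p + y * jump v B p := by
  simp only [jump, Pi.add_apply, Pi.smul_apply, smul_eq_mul]
  ring

theorem HasPiecewiseGrad.avgFlux_linear (hT : T.Admissible S) (hu : HasPiecewiseGrad T S u)
    (hv : HasPiecewiseGrad T S v) (x y : ℝ) (B : T.Edge) :
    ∀ᵐ t ∂volume.restrict (Icc B.lo B.hi), avgFlux S βm βp (x • u + y • v) B (B.pt t)
      = x * avgFlux S βm βp u B (B.pt t) + y * avgFlux S βm βp v B (B.pt t) := by
  have h1 := hT.traceable_fst B
  have h2 := hT.traceable_snd B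
  filter_upwards [h1.mem, h1.notMem, h2.mem, h2.notMem] with t a b c d
  simp only [avgFlux, hu.grad_linear hv x y a b, hu.grad_linear hv x y c d, inner_add_left,
    real_inner_smul_left]
  ring

theorem HasPiecewiseGrad.integrable_flux_jump (hT : T.Admissible S) (hu : HasPiecewiseGrad T S u)
    (hv : HasPiecewiseGrad T S v) (B : T.Edge) :
    Integrable (fun t => avgFlux S βm βp u B (B.pt t) * jump v B (B.pt t))
      (volume.restrict (Icc B.lo B.hi)) :=
  (hu.memLp_avgFlux hT B).integrable_mul (hv.memLp_jump B)

theorem HasPiecewiseGrad.integrable_jump_jump (hu : HasPiecewiseGrad T S u)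
    (hv : HasPiecewiseGrad T S v) (B : T.Edge) (s : ℝ) :
    Integrable (fun t => s * jump u B (B.pt t) * jump v B (B.pt t))
      (volume.restrict (Icc B.lo B.hi)) := by
  have := ((hu.memLp_jump B).integrable_mul (hv.memLp_jump B)).const_mul s
  refine this.congr (Filter.Eventually.of_forall fun t => ?_)
  simp only [Pi.mul_apply]
  ring

variable {ε α : ℝ} {σ : T.Edge → ℝ}

theorem bilin_linear_left (hT : T.Admissible S) (hu : HasPiecewiseGrad T S u)
    (hv : HasPiecewiseGrad T S v) (hw : HasPiecewiseGrad T S w) (x y : ℝ) :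
    bilin S βm βp ε α σ (x • u + y • v) w
      = x * bilin S βm βp ε α σ u w + y * bilin S βm βp ε α σ v w := by
  have e1 : ∀ K, ∫ p in T.cell K, coeff T S βm βp K p *
      inner ℝ (grad T K (x • u + y • v) p) (grad T K w p)
      = x * (∫ p in T.cell K, coeff T S βm βp K p * inner ℝ (grad T K u p) (grad T K w p))
      + y * ∫ p in T.cell K, coeff T S βm βp K p * inner ℝ (grad T K v p) (grad T K w p) := by
    intro K
    have hπ := hT.traceable_cell K
    refine integral_ae_linear (hu.integrable_cell hT hw K) (hv.integrable_cell hT hw K) ?_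
    filter_upwards [hπ.mem, hπ.notMem] with p a b
    rw [hu.grad_linear hv x y (p := p) a b, inner_add_left, real_inner_smul_left, real_inner_smul_left]
    ring
  have e2 : ∀ B : T.Edge, (B.integral fun p => avgFlux S βm βp (x • u + y • v) B p * jump w B p)
      = x * (B.integral fun p => avgFlux S βm βp u B p * jump w B p)
      + y * (B.integral fun p => avgFlux S βm βp v B p * jump w B p) := by
    intro B
    simp only [B.integral_eq]
    refine integral_ae_linear (hu.integrable_flux_jump hT hw B) (hv.integrable_flux_jump hT hw B) ?_
    filter_upwards [hu.avgFlux_linear hT hv x y B] with t h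
    rw [h]; ring
  have e3 : ∀ B : T.Edge, (B.integral fun p => avgFlux S βm βp w B p * jump (x • u + y • v) B p)
      = x * (B.integral fun p => avgFlux S βm βp w B p * jump u B p)
      + y * (B.integral fun p => avgFlux S βm βp w B p * jump v B p) := by
    intro B
    simp only [B.integral_eq]
    refine integral_ae_linear (hw.integrable_flux_jump hT hu B) (hw.integrable_flux_jump hT hv B)
      (Filter.Eventually.of_forall fun t => ?_)
    rw [jump_linear]; ring
  have e4 : ∀ B : T.Edge,
      (B.integral fun p => σ B / B.length ^ α * jump (x • u + y • v) B p * jump w B p)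
      = x * (B.integral fun p => σ B / B.length ^ α * jump u B p * jump w B p)
      + y * (B.integral fun p => σ B / B.length ^ α * jump v B p * jump w B p) := by
    intro B
    simp only [B.integral_eq]
    refine integral_ae_linear (hu.integrable_jump_jump hw B _) (hv.integrable_jump_jump hw B _)
      (Filter.Eventually.of_forall fun t => ?_)
    rw [jump_linear]; ring
  simp only [bilin, e1, e2, e3, e4, Finset.sum_add_distrib, ← Finset.mul_sum]
  ring

theorem bilin_linear_right (hT : T.Admissible S) (hu : HasPiecewiseGrad T S u)
    (hv : HasPiecewiseGrad T S v) (hw : HasPiecewiseGrad T S w) (x y : ℝ) :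
    bilin S βm βp ε α σ w (x • u + y • v)
      = x * bilin S βm βp ε α σ w u + y * bilin S βm βp ε α σ w v := by
  have e1 : ∀ K, ∫ p in T.cell K, coeff T S βm βp K p *
      inner ℝ (grad T K w p) (grad T K (x • u + y • v) p)
      = x * (∫ p in T.cell K, coeff T S βm βp K p * inner ℝ (grad T K w p) (grad T K u p))
      + y * ∫ p in T.cell K, coeff T S βm βp K p * inner ℝ (grad T K w p) (grad T K v p) := by
    intro K
    have hπ := hT.traceable_cell K
    refine integral_ae_linear (hw.integrable_cell hT hu K) (hw.integrable_cell hT hv K) ?_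
    filter_upwards [hπ.mem, hπ.notMem] with p a b
    rw [hu.grad_linear hv x y (p := p) a b, inner_add_right, real_inner_smul_right, real_inner_smul_right]
    ring
  have e2 : ∀ B : T.Edge, (B.integral fun p => avgFlux S βm βp (x • u + y • v) B p * jump w B p)
      = x * (B.integral fun p => avgFlux S βm βp u B p * jump w B p)
      + y * (B.integral fun p => avgFlux S βm βp v B p * jump w B p) := by
    intro B
    simp only [B.integral_eq]
    refine integral_ae_linear (hu.integrable_flux_jump hT hw B) (hv.integrable_flux_jump hT hw B) ?_
    filter_upwards [hu.avgFlux_linear hT hv x y B] with t h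
    rw [h]; ring
  have e3 : ∀ B : T.Edge, (B.integral fun p => avgFlux S βm βp w B p * jump (x • u + y • v) B p)
      = x * (B.integral fun p => avgFlux S βm βp w B p * jump u B p)
      + y * (B.integral fun p => avgFlux S βm βp w B p * jump v B p) := by
    intro B
    simp only [B.integral_eq]
    refine integral_ae_linear (hw.integrable_flux_jump hT hu B) (hw.integrable_flux_jump hT hv B)
      (Filter.Eventually.of_forall fun t => ?_)
    rw [jump_linear]; ring
  have e4 : ∀ B : T.Edge,
      (B.integral fun p => σ B / B.length ^ α * jump w B p * jump (x • u + y • v) B p)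
      = x * (B.integral fun p => σ B / B.length ^ α * jump w B p * jump u B p)
      + y * (B.integral fun p => σ B / B.length ^ α * jump w B p * jump v B p) := by
    intro B
    simp only [B.integral_eq]
    refine integral_ae_linear (hw.integrable_jump_jump hu B _) (hw.integrable_jump_jump hv B _)
      (Filter.Eventually.of_forall fun t => ?_)
    rw [jump_linear]; ring
  simp only [bilin, e1, e2, e3, e4, Finset.sum_add_distrib, ← Finset.mul_sum]
  ring

theorem HasPiecewiseGrad.integrable_load (hv : HasPiecewiseGrad T S v) {f : Pt → ℝ}
    (hf : MemLp f 2 (volume.restrict Q.dom)) (K : T.Elt) :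
    Integrable (fun p => f p * v K p) (volume.restrict (T.cell K)) := by
  obtain ⟨_, _, P⟩ := hv K
  have h1 : MemLp f 2 (volume.restrict (T.cell K)) := by
    rw [Measure.restrict_congr_set (T.cell_ae_eq_interior K)]
    exact hf.mono_measure (Measure.restrict_mono_set _ (T.interior_cell_subset_dom K))
  have : IsFiniteMeasure (volume.restrict (T.cell K)) :=
    ⟨by simpa using (T.volume_cell_ne_top K).lt_top⟩
  obtain ⟨M, hM⟩ := (T.isCompact_cell K).exists_bound_of_continuousOn P.cont
  have h2 : MemLp (v K) 2 (volume.restrict (T.cell K)) := by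
    refine memLp_of_ae_bound (P.cont.aestronglyMeasurable (T.isClosed_cell K).measurableSet) ⟨M, ?_⟩
    filter_upwards [ae_restrict_mem (T.isClosed_cell K).measurableSet] with p hp using hM p hp
  exact h1.integrable_mul h2

theorem load_linear (hu : HasPiecewiseGrad T S u) (hv : HasPiecewiseGrad T S v) {f : Pt → ℝ}
    (hf : MemLp f 2 (volume.restrict Q.dom)) (x y : ℝ) :
    load f (x • u + y • v) = x * load f u + y * load f v := by
  have e1 : ∀ K, ∫ p in T.cell K, f p * (x • u + y • v) K p
      = x * (∫ p in T.cell K, f p * u K p) + y * ∫ p in T.cell K, f p * v K p := by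
    intro K
    refine integral_ae_linear (hu.integrable_load hf K) (hv.integrable_load hf K)
      (Filter.Eventually.of_forall fun p => ?_)
    simp only [Pi.add_apply, Pi.smul_apply, smul_eq_mul]
    ring
  simp only [load, e1, Finset.sum_add_distrib, ← Finset.mul_sum]

/-- Unique solvability follows from definiteness. -/
theorem existsUnique_isSolution {m : ℕ} (hm : 1 ≤ m) (h3 : 3 ≤ m → ContDiff ℝ 3 S.g)
    (hT : T.Admissible S) (hβm : 0 < βm) (hβ : βm ≤ βp)
    (hdef : ∀ v, IsHIFE T S m βm βp v → bilin S βm βp ε α σ v v = 0 → v = 0)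
    {f : Pt → ℝ} (hf : MemLp f 2 (volume.restrict Q.dom)) :
    ∃! u, IsSolution S m βm βp ε α σ f u := by
  have hfin := finiteDimensional_hifeSpace (βm := βm) (βp := βp) hT hm h3
  have hP : ∀ v ∈ hifeSpace T S m βm βp hm h3, HasPiecewiseGrad T S v := fun v hv =>
    IsHIFE.hasPiecewiseGrad hm h3 hT hβm hβ hv
  exact existsUnique_of_definite (hifeSpace T S m βm βp hm h3) (bilin S βm βp ε α σ) (load f)
    (fun u hu v hv w hw x y => bilin_linear_left hT (hP u hu) (hP v hv) (hP w hw) x y)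
    (fun u hu v hv w hw x y => bilin_linear_right hT (hP u hu) (hP v hv) (hP w hw) x y)
    (fun u hu v hv x y => load_linear (hP u hu) (hP v hv) hf x y) hdef

end Forms

end

section

variable {Q : Rect}

/-! ### Definiteness -/

theorem sum_comp_le_of_injective {ι κ : Type*} [Fintype ι] [Fintype κ] (f : ι → κ)
    (hf : Function.Injective f) (E : κ → ℝ) (hE : ∀ k, 0 ≤ E k) : ∑ i, E (f i) ≤ ∑ k, E k := by
  have := Finset.sum_map Finset.univ ⟨f, hf⟩ E
  simp only [Function.Embedding.coeFn_mk] at this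
  rw [← this]
  exact Finset.sum_le_univ_sum_of_nonneg hE

/-- An element is the first neighbour of at most one vertical and one horizontal edge, and likewise
the second neighbour. -/
theorem Mesh.sum_adjacent_le {T : Mesh Q} (A : Finset T.Edge) (E : T.Elt → ℝ) (hE : ∀ K, 0 ≤ E K) :
    ∑ B ∈ A, (E B.fst + E B.snd) ≤ 4 * ∑ K, E K := by
  refine (Finset.sum_le_univ_sum_of_nonneg fun B => add_nonneg (hE _) (hE _)).trans ?_
  rw [Fintype.sum_sum_type, Finset.sum_add_distrib, Finset.sum_add_distrib]
  have h1 := sum_comp_le_of_injective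
    (fun e : Fin T.nx × Fin (T.ny + 1) => (Mesh.Edge.fst (T := T) (Sum.inl e))) (fun a b h => by
      simpa [Mesh.Edge.fst, Prod.ext_iff] using h) E hE
  have h2 := sum_comp_le_of_injective
    (fun e : Fin T.nx × Fin (T.ny + 1) => (Mesh.Edge.snd (T := T) (Sum.inl e))) (fun a b h => by
      simpa [Mesh.Edge.snd, Prod.ext_iff] using h) E hE
  have h3 := sum_comp_le_of_injective
    (fun e : Fin (T.nx + 1) × Fin T.ny => (Mesh.Edge.fst (T := T) (Sum.inr e))) (fun a b h => by
      simpa [Mesh.Edge.fst, Prod.ext_iff] using h) E hE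
  have h4 := sum_comp_le_of_injective
    (fun e : Fin (T.nx + 1) × Fin T.ny => (Mesh.Edge.snd (T := T) (Sum.inr e))) (fun a b h => by
      simpa [Mesh.Edge.snd, Prod.ext_iff] using h) E hE
  linarith

section Definite

variable {T : Mesh Q} {S : Interface Q} {v : T.Elt → Pt → ℝ} {βm βp : ℝ}

/-- The Dirichlet energy of `v` on an element. -/
def energy (T : Mesh Q) (v : T.Elt → Pt → ℝ) (K : T.Elt) : ℝ := ∫ q in T.cell K, ‖grad T K v q‖ ^ 2

theorem energy_nonneg (v : T.Elt → Pt → ℝ) (K : T.Elt) : 0 ≤ energy T v K :=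
  integral_nonneg fun _ => sq_nonneg _

theorem HasPiecewiseGrad.energy_le (hT : T.Admissible S) (hv : HasPiecewiseGrad T S v)
    (hβ : βm ≤ βp) (K : T.Elt) : βm * energy T v K
      ≤ ∫ p in T.cell K, coeff T S βm βp K p * inner ℝ (grad T K v p) (grad T K v p) := by
  obtain ⟨_, _, P⟩ := hv K
  rw [energy, ← integral_const_mul]
  refine integral_mono ((integrableOn_norm_grad_sq hT P).const_mul βm)
    (hv.integrable_cell hT hv K) fun p => ?_
  simp only [real_inner_self_eq_norm_sq, grad]
  refine mul_le_mul_of_nonneg_right ?_ (sq_nonneg _)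
  unfold coeff
  split_ifs
  exacts [le_rfl, hβ]

theorem coeff_mul_grad_sq_le {K : T.Elt} {Gm Gp : Pt → Pt} {M : ℝ}
    (P : PiecewiseGrad T S K (v K) Gm Gp)
    (h : ∀ p ∈ T.cell K, (βm * ‖Gm p‖) ^ 2 ≤ M ∧ (βp * ‖Gp p‖) ^ 2 ≤ M) {p : Pt}
    (hp : p ∈ T.cell K) (hr : p ∉ T.ridge S K) :
    (coeff T S βm βp K p * ‖grad T K v p‖) ^ 2 ≤ M := by
  by_cases hM : p ∈ T.sideM S K
  · rw [show coeff T S βm βp K p = βm from if_pos hM, grad, P.gradientWithin_eq_of_mem hp hr hM]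
    exact (h p hp).1
  · rw [show coeff T S βm βp K p = βp from if_neg hM, grad, P.gradientWithin_eq_of_notMem hp hr hM]
    exact (h p hp).2

theorem avgFlux_sq_le (B : T.Edge) {p : Pt} {M M' : ℝ}
    (h : (coeff T S βm βp B.fst p * ‖grad T B.fst v p‖) ^ 2 ≤ M)
    (h' : (coeff T S βm βp B.snd p * ‖grad T B.snd v p‖) ^ 2 ≤ M') :
    avgFlux S βm βp v B p ^ 2 ≤ (M + M') / 2 := by
  have key : ∀ (x M : ℝ) (G : Pt), (x * ‖G‖) ^ 2 ≤ M → (x * inner ℝ G B.normal) ^ 2 ≤ M := by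
    intro x M G hx
    refine le_trans ?_ hx
    rw [mul_pow, mul_pow]
    have : |inner ℝ G B.normal| ≤ ‖G‖ := by
      have := abs_real_inner_le_norm G B.normal
      rwa [B.norm_normal, mul_one] at this
    rw [← sq_abs (inner ℝ G B.normal)]
    gcongr
  have h1 := key _ _ _ h
  have h2 := key _ _ _ h'
  rw [avgFlux]
  nlinarith [sq_nonneg (coeff T S βm βp B.fst p * inner ℝ (grad T B.fst v p) B.normal
    - coeff T S βm βp B.snd p * inner ℝ (grad T B.snd v p) B.normal)]

/-- Young's inequality, with `s` to be the penalty weight of an edge. -/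
theorem abs_integral_mul_le {X : Type*} [MeasurableSpace X] {μ : Measure X} {F J : X → ℝ}
    (hF : MemLp F 2 μ) (hJ : MemLp J 2 μ) {s : ℝ} (hs : 0 < s) :
    |∫ x, F x * J x ∂μ| ≤ 1 / s * (∫ x, F x ^ 2 ∂μ) + s / 4 * ∫ x, J x ^ 2 ∂μ := by
  have h1 := hF.integrable_sq
  have h2 := hJ.integrable_sq
  refine (abs_integral_le_integral_abs).trans ?_
  rw [← integral_const_mul, ← integral_const_mul, ← integral_add (h1.const_mul _) (h2.const_mul _)]
  refine integral_mono (hF.integrable_mul hJ).abs ((h1.const_mul _).add (h2.const_mul _)) fun x => ?_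
  show |F x * J x| ≤ 1 / s * F x ^ 2 + s / 4 * J x ^ 2
  rw [abs_le]
  have e : ∀ r : ℝ, r ^ 2 = 1 → r * (F x * J x) ≤ 1 / s * F x ^ 2 + s / 4 * J x ^ 2 := by
    intro r hr
    have : 0 ≤ 1 / s * (F x - r * (s / 2 * J x)) ^ 2 := by positivity
    have e : 1 / s * (F x - r * (s / 2 * J x)) ^ 2
        = 1 / s * F x ^ 2 + r ^ 2 * (s / 4 * J x ^ 2) - r * (F x * J x) := by field_simp; ring
    rw [e, hr] at this
    linarith
  have a := e 1 (by norm_num)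
  have b := e (-1) (by norm_num)
  constructor <;> linarith

/-- If the energies and the jumps of a function of the immersed space vanish then it is zero. -/
theorem eq_zero_of_energy_eq_zero {m : ℕ} (hm : 1 ≤ m) (h3 : 3 ≤ m → ContDiff ℝ 3 S.g)
    (hT : T.Admissible S) (hβm : 0 < βm) (hβ : βm ≤ βp) (hv : IsHIFE T S m βm βp v)
    (hE : ∀ K, energy T v K = 0)
    (hJ : ∀ B ∈ T.sEdges S, ∫ t in Icc B.lo B.hi, jump v B (B.pt t) ^ 2 = 0) : v = 0 := by
  obtain ⟨c, hc, hq⟩ := T.exists_quasiUniform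
  obtain ⟨C, -, H⟩ := S.exists_flux_bound hm h3 hc
  have hβp : 0 < βp := hβm.trans_le hβ
  -- With zero energy the flux bound makes both gradient fields vanish at every point, not merely
  -- almost everywhere, so `v` is constant on each element.
  have hconst : ∀ K, ∀ p ∈ T.cell K, ∀ q ∈ T.cell K, v K p = v K q := by
    intro K
    obtain ⟨Gm, Gp, P, h⟩ := H T βm βp v hT hq hβm hβ hv K
    have h0 : ∫ q in T.cell K, ‖grad T K v q‖ ^ 2 = 0 := hE K
    rw [h0, mul_zero] at h
    have z : ∀ (β : ℝ) (G : Pt), 0 < β → (β * ‖G‖) ^ 2 ≤ 0 → G = 0 := by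
      intro β G hβ hG
      have := pow_eq_zero_iff two_ne_zero |>.1 (le_antisymm hG (sq_nonneg _))
      exact norm_eq_zero.1 ((mul_eq_zero.1 this).resolve_left hβ.ne')
    exact P.const (fun p hp => z βm _ hβm (h p hp).1) fun p hp => z βp _ hβp (h p hp).2
  have hlo : ∀ B : T.Edge, B.lo ∈ Icc B.lo B.hi := fun B => ⟨le_rfl, B.lo_lt_hi.le⟩
  -- The jump is constant along an edge, so a vanishing integral makes it zero; across the remaining
  -- edges continuity is part of the space.
  have hjump : ∀ B : T.Edge, v B.fst (B.pt B.lo) = v B.snd (B.pt B.lo) := by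
    intro B
    by_cases hB : B ∈ T.sEdges S
    · have h := hJ B hB
      have e : ∀ t ∈ Icc B.lo B.hi, jump v B (B.pt t) ^ 2 = jump v B (B.pt B.lo) ^ 2 := by
        intro t ht
        rw [jump, jump, hconst _ _ (B.pt_mem_fst ht) _ (B.pt_mem_fst (hlo B)),
          hconst _ _ (B.pt_mem_snd ht) _ (B.pt_mem_snd (hlo B))]
      rw [setIntegral_congr_fun measurableSet_Icc e, setIntegral_const, Measure.real,
        Real.volume_Icc, ENNReal.toReal_ofReal (sub_nonneg.2 B.lo_lt_hi.le), smul_eq_mul] at h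
      have h1 := (mul_eq_zero.1 h).resolve_left (sub_pos.2 B.lo_lt_hi).ne'
      exact sub_eq_zero.1 (pow_eq_zero_iff two_ne_zero |>.1 h1)
    · have hB' : ¬ T.IsSEdge S B := by
        simpa [Mesh.sEdges] using hB
      exact hv.continuous B hB' _ ⟨_, hlo B, rfl⟩
  -- The boundary value zero in the leftmost column is passed on to the right through the vertical
  -- edges.
  have hzero : ∀ (n : ℕ) (hn : n < T.nx + 1) (j : Fin (T.ny + 1)),
      ∀ p ∈ T.cell (⟨n, hn⟩, j), v (⟨n, hn⟩, j) p = 0 := by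
    intro n
    induction n with
    | zero =>
      intro hn j p hp
      have hmem := T.vertex_mem (⟨0, hn⟩, j) 0
      rw [hconst _ p hp _ hmem]
      refine hv.boundary _ _ hmem ⟨?_, ?_⟩
      · rw [← T.closure_interior_cell] at hmem
        exact closure_mono (T.interior_cell_subset_dom _) hmem
      · rw [(Q.isOpen_dom).interior_eq]
        rintro ⟨⟨h, -⟩, -⟩
        have : T.vertex (⟨0, hn⟩, j) 0 0 = Q.x₀ := by
          rw [← T.x_first]
          simp [Mesh.vertex]
        exact h.ne this.symm
    | succ n ih =>
      intro hn j p hp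
      let B : T.Edge := Sum.inl (⟨n, by omega⟩, j)
      have h1 := hjump B
      have h2 : v B.fst (B.pt B.lo) = 0 := ih (by omega) j _ (B.pt_mem_fst (hlo B))
      rw [h2] at h1
      rw [hconst _ p hp _ (B.pt_mem_snd (hlo B))]
      exact h1.symm
  ext ⟨i, j⟩ p
  by_cases hp : p ∈ T.cell (i, j)
  · exact hzero i.1 i.2 j p hp
  · exact hv.support _ p hp

variable {ε α : ℝ} {σ : T.Edge → ℝ}

theorem bilin_self (v : T.Elt → Pt → ℝ) : bilin S βm βp ε α σ v v
    = (∑ K, ∫ p in T.cell K, coeff T S βm βp K p * inner ℝ (grad T K v p) (grad T K v p))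
    - (1 - ε) * (∑ B ∈ T.sEdges S,
        ∫ t in Icc B.lo B.hi, avgFlux S βm βp v B (B.pt t) * jump v B (B.pt t))
    + ∑ B ∈ T.sEdges S, σ B / B.length ^ α * ∫ t in Icc B.lo B.hi, jump v B (B.pt t) ^ 2 := by
  have e : ∀ B : T.Edge, (B.integral fun p => σ B / B.length ^ α * jump v B p * jump v B p)
      = σ B / B.length ^ α * ∫ t in Icc B.lo B.hi, jump v B (B.pt t) ^ 2 := by
    intro B
    rw [B.integral_eq, ← integral_const_mul]
    congr 1; ext t; ring
  simp only [bilin, e, Mesh.Edge.integral_eq]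
  ring

/-- Definiteness from a lower bound of the bilinear form by the energies and jumps. -/
theorem definite_of_lower_bound {m : ℕ} (hm : 1 ≤ m) (h3 : 3 ≤ m → ContDiff ℝ 3 S.g)
    (hT : T.Admissible S) (hβm : 0 < βm) (hβ : βm ≤ βp) (hσ : ∀ B ∈ T.sEdges S, 0 < σ B)
    (hv : IsHIFE T S m βm βp v) {k : ℝ} (hk : 0 < k)
    (hlow : k * ((∑ K, βm * energy T v K) + ∑ B ∈ T.sEdges S, σ B / B.length ^ α *
      ∫ t in Icc B.lo B.hi, jump v B (B.pt t) ^ 2) ≤ bilin S βm βp ε α σ v v)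
    (h0 : bilin S βm βp ε α σ v v = 0) : v = 0 := by
  have hEn : ∀ K ∈ (Finset.univ : Finset T.Elt), 0 ≤ βm * energy T v K :=
    fun K _ => mul_nonneg hβm.le (energy_nonneg v K)
  have hs : ∀ B ∈ T.sEdges S, 0 < σ B / B.length ^ α := fun B hB =>
    div_pos (hσ B hB) (Real.rpow_pos_of_pos B.length_pos _)
  have hI : ∀ B : T.Edge, 0 ≤ ∫ t in Icc B.lo B.hi, jump v B (B.pt t) ^ 2 := fun B =>
    integral_nonneg fun _ => sq_nonneg _
  have hJn : ∀ B ∈ T.sEdges S, 0 ≤ σ B / B.length ^ α *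
      ∫ t in Icc B.lo B.hi, jump v B (B.pt t) ^ 2 := fun B hB => mul_nonneg (hs B hB).le (hI B)
  rw [h0] at hlow
  have a := Finset.sum_nonneg hEn
  have b := Finset.sum_nonneg hJn
  have hsum : (∑ K, βm * energy T v K) + ∑ B ∈ T.sEdges S, σ B / B.length ^ α *
      (∫ t in Icc B.lo B.hi, jump v B (B.pt t) ^ 2) ≤ 0 := by
    by_contra! h
    exact (mul_pos hk h).not_ge hlow
  have hE0 : ∑ K, βm * energy T v K = 0 := by linarith
  have hJ0 : ∑ B ∈ T.sEdges S, σ B / B.length ^ α *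
      (∫ t in Icc B.lo B.hi, jump v B (B.pt t) ^ 2) = 0 := by linarith
  refine eq_zero_of_energy_eq_zero hm h3 hT hβm hβ hv (fun K => ?_) fun B hB => ?_
  · exact (mul_eq_zero.1 ((Finset.sum_eq_zero_iff_of_nonneg hEn).1 hE0 K
      (Finset.mem_univ K))).resolve_left hβm.ne'
  · exact (mul_eq_zero.1 ((Finset.sum_eq_zero_iff_of_nonneg hJn).1 hJ0 B hB)).resolve_left
      (hs B hB).ne'

/-- The nonsymmetric form is definite for all positive penalty parameters. -/
theorem definite_of_eps_eq_one {m : ℕ} (hm : 1 ≤ m) (h3 : 3 ≤ m → ContDiff ℝ 3 S.g)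
    (hT : T.Admissible S) (hβm : 0 < βm) (hβ : βm ≤ βp) (hσ : ∀ B ∈ T.sEdges S, 0 < σ B)
    (hv : IsHIFE T S m βm βp v) (h0 : bilin S βm βp 1 α σ v v = 0) : v = 0 := by
  refine definite_of_lower_bound hm h3 hT hβm hβ hσ hv one_pos ?_ h0
  have hP := hv.hasPiecewiseGrad hm h3 hT hβm hβ
  -- For `ε = 1` the flux terms cancel and only energy and penalty remain.
  rw [bilin_self, sub_self, zero_mul, sub_zero, one_mul]
  gcongr with K _
  exact hP.energy_le hT hβ K

/-- Since `α ≥ 0`, the weight `l ^ (-α)` is at least `h ^ (-α)`; the factor `h ^ (α - 1)` raises it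
to `1 / h`, the weight that the flux bound demands. -/
theorem penalty_scaling {h l α : ℝ} (hl : 0 < l) (hlh : l ≤ h) (hα : 0 ≤ α) :
    1 / h ≤ max 1 (h ^ (α - 1)) / l ^ α := by
  have hh : 0 < h := hl.trans_le hlh
  have h1 : l ^ α ≤ h ^ α := Real.rpow_le_rpow hl.le hlh hα
  have h2 : 0 < l ^ α := Real.rpow_pos_of_pos hl _
  calc 1 / h = h ^ (α - 1) / h ^ α := by
        rw [Real.rpow_sub_one hh.ne']
        have := (Real.rpow_pos_of_pos hh α).ne'
        field_simp
    _ ≤ max 1 (h ^ (α - 1)) / l ^ α := by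
        gcongr
        exact le_max_right _ _

end Definite

/-- The other two forms are definite for large penalty parameters. -/
theorem Interface.exists_penalty (S : Interface Q) {m : ℕ} (hm : 1 ≤ m)
    (h3 : 3 ≤ m → ContDiff ℝ 3 S.g) {α : ℝ} (hα : 0 ≤ α) {c : ℝ} (hc : 0 < c) :
    ∃ C : ℝ, 0 < C ∧ ∀ T : Mesh Q, T.Admissible S → T.QuasiUniform c →
      ∀ βm βp : ℝ, 0 < βm → βm ≤ βp → ∀ ε : ℝ, ε = 0 ∨ ε = -1 → ∀ σ : T.Edge → ℝ,
      (∀ B ∈ T.sEdges S, C * max 1 (T.h ^ (α - 1)) * (βp ^ 2 / βm) ≤ σ B) →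
      ∀ v, IsHIFE T S m βm βp v → bilin S βm βp ε α σ v v = 0 → v = 0 := by
  obtain ⟨C, hC, H⟩ := S.exists_flux_bound hm h3 hc
  -- The `8` is adjusted to three losses: `1 - ε ≤ 2`, the averaging of two fluxes, and the four
  -- edges of an element.
  refine ⟨8 * C, by positivity, fun T hT hq βm βp hβm hβ ε hε σ hσ v hv h0 => ?_⟩
  have hβp : 0 < βp := hβm.trans_le hβ
  have hh := T.h_pos
  have hσ0 : ∀ B ∈ T.sEdges S, 0 < σ B := fun B hB => lt_of_lt_of_le (by positivity) (hσ B hB)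
  refine definite_of_lower_bound hm h3 hT hβm hβ hσ0 hv (k := 1 / 2) (by norm_num) ?_ h0
  have hP := hv.hasPiecewiseGrad hm h3 hT hβm hβ
  have hE := fun K => hP.energy_le hT hβ K
  rw [bilin_self]
  -- A pointwise bound of order `h ^ (-2)` integrated over an edge of length at most `h`.
  have hflux : ∀ B : T.Edge, ∫ t in Icc B.lo B.hi, avgFlux S βm βp v B (B.pt t) ^ 2
      ≤ C * βp ^ 2 / T.h * (energy T v B.fst + energy T v B.snd) / 2 := by
    intro B
    obtain ⟨_, _, P, hP1⟩ := H T βm βp v hT hq hβm hβ hv B.fst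
    obtain ⟨_, _, P', hP2⟩ := H T βm βp v hT hq hβm hβ hv B.snd
    have hfst := hT.traceable_fst B
    have hsnd := hT.traceable_snd B
    have hb : ∀ᵐ t ∂volume.restrict (Icc B.lo B.hi), avgFlux S βm βp v B (B.pt t) ^ 2
        ≤ C * βp ^ 2 / T.h ^ 2 * (energy T v B.fst + energy T v B.snd) / 2 := by
      filter_upwards [hfst.mem, hfst.notMem, hsnd.mem, hsnd.notMem] with t a1 a2 a3 a4
      have := avgFlux_sq_le B (coeff_mul_grad_sq_le P hP1 a1 a2) (coeff_mul_grad_sq_le P' hP2 a3 a4)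
      rw [mul_add]
      exact this
    have hi := integral_mono_ae (hP.memLp_avgFlux (βm := βm) (βp := βp) hT B).integrable_sq
      (integrable_const _) hb
    refine hi.trans ?_
    rw [setIntegral_const, Measure.real, Real.volume_Icc,
      ENNReal.toReal_ofReal (sub_nonneg.2 B.lo_lt_hi.le), smul_eq_mul]
    have hl : B.hi - B.lo ≤ T.h := B.length_le_h
    have hEE : 0 ≤ energy T v B.fst + energy T v B.snd :=
      add_nonneg (energy_nonneg _ _) (energy_nonneg _ _)
    calc (B.hi - B.lo) * (C * βp ^ 2 / T.h ^ 2 * (energy T v B.fst + energy T v B.snd) / 2)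
        ≤ T.h * (C * βp ^ 2 / T.h ^ 2 * (energy T v B.fst + energy T v B.snd) / 2) := by gcongr
      _ = _ := by field_simp
  -- Young's inequality weighted by the actual penalty `s`: doubling its two terms gives exactly
  -- half of the penalty, and by the lower bound on `s` an energy contribution of `βm / 8`.
  have hterm : ∀ B ∈ T.sEdges S, (1 - ε) *
      (∫ t in Icc B.lo B.hi, avgFlux S βm βp v B (B.pt t) * jump v B (B.pt t))
      ≤ βm / 8 * (energy T v B.fst + energy T v B.snd)
        + 1 / 2 * (σ B / B.length ^ α * ∫ t in Icc B.lo B.hi, jump v B (B.pt t) ^ 2) := by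
    intro B hB
    set s := σ B / B.length ^ α with hs
    have hspos : 0 < s := div_pos (hσ0 B hB) (Real.rpow_pos_of_pos B.length_pos _)
    have hslow : 8 * C * (βp ^ 2 / βm) / T.h ≤ s := by
      calc 8 * C * (βp ^ 2 / βm) / T.h = 8 * C * (βp ^ 2 / βm) * (1 / T.h) := by ring
        _ ≤ 8 * C * (βp ^ 2 / βm) * (max 1 (T.h ^ (α - 1)) / B.length ^ α) := by
          exact mul_le_mul_of_nonneg_left (penalty_scaling B.length_pos B.length_le_h hα)
            (by positivity)
        _ = 8 * C * max 1 (T.h ^ (α - 1)) * (βp ^ 2 / βm) / B.length ^ α := by ring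
        _ ≤ s := by
          rw [hs]
          exact div_le_div_of_nonneg_right (hσ B hB) (Real.rpow_pos_of_pos B.length_pos _).le
    have hy := abs_integral_mul_le (hP.memLp_avgFlux (βm := βm) (βp := βp) hT B) (hP.memLp_jump B) hspos
    set I := ∫ t in Icc B.lo B.hi, avgFlux S βm βp v B (B.pt t) * jump v B (B.pt t)
    set F := ∫ t in Icc B.lo B.hi, avgFlux S βm βp v B (B.pt t) ^ 2 with hF
    have hEE : 0 ≤ energy T v B.fst + energy T v B.snd :=
      add_nonneg (energy_nonneg _ _) (energy_nonneg _ _)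
    have h1 : 1 / s * F ≤ βm / 16 * (energy T v B.fst + energy T v B.snd) := by
      calc 1 / s * F ≤ 1 / (8 * C * (βp ^ 2 / βm) / T.h) *
            (C * βp ^ 2 / T.h * (energy T v B.fst + energy T v B.snd) / 2) := by
            refine mul_le_mul ?_ (hflux B) (integral_nonneg fun _ => sq_nonneg _) (by positivity)
            exact one_div_le_one_div_of_le (by positivity) hslow
        _ = _ := by field_simp; ring
    have h2 : (1 - ε) * I ≤ 2 * |I| := by
      have := le_abs_self I
      have := abs_nonneg I
      rcases hε with rfl | rfl <;> linarith
    linarith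
  have hsum := Finset.sum_le_sum hterm
  rw [← Finset.mul_sum, Finset.sum_add_distrib, ← Finset.mul_sum, ← Finset.mul_sum] at hsum
  -- Four times `βm / 8` is half of the energy weight, so half of the energy and half of the penalty
  -- are left, in accordance with `k = 1 / 2`.
  have hadj := Mesh.sum_adjacent_le (T.sEdges S) (energy T v) (energy_nonneg v)
  have hEsum : ∑ K, βm * energy T v K ≤ ∑ K, ∫ p in T.cell K,
      coeff T S βm βp K p * inner ℝ (grad T K v p) (grad T K v p) :=
    Finset.sum_le_sum fun K _ => hE K
  have hadj' : βm / 8 * ∑ B ∈ T.sEdges S, (energy T v B.fst + energy T v B.snd)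
      ≤ 1 / 2 * ∑ K, βm * energy T v K := by
    rw [← Finset.mul_sum]
    have := mul_le_mul_of_nonneg_left hadj (by positivity : 0 ≤ βm / 8)
    linarith
  linarith

end

end SDG

end

/-! ### Unique solvability of the scheme -/

theorem theorem1 (Q : SDG.Rect) (S : SDG.Interface Q) (m : ℕ) (hm : 1 ≤ m)
    (hS : 3 ≤ m → ContDiff ℝ 3 S.g) (α : ℝ) (hα : 0 ≤ α) :
    (∀ T : SDG.Mesh Q, T.Admissible S →
      ∀ βm βp : ℝ, 0 < βm → βm ≤ βp →
      ∀ σ : T.Edge → ℝ, (∀ B ∈ T.sEdges S, 0 < σ B) →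
      ∀ f : SDG.Pt → ℝ, MemLp f 2 (volume.restrict Q.dom) →
        ∃! u, SDG.IsSolution S m βm βp 1 α σ f u) ∧
    (∀ c : ℝ, 0 < c → ∃ C : ℝ, 0 < C ∧
      ∀ T : SDG.Mesh Q, T.Admissible S → T.QuasiUniform c →
      ∀ βm βp : ℝ, 0 < βm → βm ≤ βp →
      ∀ ε : ℝ, ε = 0 ∨ ε = -1 →
      ∀ σ : T.Edge → ℝ,
        (∀ B ∈ T.sEdges S, C * max 1 (T.h ^ (α - 1)) * (βp ^ 2 / βm) ≤ σ B) →
      ∀ f : SDG.Pt → ℝ, MemLp f 2 (volume.restrict Q.dom) →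
        ∃! u, SDG.IsSolution S m βm βp ε α σ f u) := by
  refine ⟨fun T hT βm βp hβm hβ σ hσ f hf => ?_, fun c hc => ?_⟩
  · exact SDG.existsUnique_isSolution hm hS hT hβm hβ
      (fun v hv h0 => SDG.definite_of_eps_eq_one hm hS hT hβm hβ hσ hv h0) hf
  · obtain ⟨C, hC, H⟩ := S.exists_penalty hm hS hα hc
    exact ⟨C, hC, fun T hT hq βm βp hβm hβ ε hε σ hσ f hf =>
      SDG.existsUnique_isSolution hm hS hT hβm hβ (H T hT hq βm βp hβm hβ ε hε σ hσ) hf⟩
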